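/- Let $1\le i\le n$, $m\ge 0$, and let $\mathfrak{sl}_{n+1}(\mathbb C)=\mathfrak n^-\oplus\mathfrak h\oplus\mathfrak n^+$ be the standard triangular decomposition, $\mathfrak b=\mathfrak h\oplus\mathfrak n^+$, with positive roots $\alpha_{k,j}=\epsilon_k-\epsilon_{j+1}$ ($1\le k\le j\le n$), fundamental weight $\omega_i=\epsilon_1+\dots+\epsilon_i$, and root vectors $f_{\alpha_{k,j}}=E_{j+1,k}$, $e_{\alpha_{k,j}}=E_{k,j+1}$. Let $V(m\omega_i)$ be the simple finite-dimensional module of highest weight $m\omega_i$ with highest weight vector $v_m\neq 0$. Let $w\in S_{n+1}$ (acting by $w(\epsilon_a)=\epsilon_{w(a)}$) be of minimal length in its coset $w\,\mathrm{Stab}(\omega_i)$, and let $v_{w(m\omega_i)}\ne 0$ be a vector of weight $w(m\omega_i)$ in $V(m\omega_i)$. Put $R^-_w=w^{-1}(R^-)\cap R^+$ and $\mathfrak n^-_w=\langle f_\alpha\mid\alpha\in R^-_w\rangle\subset\mathfrak n^-$. For $1\le k\le i$ let $\ell_k$ be the maximum of $\{i-1\}\cup\{j\mid i\le j\le n,\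 \alpha_{k,j}\in R^-_w\}$. Let $\mathcal P_{\underline\ell_w}$ be the poset of the elements $x_{k,j}$, $1\le k\le i\le j\le \ell_k$, with $x_{k_1,j_1}\ge x_{k_2,j_2}$ iff $k_1\le k_2$ and $j_1\ge j_2$; it is identified with $R^-_w$ via $\alpha_{k,j}\leftrightarrow x_{k,j}$. Let $\mathcal C_{\underline\ell_w}$ be its chain polytope, i.e. the set of all nonnegative real families $(s_{k,j})$ whose sum over every chain is at most $1$; let $N=|R^-_w|$. For a Lie algebra $\mathfrak u$ and a cyclic module $M=U(\mathfrak u).v$ let $M_s$ be the span of all $x_1\cdots x_r.v$ with $r\le s$ and $x_1,\dots,x_r\in\mathfrak u$, and let $M^a=\bigoplus_s M_s/M_{s-1}$ be the associated graded module over the symmetric algebra $S(\mathfrak u)$. This defines the $S(\mathfrak n^-_w)$-module $(U(\mathfrak n^-_w).v_m)^a$ and, for the Demazure module $V_w(m\omega_i)=U(\mathfrak b).v_{w(m\omega_i)}$, the $S(\mathfrak b)$-module $V_w(m\omega_i)^a$. Let $I_{m,w}\subset S(\mathfrak n^-_w)$ be the annihilator of the class of $v_m$, so that $(U(\mathfrak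 n^-_w).v_m)^a\cong S(\mathfrak n^-_w)/I_{m,w}$. Finally $U(\mathfrak n^+)$ acts on $S(\mathfrak n^-)$ by letting each element of $\mathfrak n^+$ act as the derivation extending the adjoint action on $\mathfrak n^-\cong\mathfrak{sl}_{n+1}/\mathfrak b$. Then: 1. The elements $\prod_{\alpha\in R^-_w}f_\alpha^{s_\alpha}.v_m$, $\mathbf s\in m\mathcal C_{\underline\ell_w}\cap\mathbb Z^N$, form a basis of $(U(\mathfrak n^-_w).v_m)^a$. 2. The elements $\prod_{\alpha\in R^-_w}e_{-w(\alpha)}^{s_\alpha}.v_{w(m\omega_i)}$, $\mathbf s\in m\mathcal C_{\underline\ell_w}\cap\mathbb Z^N$, form a basis of $V_w(m\omega_i)^a$. 3. The ideal $I_{m,w}$ of $S(\mathfrak n^-_w)$ is generated by $S(\mathfrak n^-_w)\cap\bigcup_{\alpha\in R^-_w}U(\mathfrak n^+).f_\alpha^{m+1}$, and likewise by $S(\mathfrak n^-_w)\cap\sum_{\alpha\in R^-_w}U(\mathfrak n^+).f_\alpha^{m+1}$. -/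

import Mathlib

open scoped DirectSum Pointwise

attribute [local instance 100] LieRing.ofAssociativeRing

noncomputable section

/-! ### Symmetric algebras: extension of commuting operators and of derivations -/

namespace PBW

section Sym

variable (k : Type*) [CommRing k] {N : Type*} [AddCommGroup N] [Module k N]

/-- Pairwise commuting operators depending linearly on `x : N` extend to an action of `S(N)`. -/
def symLift {G : Type*} [AddCommGroup G] [Module k G] (φ : N →ₗ[k] Module.End k G)
    (hφ : ∀ x y, φ x * φ y = φ y * φ x) : SymmetricAlgebra k N →ₐ[k] Module.End k G :=
  RingCon.liftₐ _ (TensorAlgebra.lift k φ) (by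
    refine RingCon.ringConGen_le.2 fun x y h => ?_
    induction h with
    | mul_comm x y =>
      rw [RingCon.ker_apply, map_mul, map_mul]
      change TensorAlgebra.lift k φ (TensorAlgebra.ι k x) *
          TensorAlgebra.lift k φ (TensorAlgebra.ι k y) =
        TensorAlgebra.lift k φ (TensorAlgebra.ι k y) *
          TensorAlgebra.lift k φ (TensorAlgebra.ι k x)
      rw [TensorAlgebra.lift_ι_apply, TensorAlgebra.lift_ι_apply]
      exact hφ x y)

theorem symLift_ι {G : Type*} [AddCommGroup G] [Module k G] (φ : N →ₗ[k] Module.End k G)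
    (hφ : ∀ x y, φ x * φ y = φ y * φ x) (x : N) :
    symLift k φ hφ (SymmetricAlgebra.ι k N x) = φ x :=
  TensorAlgebra.lift_ι_apply φ x

/-- The algebra map `S(N) → S(N)[ε]`, `x ↦ x + ε φ(x)`, whose `ε`-part is the derivation
extending `φ`. -/
def symDualNumber (φ : N →ₗ[k] N) :
    SymmetricAlgebra k N →ₐ[k] TrivSqZeroExt (SymmetricAlgebra k N) (SymmetricAlgebra k N) :=
  SymmetricAlgebra.lift
    ((TrivSqZeroExt.inlAlgHom k (SymmetricAlgebra k N) (SymmetricAlgebra k N)).toLinearMap ∘ₗ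
        SymmetricAlgebra.ι k N +
      ((TrivSqZeroExt.inrHom (SymmetricAlgebra k N) (SymmetricAlgebra k N)).restrictScalars k) ∘ₗ
        SymmetricAlgebra.ι k N ∘ₗ φ)

theorem fst_symDualNumber (φ : N →ₗ[k] N) (p : SymmetricAlgebra k N) :
    (symDualNumber k φ p).fst = p := by
  have h : (TrivSqZeroExt.fstHom k (SymmetricAlgebra k N) (SymmetricAlgebra k N)).comp
      (symDualNumber k φ) = AlgHom.id k _ := by
    ext x
    simp [symDualNumber]
  exact congrArg (fun F => F p) h

/-- The unique derivation of `S(N)` which restricts to the linear map `φ` on `N`. -/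
def symDerivation (φ : N →ₗ[k] N) :
    Derivation k (SymmetricAlgebra k N) (SymmetricAlgebra k N) where
  toFun p := (symDualNumber k φ p).snd
  map_add' p q := by simp
  map_smul' c p := by simp
  map_one_eq_zero' := by simp
  leibniz' p q := by
    simp [fst_symDualNumber, mul_comm]

@[simp]
theorem symDerivation_ι (φ : N →ₗ[k] N) (x : N) :
    symDerivation k φ (SymmetricAlgebra.ι k N x) = SymmetricAlgebra.ι k N (φ x) := by
  change (symDualNumber k φ (SymmetricAlgebra.ι k N x)).snd = _
  simp [symDualNumber]

theorem symDerivation_ext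
    {D₁ D₂ : Derivation k (SymmetricAlgebra k N) (SymmetricAlgebra k N)}
    (h : ∀ x, D₁ (SymmetricAlgebra.ι k N x) = D₂ (SymmetricAlgebra.ι k N x)) : D₁ = D₂ := by
  ext p
  induction p using SymmetricAlgebra.induction with
  | algebraMap r => simp
  | ι x => exact h x
  | mul a b ha hb => simp [ha, hb]
  | add a b ha hb => simp [ha, hb]

theorem symDerivation_add (φ ψ : N →ₗ[k] N) :
    symDerivation k (φ + ψ) = symDerivation k φ + symDerivation k ψ :=
  symDerivation_ext k fun x => by simp

theorem symDerivation_smul (c : k) (φ : N →ₗ[k] N) :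
    symDerivation k (c • φ) = c • symDerivation k φ :=
  symDerivation_ext k fun x => by simp

theorem symDerivation_commutator (φ ψ : N →ₗ[k] N) :
    symDerivation k (φ ∘ₗ ψ - ψ ∘ₗ φ) = ⁅symDerivation k φ, symDerivation k ψ⁆ :=
  symDerivation_ext k fun x => by simp [Derivation.commutator_apply]

variable (N) in
/-- The representation of `End(N)` on `S(N)` by derivations. -/
def symDerivationRep : Module.End k N →ₗ⁅k⁆ Module.End k (SymmetricAlgebra k N) where
  toFun φ := (symDerivation k φ).toLinearMap
  map_add' φ ψ := congrArg (fun D => D.toLinearMap) (symDerivation_add k φ ψ)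
  map_smul' c φ := congrArg (fun D => D.toLinearMap) (symDerivation_smul k c φ)
  map_lie' {φ ψ} := (congrArg (fun D => D.toLinearMap) (symDerivation_commutator k φ ψ)).trans
    Derivation.commutator_coe_linear_map

end Sym

/-! ### The PBW filtration and PBW-graded cyclic modules -/

section Graded

variable (k : Type*) [CommRing k] (L : Type*) [LieRing L] [LieAlgebra k L]
  {M : Type*} [AddCommGroup M] [Module k M] [LieRingModule L M] [LieModule k L M]

/-- `U(L)_s`, the span of all products of at most `s` elements of `L`. -/
def envFiltration (s : ℕ) : Submodule k (UniversalEnvelopingAlgebra k L) :=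
  Submodule.span k {x | ∃ l : List L, l.length ≤ s ∧
    x = (l.map (UniversalEnvelopingAlgebra.ι k)).prod}

/-- The map `U(L) → M`, `u ↦ u.v`. -/
def orbitMap (v : M) : UniversalEnvelopingAlgebra k L →ₗ[k] M :=
  (LinearMap.applyₗ v).comp
    (UniversalEnvelopingAlgebra.lift k (LieModule.toEnd k L M)).toLinearMap

/-- The PBW filtration `U(L)_s.v` of the cyclic `L`-module `U(L).v`. -/
def filtration (v : M) (s : ℕ) : Submodule k M :=
  (envFiltration k L s).map (orbitMap k L v)

/-- The previous step `U(L)_{s-1}.v` of the PBW filtration, which is `0` for `s = 0`. -/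
def filtrationPred (v : M) : ℕ → Submodule k M
  | 0 => ⊥
  | s + 1 => filtration k L v s

/-- The degree `s` part `U(L)_s.v / U(L)_{s-1}.v`. -/
abbrev Component (v : M) (s : ℕ) : Type _ :=
  filtration k L v s ⧸ (filtrationPred k L v s).submoduleOf (filtration k L v s)

/-- The PBW-graded module `(U(L).v)^a`. -/
def Gr (v : M) : Type _ := ⨁ s, Component k L v s

instance (v : M) : AddCommGroup (Gr k L v) :=
  inferInstanceAs (AddCommGroup (⨁ s, Component k L v s))

instance (v : M) : Module k (Gr k L v) :=
  inferInstanceAs (Module k (⨁ s, Component k L v s))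

variable {k L}

theorem mem_filtration_self (v : M) : v ∈ filtration k L v 0 :=
  ⟨1, Submodule.subset_span ⟨[], by simp, by simp⟩, by simp [orbitMap]⟩

theorem lie_mem_filtration (v : M) (s : ℕ) (x : L) {y : M} (hy : y ∈ filtration k L v s) :
    ⁅x, y⁆ ∈ filtration k L v (s + 1) := by
  obtain ⟨u, hu, rfl⟩ := hy
  refine ⟨UniversalEnvelopingAlgebra.ι k x * u, ?_, ?_⟩
  · induction hu using Submodule.span_induction with
    | mem u hu =>
      obtain ⟨l, hl, rfl⟩ := hu
      exact Submodule.subset_span ⟨x :: l, by simpa using hl, by simp⟩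
    | zero => simp
    | add a b _ _ ha hb => rw [mul_add]; exact Submodule.add_mem _ ha hb
    | smul c a _ ha => rw [mul_smul_comm]; exact Submodule.smul_mem _ _ ha
  · have h := UniversalEnvelopingAlgebra.lift_ι_apply k (LieModule.toEnd k L M) x
    simp only [orbitMap, LinearMap.comp_apply, AlgHom.toLinearMap_apply, map_mul, h,
      LinearMap.applyₗ_apply_apply, Module.End.mul_apply, LieModule.toEnd_apply_apply]

theorem lie_mem_filtrationPred (v : M) (s : ℕ) (x : L) {y : M}
    (hy : y ∈ filtrationPred k L v s) : ⁅x, y⁆ ∈ filtrationPred k L v (s + 1) := by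
  cases s with
  | zero =>
    have : y = 0 := by simpa [filtrationPred] using hy
    subst this
    simp
  | succ s => exact lie_mem_filtration v s x hy

/-- Action of `x ∈ L` as a map from degree `s` to degree `s + 1`. -/
def raise (v : M) (s : ℕ) : L →ₗ[k] Component k L v s →ₗ[k] Component k L v (s + 1) where
  toFun x := Submodule.mapQ _ _
    ((LieModule.toEnd k L M x).restrict (p := filtration k L v s) (q := filtration k L v (s + 1))
      (fun _ hy => lie_mem_filtration v s x hy))
    (fun y hy => lie_mem_filtrationPred v s x (y := (y : M)) hy)
  map_add' x y := by
    refine LinearMap.ext fun z => ?_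
    obtain ⟨z, rfl⟩ := Submodule.Quotient.mk_surjective _ z
    refine congrArg (Submodule.Quotient.mk (p := (filtrationPred k L v (s + 1)).submoduleOf
      (filtration k L v (s + 1)))) (Subtype.ext ?_)
    exact add_lie x y (z : M)
  map_smul' c x := by
    refine LinearMap.ext fun z => ?_
    obtain ⟨z, rfl⟩ := Submodule.Quotient.mk_surjective _ z
    refine congrArg (Submodule.Quotient.mk (p := (filtrationPred k L v (s + 1)).submoduleOf
      (filtration k L v (s + 1)))) (Subtype.ext ?_)
    exact smul_lie c x (z : M)

theorem raise_comm (v : M) (s : ℕ) (x y : L) (z : Component k L v s) :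
    raise v (s + 1) x (raise v s y z) = raise v (s + 1) y (raise v s x z) := by
  obtain ⟨z, rfl⟩ := Submodule.Quotient.mk_surjective _ z
  change Submodule.Quotient.mk _ = Submodule.Quotient.mk _
  rw [Submodule.Quotient.eq]
  change ⁅x, ⁅y, (z : M)⁆⁆ - ⁅y, ⁅x, (z : M)⁆⁆ ∈ filtration k L v (s + 1)
  have h : ⁅x, ⁅y, (z : M)⁆⁆ - ⁅y, ⁅x, (z : M)⁆⁆ = ⁅⁅x, y⁆, (z : M)⁆ := by
    rw [lie_lie]
  rw [h]
  exact lie_mem_filtration v s _ z.2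

/-- The action of `x ∈ L` on `(U(L).v)^a`, on the underlying direct sum. -/
def sumOp (v : M) (x : L) : (⨁ s, Component k L v s) →ₗ[k] ⨁ s, Component k L v s :=
  DirectSum.toModule k ℕ _ fun s =>
    DirectSum.lof k ℕ (fun s => Component k L v s) (s + 1) ∘ₗ raise v s x

theorem sumOp_lof (v : M) (x : L) (s : ℕ) (z : Component k L v s) :
    sumOp v x (DirectSum.lof k ℕ (fun s => Component k L v s) s z) =
      DirectSum.lof k ℕ (fun s => Component k L v s) (s + 1) (raise v s x z) := by
  rw [sumOp, DirectSum.toModule_lof]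
  rfl

/-- The action of `x ∈ L` on `(U(L).v)^a`. -/
def grOp (v : M) : L →ₗ[k] Module.End k (Gr k L v) where
  toFun x := sumOp v x
  map_add' x y := by
    refine DirectSum.linearMap_ext k fun s => LinearMap.ext fun z => ?_
    change sumOp v (x + y) (DirectSum.lof k ℕ (fun s => Component k L v s) s z) =
      sumOp v x (DirectSum.lof k ℕ (fun s => Component k L v s) s z) +
      sumOp v y (DirectSum.lof k ℕ (fun s => Component k L v s) s z)
    rw [sumOp_lof, sumOp_lof, sumOp_lof, map_add, LinearMap.add_apply, map_add]
  map_smul' c x := by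
    refine DirectSum.linearMap_ext k fun s => LinearMap.ext fun z => ?_
    change sumOp v (c • x) (DirectSum.lof k ℕ (fun s => Component k L v s) s z) =
      c • sumOp v x (DirectSum.lof k ℕ (fun s => Component k L v s) s z)
    rw [sumOp_lof, sumOp_lof, map_smul, LinearMap.smul_apply, map_smul]

theorem grOp_comm (v : M) (x y : L) : grOp (k := k) v x * grOp v y = grOp v y * grOp v x := by
  refine DirectSum.linearMap_ext k fun s => LinearMap.ext fun z => ?_
  change sumOp v x (sumOp v y (DirectSum.lof k ℕ (fun s => Component k L v s) s z)) =
    sumOp v y (sumOp v x (DirectSum.lof k ℕ (fun s => Component k L v s) s z))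
  rw [sumOp_lof, sumOp_lof, sumOp_lof, sumOp_lof, raise_comm]

/-- The `S(L)`-module structure of the PBW-graded module `(U(L).v)^a`. -/
instance (v : M) : Module (SymmetricAlgebra k L) (Gr k L v) :=
  Module.compHom (Gr k L v) (symLift k (grOp v) (grOp_comm v)).toRingHom

variable (k L)

/-- The class of the cyclic generator `v` in degree `0` of `(U(L).v)^a`. -/
def grGen (v : M) : Gr k L v :=
  DirectSum.lof k ℕ (fun s => Component k L v s) 0
    (Submodule.Quotient.mk ⟨v, mem_filtration_self v⟩)

end Graded

/-! ### The Lie algebra `sl_{n+1}`, its roots, weights and Weyl group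

Indices `a, b : Fin (n + 1)` start at `0`.  The positive roots of `sl_{n+1}` are the pairs
`(a, b)` with `a < b`; in the usual numbering starting at `1` the pair `(a, b)` is the root
`ε_{a+1} - ε_{b+1} = α_{a+1} + ⋯ + α_b = α_{a+1,b}`. -/

section TypeA

/-- The Lie algebra `sl_{n+1}(ℂ)`. -/
abbrev SL (n : ℕ) := LieAlgebra.SpecialLinear.sl (Fin (n + 1)) ℂ

variable {n : ℕ}

/-- The Lie subalgebra of all matrices in `sl_{n+1}` whose nonzero entries are at positions
`(x, y)` with `r x y`, for a transitive relation `r`. -/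
def supported (r : Fin (n + 1) → Fin (n + 1) → Prop) (hr : ∀ x y z, r x y → r y z → r x z) :
    LieSubalgebra ℂ (SL n) where
  carrier := {A | ∀ x y, ¬ r x y → A.1 x y = 0}
  zero_mem' x y _ := rfl
  add_mem' {A B} hA hB x y h := by
    change A.1 x y + B.1 x y = 0
    rw [hA x y h, hB x y h, add_zero]
  smul_mem' c A hA x y h := by
    change c * A.1 x y = 0
    rw [hA x y h, mul_zero]
  lie_mem' {A B} hA hB x y h := by
    have key : ∀ C D : SL n, (∀ x y, ¬ r x y → C.1 x y = 0) → (∀ x y, ¬ r x y → D.1 x y = 0) →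
        (C.1 * D.1) x y = 0 := by
      intro C D hC hD
      rw [Matrix.mul_apply]
      refine Finset.sum_eq_zero fun z _ => ?_
      by_cases h1 : r x z
      · by_cases h2 : r z y
        · exact absurd (hr x z y h1 h2) h
        · rw [hD z y h2, mul_zero]
      · rw [hC x z h1, zero_mul]
    rw [LieAlgebra.SpecialLinear.sl_bracket, Matrix.sub_apply, key A B hA hB, key B A hB hA,
      sub_zero]

/-- `𝔫⁺`: strictly upper triangular matrices. -/
def nPlus (n : ℕ) : LieSubalgebra ℂ (SL n) :=
  supported (fun x y => x < y) (fun _ _ _ => lt_trans)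

/-- `𝔫⁻`: strictly lower triangular matrices. -/
def nMinus (n : ℕ) : LieSubalgebra ℂ (SL n) :=
  supported (fun x y => y < x) (fun _ _ _ h h' => lt_trans h' h)

/-- `𝔟 = 𝔥 ⊕ 𝔫⁺`: upper triangular matrices of trace zero. -/
def borel (n : ℕ) : LieSubalgebra ℂ (SL n) :=
  supported (fun x y => x ≤ y) (fun _ _ _ => le_trans)

/-- The Weyl group, acting on weights by `w(ε_a) = ε_{w(a)}`. -/
abbrev Weyl (n : ℕ) := Equiv.Perm (Fin (n + 1))

/-- `R⁻_w = w⁻¹(R⁻) ∩ R⁺`, the positive roots `(a, b)` (that is, `ε_a - ε_b` with `a < b`)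
such that `w(ε_a - ε_b) = ε_{w(a)} - ε_{w(b)}` is a negative root. -/
abbrev RootsNeg (w : Weyl n) : Type :=
  {α : Fin (n + 1) × Fin (n + 1) // α.1 < α.2 ∧ w α.2 < w α.1}

/-- `𝔫⁻_w = 𝔫⁻ ∩ w⁻¹ 𝔫⁺ w`, the matrices supported at the positions `(b, a)` of the root vectors
`f_α` with `α = (a, b) ∈ R⁻_w`. -/
def nMinusW (w : Weyl n) : LieSubalgebra ℂ (SL n) :=
  supported (fun x y => y < x ∧ w x < w y)
    (fun _ _ _ h h' => ⟨lt_trans h'.1 h.1, lt_trans h.2 h'.2⟩)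

theorem nMinusW_le (w : Weyl n) : nMinusW w ≤ nMinus n :=
  fun _ hA x y h => hA x y fun h' => h h'.1

/-- The matrix unit `E_{a,b}`, `a ≠ b`, in `sl_{n+1}`.  It is the root vector of `ε_a - ε_b`. -/
def unit (a b : Fin (n + 1)) (h : a ≠ b) : SL n :=
  LieAlgebra.SpecialLinear.single a b h 1

theorem unit_mem {r : Fin (n + 1) → Fin (n + 1) → Prop} (hr : ∀ x y z, r x y → r y z → r x z)
    {a b : Fin (n + 1)} (h : a ≠ b) (hab : r a b) : unit a b h ∈ supported r hr := by
  intro x y hxy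
  change Matrix.single a b (1 : ℂ) x y = 0
  rw [Matrix.single_apply, if_neg]
  rintro ⟨rfl, rfl⟩
  exact hxy hab

/-- `f_α = E_{b,a} ∈ 𝔫⁻_w` for `α = (a, b) ∈ R⁻_w`. -/
def fRoot (w : Weyl n) (α : RootsNeg w) : nMinusW w :=
  ⟨unit α.1.2 α.1.1 α.2.1.ne', unit_mem _ _ α.2⟩

/-- For `α = (a, b) ∈ R⁻_w`, the root `-w(α) = ε_{w(b)} - ε_{w(a)}` is positive, and
`e_{-w(α)} = E_{w(b),w(a)} ∈ 𝔟` is its root vector. -/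
def eRoot (w : Weyl n) (α : RootsNeg w) : borel n :=
  ⟨unit (w α.1.2) (w α.1.1) α.2.2.ne, unit_mem _ _ α.2.2.le⟩

/-- Integral weights `∑ μ_a ε_a`, given by their coefficients. -/
abbrev Weight (n : ℕ) := Fin (n + 1) → ℤ

/-- The fundamental weight `ω_i = ε_1 + ⋯ + ε_i`. -/
def fundWeight (n i : ℕ) : Weight n := fun a => if (a : ℕ) < i then 1 else 0

/-- The action of the Weyl group on weights, `w(∑ μ_a ε_a) = ∑ μ_a ε_{w(a)}`. -/
def actWeight (w : Weyl n) (μ : Weight n) : Weight n := fun a => μ (w⁻¹ a)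

/-- The simple reflection exchanging the `j`-th and the `(j+1)`-st index. -/
def simpleRefl (j : Fin n) : Weyl n := Equiv.swap j.castSucc j.succ

/-- The length of `w`: least number of factors in an expression of `w` as a product of simple
reflections. -/
def length (w : Weyl n) : ℕ :=
  sInf {r | ∃ l : List (Fin n), l.length = r ∧ (l.map simpleRefl).prod = w}

/-- `w` has minimal length in its coset `w Stab_W(ω_i)`, that is, `w ∈ W^i`. -/
def IsMinimalRep (i : ℕ) (w : Weyl n) : Prop :=
  ∀ τ : Weyl n, actWeight τ (fundWeight n i) = fundWeight n i → length w ≤ length (w * τ)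

section Modules

variable {V : Type*} [AddCommGroup V] [Module ℂ V] [LieRingModule (SL n) V]

/-- `v` lies in the weight space of weight `μ`. -/
def HasWeight (μ : Weight n) (v : V) : Prop :=
  ∀ h : SL n, h.1.IsDiag → ⁅h, v⁆ = (∑ a, (μ a : ℂ) * h.1 a a) • v

/-- `v` is a highest weight vector of weight `μ`. -/
structure IsHighestWeightVector (μ : Weight n) (v : V) : Prop where
  ne_zero : v ≠ 0
  weight : HasWeight μ v
  nPlus_lie : ∀ x ∈ nPlus n, ⁅x, v⁆ = 0

end Modules

/-! ### The action of `𝔫⁺` on `S(𝔫⁻)` -/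

/-- The projection `sl_{n+1} = 𝔫⁻ ⊕ 𝔟 → 𝔫⁻`. -/
def lowerPart : SL n →ₗ[ℂ] nMinus n where
  toFun A := ⟨⟨Matrix.of fun x y => if y < x then A.1 x y else 0, by
    refine LinearMap.mem_ker.2 ((Matrix.traceLinearMap_apply _ _ _ _).trans ?_)
    exact Finset.sum_eq_zero fun x _ => if_neg (lt_irrefl x)⟩, fun x y h => by
      change (if y < x then A.1 x y else 0) = 0
      exact if_neg h⟩
  map_add' A B := by
    ext x y
    change (if y < x then A.1 x y + B.1 x y else 0) =
      (if y < x then A.1 x y else 0) + (if y < x then B.1 x y else 0)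
    split_ifs <;> simp
  map_smul' c A := by
    ext x y
    change (if y < x then c * A.1 x y else 0) = c * (if y < x then A.1 x y else 0)
    split_ifs <;> simp

theorem lowerPart_lie_lowerPart (e : nPlus n) (A : SL n) :
    lowerPart ⁅(e : SL n), ((lowerPart A : nMinus n) : SL n)⁆ = lowerPart ⁅(e : SL n), A⁆ := by
  have he : ∀ x y, ¬ x < y → e.1.1 x y = 0 := e.2
  have key : ∀ x y : Fin (n + 1), y < x →
      ⁅(e : SL n), ((lowerPart A : nMinus n) : SL n)⁆.1 x y = ⁅(e : SL n), A⁆.1 x y := by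
    intro x y hyx
    simp only [LieAlgebra.SpecialLinear.sl_bracket, Matrix.sub_apply, Matrix.mul_apply]
    congr 1
    · refine Finset.sum_congr rfl fun z _ => ?_
      change e.1.1 x z * (if y < z then A.1 z y else 0) = e.1.1 x z * A.1 z y
      split_ifs with h
      · rfl
      · rw [he x z (fun h' => h (hyx.trans h')), zero_mul, zero_mul]
    · refine Finset.sum_congr rfl fun z _ => ?_
      change (if z < x then A.1 x z else 0) * e.1.1 z y = A.1 x z * e.1.1 z y
      split_ifs with h
      · rfl
      · rw [he z y (fun h' => h (h'.trans hyx)), mul_zero, mul_zero]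
  ext x y
  change (if y < x then _ else (0 : ℂ)) = (if y < x then _ else (0 : ℂ))
  split_ifs with h
  · exact key x y h
  · rfl

/-- The action of `e ∈ 𝔫⁺` on `𝔫⁻ = sl_{n+1} / 𝔟`: the `𝔫⁻`-part of the bracket. On root vectors it
sends `f_β` to a nonzero multiple of `f_{β-α}` if `e = e_α` and `β - α` is a positive root, and
to `0` otherwise. -/
def deltaLin (e : nPlus n) : nMinus n →ₗ[ℂ] nMinus n :=
  lowerPart ∘ₗ (LieAlgebra.ad ℂ (SL n) (e : SL n)).comp (nMinus n).subtype

theorem deltaLin_apply (e : nPlus n) (f : nMinus n) :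
    deltaLin e f = lowerPart ⁅(e : SL n), (f : SL n)⁆ := rfl

theorem deltaLin_add (e e' : nPlus n) : deltaLin (e + e') = deltaLin e + deltaLin e' := by
  refine LinearMap.ext fun x => ?_
  exact (congrArg lowerPart (add_lie (e : SL n) (e' : SL n) (x : SL n))).trans
    (lowerPart.map_add _ _)

theorem deltaLin_smul (c : ℂ) (e : nPlus n) : deltaLin (c • e) = c • deltaLin e := by
  refine LinearMap.ext fun x => ?_
  exact (congrArg lowerPart (smul_lie c (e : SL n) (x : SL n))).trans (lowerPart.map_smul _ _)

theorem deltaLin_lie (e e' : nPlus n) : deltaLin ⁅e, e'⁆ =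
    deltaLin e ∘ₗ deltaLin e' - deltaLin e' ∘ₗ deltaLin e := by
  refine LinearMap.ext fun x => ?_
  have h1 : deltaLin ⁅e, e'⁆ x = lowerPart (⁅(e : SL n), ⁅(e' : SL n), (x : SL n)⁆⁆ -
      ⁅(e' : SL n), ⁅(e : SL n), (x : SL n)⁆⁆) :=
    congrArg lowerPart (lie_lie (e : SL n) (e' : SL n) (x : SL n))
  rw [h1, lowerPart.map_sub, ← lowerPart_lie_lowerPart e ⁅(e' : SL n), (x : SL n)⁆,
    ← lowerPart_lie_lowerPart e' ⁅(e : SL n), (x : SL n)⁆]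
  rfl

/-- The representation of `𝔫⁺` on `𝔫⁻ = sl_{n+1} / 𝔟`. -/
def deltaRep (n : ℕ) : nPlus n →ₗ⁅ℂ⁆ Module.End ℂ (nMinus n) where
  toFun e := deltaLin e
  map_add' e e' := deltaLin_add e e'
  map_smul' c e := deltaLin_smul c e
  map_lie' {e e'} := deltaLin_lie e e'

/-- The representation of `𝔫⁺` on `S(𝔫⁻)` by derivations. -/
def delta (n : ℕ) : nPlus n →ₗ⁅ℂ⁆ Module.End ℂ (SymmetricAlgebra ℂ (nMinus n)) :=
  (symDerivationRep ℂ (nMinus n)).comp (deltaRep n)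

/-- The action `u.p` of `u ∈ U(𝔫⁺)` on `p ∈ S(𝔫⁻)`. -/
def nPlusAct (u : UniversalEnvelopingAlgebra ℂ (nPlus n)) (p : SymmetricAlgebra ℂ (nMinus n)) :
    SymmetricAlgebra ℂ (nMinus n) :=
  UniversalEnvelopingAlgebra.lift ℂ (delta n) u p

/-- The inclusion `S(𝔫⁻_w) ⊆ S(𝔫⁻)`. -/
def symIncl (w : Weyl n) :
    SymmetricAlgebra ℂ (nMinusW w) →ₐ[ℂ] SymmetricAlgebra ℂ (nMinus n) :=
  SymmetricAlgebra.lift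
    (SymmetricAlgebra.ι ℂ (nMinus n) ∘ₗ
      ((LieSubalgebra.inclusion (nMinusW_le w) : nMinusW w →ₗ⁅ℂ⁆ nMinus n) :
        nMinusW w →ₗ[ℂ] nMinus n))

/-- The union of the sets `U(𝔫⁺).f_α^{m+1} ⊆ S(𝔫⁻)`, `α ∈ R⁻_w`. -/
def relations (w : Weyl n) (m : ℕ) : Set (SymmetricAlgebra ℂ (nMinus n)) :=
  {p | ∃ (α : RootsNeg w) (u : UniversalEnvelopingAlgebra ℂ (nPlus n)),
    p = nPlusAct u (symIncl w (SymmetricAlgebra.ι ℂ _ (fRoot w α) ^ (m + 1)))}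

/-! ### Posets and chain polytopes -/

/-- The chain polytope of a poset: nonnegative functions whose sum over each finite chain is at
most `1`. -/
def chainPolytope (P : Type*) [PartialOrder P] : Set (P → ℝ) :=
  {x | (∀ p, 0 ≤ x p) ∧ ∀ c : Finset P, IsChain (· ≤ ·) (c : Set P) → ∑ p ∈ c, x p ≤ 1}

/-- The poset `P_ℓ` with elements `x_{k,j}`, `1 ≤ k ≤ i`, `i ≤ j ≤ ℓ_k`, and
`x_{k₁,j₁} ≥ x_{k₂,j₂}` iff `k₁ ≤ k₂` and `j₁ ≥ j₂`; the element `x_{k,j}` is the pair `(k, j)`, and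
the order is the product order with the order of the first factor reversed. -/
abbrev PosetL (i : ℕ) (ℓ : ℕ → ℕ) : Type :=
  {x : ℕᵒᵈ × ℕ // 1 ≤ OrderDual.ofDual x.1 ∧ OrderDual.ofDual x.1 ≤ i ∧
    i ≤ x.2 ∧ x.2 ≤ ℓ (OrderDual.ofDual x.1)}

open Classical in
/-- The sequence `ℓ_w`: `ℓ_k` is the largest of `i - 1` and all `j ≥ i` with `α_{k,j} ∈ R⁻_w`.
(The root `α_{k,j}` is the pair `(a, b)` with `a + 1 = k` and `b = j`.) -/
def ellSeq (i : ℕ) (w : Weyl n) (k : ℕ) : ℕ :=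
  max (i - 1) ((Finset.univ.filter fun α : RootsNeg w =>
    (α.1.1 : ℕ) + 1 = k ∧ i ≤ (α.1.2 : ℕ)).sup fun α => (α.1.2 : ℕ))

/-- The lattice points of the dilated chain polytope `m C_{ℓ_w}` (their coordinates are
nonnegative, so they are families of natural numbers). -/
abbrev LatticePoints (i m : ℕ) (w : Weyl n) : Type :=
  {s : PosetL i (ellSeq i w) → ℕ //
    (fun x => (s x : ℝ)) ∈ (m : ℝ) • chainPolytope (PosetL i (ellSeq i w))}

open Classical in
/-- The coordinate `s_α` of `s`, `α ∈ R⁻_w`, under the identification `α_{p,q} ↔ x_{p,q}` of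
`R⁻_w` with `P_{ℓ_w}` (a bijection for `w ∈ W^i`, so that the default value `0` is not used). -/
def coordinate (i : ℕ) (w : Weyl n) (s : PosetL i (ellSeq i w) → ℕ) (α : RootsNeg w) : ℕ :=
  if h : 1 ≤ (α.1.1 : ℕ) + 1 ∧ (α.1.1 : ℕ) + 1 ≤ i ∧ i ≤ (α.1.2 : ℕ) ∧
      (α.1.2 : ℕ) ≤ ellSeq i w ((α.1.1 : ℕ) + 1)
  then s ⟨(OrderDual.toDual ((α.1.1 : ℕ) + 1), (α.1.2 : ℕ)), h⟩ else 0

/-- The monomial `f^s = ∏_{α ∈ R⁻_w} f_α^{s_α} ∈ S(𝔫⁻_w)`. -/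
def fMonomial (i : ℕ) (w : Weyl n) (s : PosetL i (ellSeq i w) → ℕ) :
    SymmetricAlgebra ℂ (nMinusW w) :=
  ∏ α : RootsNeg w, SymmetricAlgebra.ι ℂ (nMinusW w) (fRoot w α) ^ coordinate i w s α

/-- The monomial `∏_{α ∈ R⁻_w} e_{-w(α)}^{s_α} ∈ S(𝔟)`. -/
def eMonomial (i : ℕ) (w : Weyl n) (s : PosetL i (ellSeq i w) → ℕ) :
    SymmetricAlgebra ℂ (borel n) :=
  ∏ α : RootsNeg w, SymmetricAlgebra.ι ℂ (borel n) (eRoot w α) ^ coordinate i w s α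

variable {V : Type*} [AddCommGroup V] [Module ℂ V] [LieRingModule (SL n) V]
  [LieModule ℂ (SL n) V]

/-- `(U(𝔫⁻_w).v)^a`, a module over `S(𝔫⁻_w)`. -/
abbrev GrW (w : Weyl n) (v : V) : Type _ := Gr ℂ (nMinusW w) v

/-- The PBW-graded module `(U(𝔟).v)^a`, a module over `S(𝔟)`; for a vector `v` generating the
weight space of weight `w(λ)` of `V(λ)` it is the PBW-graded Demazure module `V_w(λ)^a`. -/
abbrev GrDemazure (v : V) : Type _ := Gr ℂ (borel n) v

/-- The defining ideal `I ⊆ S(𝔫⁻_w)`, the annihilator of the class of `v` in `(U(𝔫⁻_w).v)^a`, so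
that `(U(𝔫⁻_w).v)^a ≅ S(𝔫⁻_w) / I`. -/
abbrev definingIdeal (w : Weyl n) (v : V) : Ideal (SymmetricAlgebra ℂ (nMinusW w)) :=
  Ideal.torsionOf (SymmetricAlgebra ℂ (nMinusW w)) (GrW w v) (grGen ℂ (nMinusW w) v)

end TypeA

end PBW

end

/-!
The proof is carried by a family of vectors `f^s v` of `V = V(m ω_i)`. As `w` has minimal length in
its coset, every root `(a, b)` of `R⁻_w` satisfies `a ≤ i < b` in the numbering from `1`
(`IsMinimalRep.isBlock`), and together with a root `R⁻_w` contains every smaller pair of this form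
(`IsMinimalRep.mem_of_le`). Thus `𝔫⁻_w` is an abelian subalgebra of the lower left block,
the vectors `f^s v` (`orbitVec`) are defined without ordering the factors, and the filtration of
`U(𝔫⁻_w).v` is the filtration by the degree of `s`. It is enough to show that the `f^s v` for
admissible `s` (sum at most `m` over every chain, which are the lattice points of the dilated chain
polytope, `latticePointsEquiv`) are linearly independent, and that every `f^s v` is a combination of
admissible ones of the same degree; `IsMonomialOrbit.basis_gr` passes to the graded module.

*Linear independence* (`IsHighestWeightRep.linearIndependent`). The module `V` embeds into a
polynomial ring in the coordinates of `m` families of `i` vectors, with `v` going to the product of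
the minors of their first `i` coordinates (`exists_embedding`, `refVector`): the submodule of the
direct sum generated by these two vectors is a graph, which follows from the contravariance of the
Fischer form instead of complete reducibility. A specialization of the variables turns the action
of `f_α` into a partial derivative (`expEval_glDer`), so that the constant term of the image of
`f^s v` is, up to a factorial, the coefficient of `s` in a product of `m` minors. By the rearrangement
inequality, the diagonal is the leading term of a minor
(`isLeadingExponent_det`). An admissible `s` is a sum of `m` antichains
(`exists_sum_indicatorExponent`), hence the leading exponent of a suitable product of minors, and
the system is triangular.

*Spanning* (`symMonomial_mem_span_sup`). The relation `f_α^{m+1} v = 0`, differentiated by the root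
vectors of `𝔫⁺` in the diagonal blocks, gives the permanents of size `m + 1` with entries
below `α` (`symIncl_permSum_mem_relations`). If `s` is not admissible, then `f^s` contains a product
of `m + 1` factors along a chain, which is the term of smallest weight in such a permanent, again
by rearrangement; so `f^s` can be straightened.

*The ideal.* The permanents generate an ideal `permIdeal` which lies in `I_{m,w}` and in the ideal
generated by either set of relations. The relations, and their linear combinations, annihilate `v`
(`IsHighestWeightRep.blockAction_relations`): on the lower left block, the derivation of `S(𝔫⁻)`
given by `e ∈ 𝔫⁺` is the commutator with the diagonal blocks of `e`, which kill `v`. Since the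
admissible monomials span modulo the permanents, and their images are linearly independent both in
`V` and in the graded module, all these ideals coincide (`le_permIdeal`).

*The Demazure module.* Conjugation with `w` turns `v_{w(m ω_i)}` into a highest weight vector of
the twisted module (`IsHighestWeightRep.conjPerm`), `e_{-w(α)}` into `f_α`, and `𝔟` into `w⁻¹ 𝔟 w`,
the sum of `𝔫⁻_w` and a subalgebra of `𝔟`. The latter preserves the degree filtration
(`IsHighestWeightRep.apply_orbitVec_mem_degreeSpan`), so that the filtrations of the Demazure module
and of the module generated by `𝔫⁻_w` agree.
-/

noncomputable section

namespace PBW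

/-! ### Bases of PBW-graded cyclic modules -/

section GradedBasis

variable {k : Type*} [CommRing k] {L : Type*} [LieRing L] [LieAlgebra k L]
  {M : Type*} [AddCommGroup M] [Module k M] [LieRingModule L M] [LieModule k L M]

/-- The class in degree `d` of the PBW-graded module of an element of `U(L)_d.v`. -/
def grMk (v : M) (d : ℕ) : filtration k L v d →ₗ[k] Gr k L v :=
  DirectSum.lof k ℕ (fun s => Component k L v s) d ∘ₗ Submodule.mkQ _

theorem ι_smul_grMk (v : M) (d : ℕ) (x : L) (z : filtration k L v d) :
    SymmetricAlgebra.ι k L x • grMk v d z =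
      grMk v (d + 1) ⟨⁅x, (z : M)⁆, lie_mem_filtration v d x z.2⟩ := by
  change symLift k (grOp v) (grOp_comm v) (SymmetricAlgebra.ι k L x) (grMk v d z) = _
  rw [symLift_ι]
  exact sumOp_lof v x d _

theorem algebraMap_smul_gr (v : M) (c : k) (z : Gr k L v) :
    algebraMap k (SymmetricAlgebra k L) c • z = c • z := by
  change symLift k (grOp v) (grOp_comm v) (algebraMap k _ c) z = _
  rw [AlgHom.commutes]
  rfl

instance (v : M) : IsScalarTower k (SymmetricAlgebra k L) (Gr k L v) where
  smul_assoc c p z := by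
    rw [Algebra.smul_def, mul_smul, algebraMap_smul_gr]

/-- The component of degree `d` of an element of the PBW-graded module. -/
def grComponent (v : M) (d : ℕ) : Gr k L v →ₗ[k] Component k L v d :=
  DirectSum.component k ℕ (fun s => Component k L v s) d

theorem grComponent_grMk (v : M) (d : ℕ) (z : filtration k L v d) :
    grComponent v d (grMk v d z) = Submodule.Quotient.mk z :=
  DirectSum.component.lof_self k (M := fun s => Component k L v s) d _

theorem grComponent_grMk_of_ne (v : M) {d e : ℕ} (h : d ≠ e) (z : filtration k L v e) :
    grComponent v d (grMk v e z) = 0 := by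
  refine (DirectSum.component.of k (M := fun s => Component k L v s) d e _).trans ?_
  rw [dif_neg h.symm]

theorem grMk_eq_zero (v : M) (d : ℕ) {z : filtration k L v d}
    (hz : (z : M) ∈ filtrationPred k L v d) : grMk v d z = 0 := by
  have : Submodule.mkQ ((filtrationPred k L v d).submoduleOf (filtration k L v d)) z = 0 := by
    rw [Submodule.mkQ_apply, Submodule.Quotient.mk_eq_zero]
    exact hz
  exact (congrArg (DirectSum.lof k ℕ (fun s => Component k L v s) d) this).trans (map_zero _)

theorem iSup_range_grMk (v : M) :
    ⨆ d, LinearMap.range (grMk (k := k) (L := L) v d) = ⊤ := by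
  refine eq_top_iff.2 fun z _ => ?_
  induction z using DirectSum.induction_on with
  | zero => exact Submodule.zero_mem _
  | of d z =>
    obtain ⟨z, rfl⟩ := Submodule.Quotient.mk_surjective _ z
    exact Submodule.mem_iSup_of_mem d ⟨z, rfl⟩
  | add a b ha hb => exact Submodule.add_mem _ (ha trivial) (hb trivial)

variable {R : Type*}

theorem exists_eq_add_single_of_degree_eq_succ {s : R →₀ ℕ} {d : ℕ} (h : s.degree = d + 1) :
    ∃ (t : R →₀ ℕ) (a : R), s = t + Finsupp.single a 1 ∧ t.degree = d := by
  classical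
  obtain ⟨a, ha⟩ : ∃ a, s a ≠ 0 := by
    by_contra! h0
    have : s = 0 := Finsupp.ext h0
    simp [this] at h
  have hs : s = (s - Finsupp.single a 1) + Finsupp.single a 1 := by
    refine (tsub_add_cancel_of_le ?_).symm
    rw [Finsupp.single_le_iff]
    omega
  refine ⟨_, a, hs, ?_⟩
  rw [hs, map_add, Finsupp.degree_single] at h
  omega

variable {x : R → L} {v : M} {y : (R →₀ ℕ) → M}

/-- If `L` raises the spans of the `y t` with `|t| ≤ d` by at most one step, then they contain the
PBW filtration. -/
theorem filtration_le_span (h0 : y 0 = v)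
    (hL : ∀ (z : L) (s : R →₀ ℕ), ⁅z, y s⁆ ∈ Submodule.span k (y '' {t | t.degree ≤ s.degree + 1}))
    (d : ℕ) : filtration k L v d ≤ Submodule.span k (y '' {t | t.degree ≤ d}) := by
  have hmono : ∀ d e : ℕ, d ≤ e → Submodule.span k (y '' {t | t.degree ≤ d}) ≤
      Submodule.span k (y '' {t | t.degree ≤ e}) := fun d e hde =>
    Submodule.span_mono (Set.image_mono fun t (ht : _ ≤ _) => ht.trans hde)
  have key : ∀ l : List L, orbitMap k L v (l.map (UniversalEnvelopingAlgebra.ι k)).prod ∈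
      Submodule.span k (y '' {t | t.degree ≤ l.length}) := by
    intro l
    induction l with
    | nil =>
      refine Submodule.subset_span ⟨0, by simp, ?_⟩
      simp [orbitMap, h0]
    | cons z l ih =>
      have h := UniversalEnvelopingAlgebra.lift_ι_apply k (LieModule.toEnd k L M) z
      have e : orbitMap k L v ((z :: l).map (UniversalEnvelopingAlgebra.ι k)).prod =
          LieModule.toEnd k L M z
            (orbitMap k L v (l.map (UniversalEnvelopingAlgebra.ι k)).prod) := by
        simp only [orbitMap, List.map_cons, List.prod_cons, LinearMap.comp_apply,
          AlgHom.toLinearMap_apply, map_mul, h, LinearMap.applyₗ_apply_apply, Module.End.mul_apply]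
      rw [e]
      have hle : Submodule.span k (y '' {t | t.degree ≤ l.length}) ≤
          (Submodule.span k (y '' {t | t.degree ≤ (z :: l).length})).comap
            (LieModule.toEnd k L M z) := by
        rw [Submodule.span_le]
        rintro _ ⟨t, ht, rfl⟩
        refine hmono (t.degree + 1) _ ?_ (hL z t)
        have : t.degree ≤ l.length := ht
        simpa using this
      exact hle ih
  rw [filtration, envFiltration, Submodule.map_span, Submodule.span_le]
  rintro _ ⟨_, ⟨l, hl, rfl⟩, rfl⟩
  exact hmono _ _ hl (key l)

variable [Fintype R]

/-- The monomial `∏ x_a ^ s_a` in the symmetric algebra of `N`. -/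
def symMonomial (k : Type*) [CommRing k] {N : Type*} [AddCommGroup N] [Module k N]
    (x : R → N) (s : R →₀ ℕ) : SymmetricAlgebra k N :=
  ∏ a, SymmetricAlgebra.ι k N (x a) ^ s a

theorem symMonomial_zero {N : Type*} [AddCommGroup N] [Module k N] (x : R → N) :
    symMonomial k x 0 = 1 := by
  simp [symMonomial]

theorem symMonomial_add {N : Type*} [AddCommGroup N] [Module k N] (x : R → N) (s t : R →₀ ℕ) :
    symMonomial k x (s + t) = symMonomial k x s * symMonomial k x t := by
  simp [symMonomial, pow_add, Finset.prod_mul_distrib]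

theorem symMonomial_single {N : Type*} [AddCommGroup N] [Module k N] (x : R → N) (a : R) :
    symMonomial k x (Finsupp.single a 1) = SymmetricAlgebra.ι k N (x a) := by
  classical
  rw [symMonomial, Finset.prod_eq_single a]
  · simp
  · intro b _ hb
    simp [hb.symm]
  · simp

/-- The family `y s` consists of the vectors `∏ x_a ^ s_a . v`, for commuting operators
`x_a ∈ L`. -/
structure IsMonomialOrbit (x : R → L) (v : M) (y : (R →₀ ℕ) → M) : Prop where
  zero : y 0 = v
  lie : ∀ a s, ⁅x a, y s⁆ = y (s + Finsupp.single a 1)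

/-- The monomial of exponent `s` maps the generator to the class of `y s` in degree `|s|`. -/
theorem IsMonomialOrbit.smul_grGen (h : IsMonomialOrbit x v y) (d : ℕ) :
    ∀ s : R →₀ ℕ, s.degree = d → ∃ hs : y s ∈ filtration k L v d,
      symMonomial k x s • grGen k L v = grMk v d ⟨y s, hs⟩ := by
  induction d with
  | zero =>
    intro s hs
    obtain rfl : s = 0 := (Finsupp.degree_eq_zero_iff s).1 hs
    rw [symMonomial_zero, one_smul]
    have h0 : y 0 ∈ filtration k L v 0 := by rw [h.zero]; exact mem_filtration_self v
    refine ⟨h0, congrArg (grMk v 0) (Subtype.ext h.zero.symm : (⟨v, mem_filtration_self v⟩ :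
      filtration k L v 0) = ⟨y 0, h0⟩)⟩
  | succ d ih =>
    intro s hs
    obtain ⟨t, a, rfl, ht⟩ := exists_eq_add_single_of_degree_eq_succ hs
    obtain ⟨h1, h2⟩ := ih t ht
    have h3 : y (t + Finsupp.single a 1) ∈ filtration k L v (d + 1) := by
      rw [← h.lie]; exact lie_mem_filtration v d (x a) h1
    refine ⟨h3, ?_⟩
    rw [symMonomial_add, mul_comm, mul_smul, h2, symMonomial_single, ι_smul_grMk]
    exact congrArg (grMk v (d + 1)) (Subtype.ext (h.lie a t))

variable (Λ : Set (R →₀ ℕ))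

/-- A monomial basis of `U(L).v` which is compatible with degrees gives a monomial basis of the
PBW-graded module. -/
theorem IsMonomialOrbit.basis_gr (h : IsMonomialOrbit x v y)
    (hL : ∀ (z : L) (s : R →₀ ℕ), ⁅z, y s⁆ ∈ Submodule.span k (y '' {t | t.degree ≤ s.degree + 1}))
    (hstr : ∀ s, y s ∈ Submodule.span k (y '' {t | t ∈ Λ ∧ t.degree = s.degree}))
    (hli : LinearIndependent k (fun s : Λ => y s)) :
    LinearIndependent k (fun s : Λ => symMonomial k x s • grGen k L v) ∧
      Submodule.span k (Set.range fun s : Λ => symMonomial k x s • grGen k L v) = ⊤ := by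
  classical
  have hfil : ∀ d, filtration k L v d ≤ Submodule.span k (y '' {t | t ∈ Λ ∧ t.degree ≤ d}) := by
    intro d
    refine (filtration_le_span h.zero hL d).trans ?_
    rw [Submodule.span_le]
    rintro _ ⟨t, ht, rfl⟩
    refine Submodule.span_mono ?_ (hstr t)
    exact Set.image_mono fun u hu => ⟨hu.1, hu.2.trans_le ht⟩
  constructor
  · -- the part of degree `d` of a relation lies in the previous step of the filtration, which is
    -- spanned by basis vectors of smaller degree
    rw [linearIndependent_iff']
    intro S g hg s₀ hs₀
    set d := (s₀ : R →₀ ℕ).degree with hd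
    set S' := S.filter (fun s : Λ => (s : R →₀ ℕ).degree = d) with hS'
    have hmem : ∀ s : Λ, (s : R →₀ ℕ).degree = d → y s ∈ filtration k L v d :=
      fun s hs => (h.smul_grGen d s hs).1
    have hsum : ∑ s ∈ S', g s • y s ∈ filtrationPred k L v d := by
      have h1 := congrArg (grComponent v d) hg
      rw [map_zero, map_sum] at h1
      have h2 : ∀ s ∈ S, grComponent v d (g s • symMonomial k x s • grGen k L v) =
          if hs : (s : R →₀ ℕ).degree = d then
            Submodule.Quotient.mk (g s • ⟨y s, hmem s hs⟩) else 0 := by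
        intro s _
        split_ifs with hs
        · obtain ⟨h3, h4⟩ := h.smul_grGen (k := k) d s hs
          rw [h4, map_smul, grComponent_grMk]
          rfl
        · obtain ⟨h3, h4⟩ := h.smul_grGen (k := k) _ (s : R →₀ ℕ) rfl
          rw [h4, map_smul, grComponent_grMk_of_ne v (Ne.symm hs), smul_zero]
      rw [Finset.sum_congr rfl h2] at h1
      have h5 : (Submodule.Quotient.mk (∑ s ∈ S, if hs : (s : R →₀ ℕ).degree = d then
            (g s • ⟨y s, hmem s hs⟩ : filtration k L v d) else 0) : Component k L v d) = 0 := by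
        rw [← h1, ← Submodule.mkQ_apply, map_sum]
        refine Finset.sum_congr rfl fun s _ => ?_
        split_ifs <;> simp
      rw [Submodule.Quotient.mk_eq_zero] at h5
      have h6 : (filtration k L v d).subtype (∑ s ∈ S, if hs : (s : R →₀ ℕ).degree = d then
            (g s • ⟨y s, hmem s hs⟩ : filtration k L v d) else 0) ∈ filtrationPred k L v d := h5
      rw [map_sum] at h6
      rw [hS', Finset.sum_filter]
      convert h6 using 2 with s
      split_ifs <;> simp
    have hpred : filtrationPred k L v d ≤
        Submodule.span k ((fun s : Λ => y s) '' {s | (s : R →₀ ℕ).degree < d}) := by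
      rcases hd' : d with _ | e
      · exact bot_le
      · refine (hfil e).trans (Submodule.span_mono ?_)
        rintro _ ⟨t, ht, rfl⟩
        exact ⟨⟨t, ht.1⟩, Nat.lt_succ_of_le ht.2, rfl⟩
    have hdisj := hli.disjoint_span_image (s := {s : Λ | (s : R →₀ ℕ).degree < d})
      (t := {s : Λ | (s : R →₀ ℕ).degree = d}) (by
        rw [Set.disjoint_left]
        intro s hs hs'
        exact (ne_of_lt hs) hs')
    have hzero : ∑ s ∈ S', g s • y s = 0 := by
      refine Submodule.disjoint_def.1 hdisj _ (hpred hsum) (Submodule.sum_mem _ fun s hs => ?_)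
      refine Submodule.smul_mem _ _ (Submodule.subset_span ⟨s, ?_, rfl⟩)
      exact (Finset.mem_filter.1 hs).2
    exact linearIndependent_iff'.1 hli S' g hzero s₀ (Finset.mem_filter.2 ⟨hs₀, hd.symm⟩)
  · rw [eq_top_iff, ← iSup_range_grMk, iSup_le_iff]
    rintro d _ ⟨z, rfl⟩
    have hz : (z : M) ∈ Submodule.span k (y '' {t | t ∈ Λ ∧ t.degree = d}) ⊔
        filtrationPred k L v d := by
      refine (Submodule.span_le.2 ?_ : Submodule.span k (y '' {t | t ∈ Λ ∧ t.degree ≤ d}) ≤ _)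
        (hfil d z.2)
      rintro _ ⟨t, ht, rfl⟩
      rcases ht.2.lt_or_eq with h1 | h1
      · refine Submodule.mem_sup_right ?_
        obtain ⟨e, rfl⟩ : ∃ e, d = e + 1 := ⟨d - 1, by omega⟩
        obtain ⟨h2, _⟩ := h.smul_grGen (k := k) t.degree t rfl
        refine Submodule.map_mono (Submodule.span_mono ?_) h2
        rintro _ ⟨l, hl, rfl⟩
        exact ⟨l, hl.trans (Nat.le_of_lt_succ h1), rfl⟩
      · exact Submodule.mem_sup_left (Submodule.subset_span ⟨t, ⟨ht.1, h1⟩, rfl⟩)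
    obtain ⟨a, ha, b, hb, hab⟩ := Submodule.mem_sup.1 hz
    have hle : Submodule.span k (y '' {t | t ∈ Λ ∧ t.degree = d}) ≤
        ((Submodule.span k (Set.range fun s : Λ => symMonomial k x s • grGen k L v)).comap
          (grMk v d)).map (filtration k L v d).subtype := by
      rw [Submodule.span_le]
      rintro _ ⟨t, ⟨ht, htd⟩, rfl⟩
      obtain ⟨h2, h3⟩ := h.smul_grGen (k := k) d t htd
      exact ⟨⟨y t, h2⟩, Submodule.subset_span ⟨⟨t, ht⟩, h3⟩, rfl⟩
    obtain ⟨a', ha', rfl⟩ := hle ha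
    have hb' : grMk v d (z - a') = 0 := by
      refine grMk_eq_zero v d ?_
      have : ((z - a' : filtration k L v d) : M) = b := by
        rw [AddSubgroupClass.coe_sub, ← hab]
        simp
      rwa [this]
    rw [map_sub, sub_eq_zero] at hb'
    rw [hb']
    exact ha'

end GradedBasis

/-! ### Derivations of products and determinants -/

section DerivationProd

variable {k A ι : Type*} [CommRing k] [CommRing A] [Algebra k A] [Fintype ι] [DecidableEq ι]

theorem derivation_prod (D : Derivation k A A) (f : ι → A) :
    D (∏ l, f l) = ∑ l, ∏ l', Function.update f l (D (f l)) l' := by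
  have key : ∀ s : Finset ι, D (∏ l ∈ s, f l) =
      ∑ l ∈ s, ∏ l' ∈ s, Function.update f l (D (f l)) l' := by
    intro s
    induction s using Finset.induction_on with
    | empty => simp
    | insert a s ha ih =>
      rw [Finset.prod_insert ha, Finset.sum_insert ha, Finset.prod_insert ha, D.leibniz, ih,
        Finset.smul_sum, add_comm, Function.update_self]
      congr 1
      · rw [smul_eq_mul, mul_comm]
        congr 1
        refine Finset.prod_congr rfl fun l hl => (Function.update_of_ne ?_ _ _).symm
        rintro rfl
        exact ha hl
      · refine Finset.sum_congr rfl fun l hl => ?_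
        rw [Finset.prod_insert ha, Function.update_of_ne, smul_eq_mul]
        rintro rfl
        exact ha hl
  exact key Finset.univ

theorem derivation_det_of_mul_right (D : Derivation k A A) (M B : Matrix ι ι A)
    (h : ∀ a b, D (M a b) = (M * B) a b) : D M.det = B.trace * M.det := by
  have h1 : D M.det = ∑ b, (M.updateCol b fun a => D (M a b)).det := by
    simp only [Matrix.det_apply, map_sum]
    rw [Finset.sum_comm]
    refine Finset.sum_congr rfl fun σ _ => ?_
    rw [Units.smul_def, map_zsmul, derivation_prod, Finset.smul_sum]
    refine Finset.sum_congr rfl fun b _ => ?_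
    rw [Units.smul_def]
    congr 1
    refine Finset.prod_congr rfl fun c _ => ?_
    by_cases hc : c = b
    · subst hc; simp
    · simp [hc]
  rw [h1, Matrix.trace, Finset.sum_mul]
  refine Finset.sum_congr rfl fun b _ => ?_
  have h2 := Matrix.det_updateCol_sum M b (fun c => B c b)
  rw [smul_eq_mul] at h2
  rw [Matrix.diag_apply, ← h2]
  congr 2
  funext a
  rw [h, Matrix.mul_apply]
  exact Finset.sum_congr rfl fun c _ => mul_comm _ _

theorem derivation_det_of_mul_left (D : Derivation k A A) (M B : Matrix ι ι A)
    (h : ∀ a b, D (M a b) = (B * M) a b) : D M.det = B.trace * M.det := by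
  rw [← Matrix.det_transpose, ← Matrix.trace_transpose]
  refine derivation_det_of_mul_right D _ _ fun a b => ?_
  rw [← Matrix.transpose_mul]
  exact h b a

theorem derivation_prod_of_eq_mul (D : Derivation k A A) (f : ι → A) (c : ι → A)
    (h : ∀ l, D (f l) = c l * f l) : D (∏ l, f l) = (∑ l, c l) * ∏ l, f l := by
  rw [derivation_prod, Finset.sum_mul]
  refine Finset.sum_congr rfl fun l _ => ?_
  rw [Finset.prod_update_of_mem (Finset.mem_univ l), h, mul_assoc, ← Finset.prod_update_of_mem
    (Finset.mem_univ l), Function.update_eq_self]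

end DerivationProd

/-! ### A polynomial representation of `gl` and the Fischer form -/

section Polynomial

open MvPolynomial

variable {σ : Type*}

/-- The derivation of a polynomial ring which multiplies the variable `X q` by `c q`. -/
def eulerDer (c : σ → ℂ) : Derivation ℂ (MvPolynomial σ ℂ) (MvPolynomial σ ℂ) :=
  mkDerivation ℂ fun q => c q • X q

theorem eulerDer_X (c : σ → ℂ) (q : σ) : eulerDer c (X q) = c q • X q :=
  mkDerivation_X _ _ _

theorem linearMap_eq_of_monomial {F G : MvPolynomial σ ℂ →ₗ[ℂ] ℂ}
    (h : ∀ e, F (monomial e 1) = G (monomial e 1)) (f : MvPolynomial σ ℂ) : F f = G f := by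
  have : F = G := (basisMonomials σ ℂ).ext fun e => by
    rw [coe_basisMonomials]; exact h e
  rw [this]

variable [Fintype σ]

theorem eulerDer_monomial (c : σ → ℂ) (e : σ →₀ ℕ) (r : ℂ) :
    eulerDer c (monomial e r) = (∑ q, (e q : ℂ) * c q) • monomial e r := by
  classical
  rw [eulerDer, mkDerivation_monomial, Finsupp.sum_fintype _ _ (fun q => by simp),
    Finset.smul_sum, Finset.sum_smul]
  refine Finset.sum_congr rfl fun q _ => ?_
  by_cases h : e q = 0
  · simp [h]
  · have h1 : Finsupp.single q 1 ≤ e := by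
      rw [Finsupp.single_le_iff]; omega
    rw [smul_eq_mul, mul_smul_comm, X, monomial_mul, tsub_add_cancel_of_le h1, smul_monomial,
      smul_monomial, smul_monomial]
    congr 1
    simp only [smul_eq_mul]
    ring

theorem coeff_eulerDer (c : σ → ℂ) (e : σ →₀ ℕ) (f : MvPolynomial σ ℂ) :
    coeff e (eulerDer c f) = (∑ q, (e q : ℂ) * c q) * coeff e f := by
  classical
  induction f using MvPolynomial.induction_on' with
  | add p q hp hq => simp [hp, hq, mul_add]
  | monomial d a =>
    rw [eulerDer_monomial, coeff_smul, coeff_monomial]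
    split_ifs with h
    · subst h; simp
    · simp

/-- The Fischer form `⟪f, g⟫ = ∑ e! f_e conj(g_e)` on polynomials, as a linear functional of
`f`. -/
def fischer (g : MvPolynomial σ ℂ) : MvPolynomial σ ℂ →ₗ[ℂ] ℂ :=
  (basisMonomials σ ℂ).constr ℂ fun e => (∏ q, ((e q).factorial : ℂ)) * star (coeff e g)

theorem fischer_monomial (g : MvPolynomial σ ℂ) (e : σ →₀ ℕ) :
    fischer g (monomial e 1) = (∏ q, ((e q).factorial : ℂ)) * star (coeff e g) := by
  have h := (basisMonomials σ ℂ).constr_basis ℂ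
    (fun e => (∏ q, ((e q).factorial : ℂ)) * star (coeff e g)) e
  rwa [coe_basisMonomials] at h

theorem fischer_add (g g' f : MvPolynomial σ ℂ) :
    fischer (g + g') f = fischer g f + fischer g' f :=
  linearMap_eq_of_monomial (F := fischer (g + g')) (G := fischer g + fischer g') (fun e => by
    simp [fischer_monomial, mul_add]) f

theorem fischer_smul (c : ℂ) (g f : MvPolynomial σ ℂ) :
    fischer (c • g) f = star c * fischer g f :=
  linearMap_eq_of_monomial (F := fischer (c • g)) (G := star c • fischer g) (fun e => by
    simp [fischer_monomial]; ring) f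

theorem fischer_zero (f : MvPolynomial σ ℂ) : fischer 0 f = 0 := by
  simpa using fischer_smul 0 0 f

theorem fischer_sum {κ : Type*} (s : Finset κ) (g : κ → MvPolynomial σ ℂ) (f : MvPolynomial σ ℂ) :
    fischer (∑ a ∈ s, g a) f = ∑ a ∈ s, fischer (g a) f := by
  classical
  induction s using Finset.induction_on with
  | empty => simp [fischer_zero]
  | insert a s ha ih => rw [Finset.sum_insert ha, Finset.sum_insert ha, fischer_add, ih]

theorem prod_factorial_add_single (e : σ →₀ ℕ) (p : σ) :
    ∏ q, (((e + Finsupp.single p 1 : σ →₀ ℕ) q).factorial : ℂ) =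
      (e p + 1) * ∏ q, ((e q).factorial : ℂ) := by
  classical
  rw [← Finset.mul_prod_erase Finset.univ _ (Finset.mem_univ p),
    ← Finset.mul_prod_erase Finset.univ (fun q => ((e q).factorial : ℂ)) (Finset.mem_univ p),
    ← mul_assoc]
  congr 1
  · simp [Nat.factorial_succ]
  · refine Finset.prod_congr rfl fun q hq => ?_
    have := (Finset.mem_erase.1 hq).1
    simp [this]

theorem fischer_X_mul (g f : MvPolynomial σ ℂ) (p : σ) :
    fischer g (X p * f) = fischer (pderiv p g) f := by
  refine linearMap_eq_of_monomial (F := fischer g ∘ₗ LinearMap.mulLeft ℂ (X p))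
    (G := fischer (pderiv p g))
    (fun e => ?_) f
  rw [LinearMap.comp_apply, LinearMap.mulLeft_apply, X, monomial_mul, one_mul, add_comm,
    fischer_monomial, fischer_monomial, prod_factorial_add_single, coeff_pderiv]
  simp
  ring

theorem fischer_pderiv (g f : MvPolynomial σ ℂ) (p : σ) :
    fischer g (pderiv p f) = fischer (X p * g) f := by
  classical
  refine linearMap_eq_of_monomial (F := fischer g ∘ₗ (pderiv p).toLinearMap)
    (G := fischer (X p * g))
    (fun e => ?_) f
  change fischer g (pderiv p (monomial e 1)) = _
  rw [pderiv_monomial, fischer_monomial, coeff_X_mul']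
  by_cases h : e p = 0
  · simp [h]
  · have h1 : Finsupp.single p 1 ≤ e := by
      rw [Finsupp.single_le_iff]; omega
    obtain ⟨d, rfl⟩ : ∃ d, e = d + Finsupp.single p 1 := ⟨_, (tsub_add_cancel_of_le h1).symm⟩
    have h2 : p ∈ (d + Finsupp.single p 1).support := by simp
    rw [if_pos h2, add_tsub_cancel_right, prod_factorial_add_single, one_mul]
    have h3 : monomial d ((((d + Finsupp.single p 1 : σ →₀ ℕ) p : ℕ)) : ℂ) =
        ((d p : ℂ) + 1) • monomial d (1 : ℂ) := by
      rw [smul_monomial]; simp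
    rw [h3, map_smul, fischer_monomial, smul_eq_mul, mul_assoc]

/-- The Fischer form is anisotropic. -/
theorem eq_zero_of_fischer_self {f : MvPolynomial σ ℂ} (h : fischer f f = 0) : f = 0 := by
  have h1 : fischer f f = ∑ e ∈ f.support,
      (((∏ q, (e q).factorial : ℕ) * Complex.normSq (coeff e f) : ℝ) : ℂ) := by
    conv_lhs => rw [f.as_sum, map_sum]
    rw [← f.as_sum]
    refine Finset.sum_congr rfl fun e _ => ?_
    have : monomial e (coeff e f) = coeff e f • monomial e (1 : ℂ) := by
      rw [smul_monomial, smul_eq_mul, mul_one]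
    rw [this, map_smul, fischer_monomial, smul_eq_mul, Complex.ofReal_mul,
      Complex.normSq_eq_conj_mul_self]
    push_cast
    rw [starRingEnd_apply]
    ring
  rw [h1, ← Complex.ofReal_sum, Complex.ofReal_eq_zero,
    Finset.sum_eq_zero_iff_of_nonneg (fun e _ => by
      exact mul_nonneg (Nat.cast_nonneg _) (Complex.normSq_nonneg _))] at h
  by_contra hf
  obtain ⟨e, he⟩ := MvPolynomial.ne_zero_iff.1 hf
  have h2 := h e (mem_support_iff.2 he)
  rcases mul_eq_zero.1 h2 with h3 | h3
  · rw [Nat.cast_eq_zero, Finset.prod_eq_zero_iff] at h3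
    obtain ⟨q, _, hq⟩ := h3
    exact Nat.factorial_ne_zero _ hq
  · exact he (Complex.normSq_eq_zero.1 h3)

end Polynomial

section GeneralLinear

open MvPolynomial

variable {P ι : Type*} [Fintype ι]

/-- The action of a matrix on polynomial functions of `P` vectors with coordinates indexed by `ι`:
the derivation extending `X_{p,b} ↦ ∑_a A_{a,b} X_{p,a}`. -/
def glDer (A : Matrix ι ι ℂ) : Derivation ℂ (MvPolynomial (P × ι) ℂ) (MvPolynomial (P × ι) ℂ) :=
  mkDerivation ℂ fun q => ∑ a, A a q.2 • X (q.1, a)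

theorem glDer_X (A : Matrix ι ι ℂ) (p : P) (b : ι) :
    glDer A (X (p, b)) = ∑ a, A a b • (X (p, a) : MvPolynomial (P × ι) ℂ) :=
  mkDerivation_X _ _ _

theorem glDer_add (A B : Matrix ι ι ℂ) :
    (glDer (A + B) : Derivation ℂ (MvPolynomial (P × ι) ℂ) _) = glDer A + glDer B :=
  derivation_ext fun ⟨p, b⟩ => by
    rw [Derivation.add_apply]
    simp only [glDer_X, ← Finset.sum_add_distrib, Matrix.add_apply, add_smul]

theorem glDer_smul (c : ℂ) (A : Matrix ι ι ℂ) :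
    (glDer (c • A) : Derivation ℂ (MvPolynomial (P × ι) ℂ) _) = c • glDer A :=
  derivation_ext fun ⟨p, b⟩ => by
    rw [Derivation.smul_apply]
    simp only [glDer_X, Finset.smul_sum, Matrix.smul_apply, smul_assoc]

theorem glDer_lie (A B : Matrix ι ι ℂ) :
    (glDer (A * B - B * A) : Derivation ℂ (MvPolynomial (P × ι) ℂ) (MvPolynomial (P × ι) ℂ)) =
      ⁅glDer (P := P) A, glDer (P := P) B⁆ := by
  have key : ∀ (A B : Matrix ι ι ℂ) (p : P) (b : ι), glDer A (glDer B (X (p, b))) =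
      ∑ a, (A * B) a b • (X (p, a) : MvPolynomial (P × ι) ℂ) := by
    intro A B p b
    simp only [glDer_X, map_sum, Derivation.map_smul, Matrix.mul_apply, Finset.sum_smul,
      Finset.smul_sum]
    rw [Finset.sum_comm]
    refine Finset.sum_congr rfl fun a _ => Finset.sum_congr rfl fun c _ => ?_
    rw [smul_smul, mul_comm]
  refine derivation_ext fun ⟨p, b⟩ => ?_
  rw [Derivation.commutator_apply, key, key, glDer_X, ← Finset.sum_sub_distrib]
  exact Finset.sum_congr rfl fun a _ => by rw [Matrix.sub_apply, sub_smul]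

theorem sum_derivation_apply {κ R : Type*} [CommRing R] [Algebra ℂ R] (s : Finset κ)
    (D : κ → Derivation ℂ R R) (f : R) : (∑ a ∈ s, D a) f = ∑ a ∈ s, D a f := by
  have h := map_sum (Derivation.coeFnAddMonoidHom (R := ℂ) (A := R) (M := R)) D s
  exact (congrFun h f).trans (Finset.sum_apply _ _ _)

theorem glDer_eq_sum [Fintype P] (A : Matrix ι ι ℂ) (f : MvPolynomial (P × ι) ℂ) :
    glDer A f = ∑ p, ∑ a, ∑ b, A a b • (X (p, a) * pderiv (p, b) f) := by
  classical
  have : (glDer A : Derivation ℂ (MvPolynomial (P × ι) ℂ) (MvPolynomial (P × ι) ℂ)) =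
      ∑ p, ∑ a, ∑ b, A a b • ((X (p, a) : MvPolynomial (P × ι) ℂ) • pderiv (p, b)) := by
    refine derivation_ext fun ⟨p, b⟩ => ?_
    simp only [sum_derivation_apply, Derivation.smul_apply, glDer_X, pderiv_X,
      Pi.single_apply, smul_eq_mul, mul_ite, mul_one, mul_zero, smul_ite, smul_zero, Prod.mk.injEq]
    rw [Finset.sum_eq_single p]
    · simp
    · intro p' _ hp'
      simp [hp'.symm]
    · simp
  rw [this]
  simp only [sum_derivation_apply, Derivation.smul_apply, smul_eq_mul]

/-- The adjoint of the action of `A` with respect to the Fischer form is the action of `Aᴴ`. -/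
theorem fischer_glDer [Fintype P] (A : Matrix ι ι ℂ) (g f : MvPolynomial (P × ι) ℂ) :
    fischer g (glDer A f) = fischer (glDer A.conjTranspose g) f := by
  rw [glDer_eq_sum, glDer_eq_sum]
  simp only [map_sum, map_smul, fischer_sum, fischer_smul, fischer_X_mul, fischer_pderiv,
    Matrix.conjTranspose_apply, star_star, smul_eq_mul]
  exact Finset.sum_congr rfl fun p _ => Finset.sum_comm

theorem glDer_diagonal (A : Matrix ι ι ℂ) (h : A.IsDiag) :
    (glDer A : Derivation ℂ (MvPolynomial (P × ι) ℂ) _) = eulerDer fun q => A q.2 q.2 :=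
  derivation_ext fun ⟨p, b⟩ => by
    rw [glDer_X, eulerDer_X, Finset.sum_eq_single b]
    · intro a _ ha
      rw [h ha, zero_smul]
    · simp

/-- The derivation multiplying the coordinates of the vector `p` by `c p` commutes with `gl`. -/
theorem eulerDer_glDer_comm (c : P → ℂ) (A : Matrix ι ι ℂ) (f : MvPolynomial (P × ι) ℂ) :
    eulerDer (fun q : P × ι => c q.1) (glDer A f) = glDer A (eulerDer (fun q => c q.1) f) := by
  have : ⁅eulerDer (fun q : P × ι => c q.1),
      (glDer A : Derivation ℂ (MvPolynomial (P × ι) ℂ) (MvPolynomial (P × ι) ℂ))⁆ = 0 := by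
    refine derivation_ext fun ⟨p, b⟩ => ?_
    rw [Derivation.commutator_apply, glDer_X, eulerDer_X, Derivation.map_smul, glDer_X, map_sum,
      Finset.smul_sum, Derivation.zero_apply, sub_eq_zero]
    refine Finset.sum_congr rfl fun a _ => ?_
    rw [Derivation.map_smul, eulerDer_X, smul_comm]
  have h := congrArg (fun D => D f) this
  simpa [Derivation.commutator_apply, sub_eq_zero] using h

/-- Permuting the vectors commutes with the action of `gl`. -/
theorem rename_glDer (τ : P → P) (A : Matrix ι ι ℂ) (f : MvPolynomial (P × ι) ℂ) :
    rename (Prod.map τ id) (glDer A f) = glDer A (rename (Prod.map τ id) f) := by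
  induction f using MvPolynomial.induction_on with
  | C a => simp
  | add p q hp hq => simp [hp, hq]
  | mul_X p q hp =>
    rw [Derivation.leibniz, map_add, smul_eq_mul, smul_eq_mul, map_mul, map_mul, hp, map_mul,
      Derivation.leibniz, smul_eq_mul, smul_eq_mul]
    congr 2
    rw [rename_X, glDer_X, map_sum]
    obtain ⟨p', b⟩ := q
    rw [Prod.map_apply, glDer_X]
    simp

end GeneralLinear

/-! ### Cyclic submodules generated by highest weight vectors -/

section Cyclic

variable {n : ℕ}

theorem mem_span_unit {r : Fin (n + 1) → Fin (n + 1) → Prop} {hr : ∀ x y z, r x y → r y z → r x z}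
    (hirr : ∀ x, ¬ r x x) {A : SL n} (hA : A ∈ supported r hr) :
    A ∈ Submodule.span ℂ
      {B : SL n | ∃ (a b : Fin (n + 1)) (h : a ≠ b), r a b ∧ B = unit a b h} := by
  classical
  have hsum : A = ∑ a, ∑ b, if h : a ≠ b then A.1 a b • unit a b h else 0 := by
    refine Subtype.ext ?_
    have h1 : ((∑ a, ∑ b, if h : a ≠ b then A.1 a b • unit a b h else 0 : SL n) : Matrix _ _ ℂ) =
        ∑ a, ∑ b, Matrix.single a b (A.1 a b) := by
      push_cast
      refine Finset.sum_congr rfl fun a _ => Finset.sum_congr rfl fun b _ => ?_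
      split_ifs with h
      · change A.1 a b • Matrix.single a b (1 : ℂ) = _
        rw [Matrix.smul_single, smul_eq_mul, mul_one]
      · obtain rfl : a = b := not_not.1 h
        rw [hA a a (hirr a), Matrix.single_zero]
        rfl
    rw [h1]
    exact Matrix.matrix_eq_sum_single A.1
  rw [hsum]
  refine Submodule.sum_mem _ fun a _ => Submodule.sum_mem _ fun b _ => ?_
  split_ifs with h
  · by_cases hab : r a b
    · exact Submodule.smul_mem _ _ (Submodule.subset_span ⟨a, b, h, hab, rfl⟩)
    · rw [hA a b hab, zero_smul]
      exact Submodule.zero_mem _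
  · exact Submodule.zero_mem _

/-- The subalgebras `𝔫⁻` and `𝔟` span `sl_{n+1}`. -/
theorem exists_nMinus_add_borel (A : SL n) : ∃ F ∈ nMinus n, ∃ B ∈ borel n, A = F + B := by
  refine ⟨lowerPart A, (lowerPart A).2, A - lowerPart A, ?_, by simp⟩
  intro x y hxy
  change A.1 x y - (if y < x then A.1 x y else 0) = 0
  rw [if_pos (not_le.1 hxy), sub_self]

variable {U : Type*} [AddCommGroup U] [Module ℂ U]

/-- The subspace `W` is stable under the representation `ρ`. -/
def IsStable (ρ : SL n →ₗ⁅ℂ⁆ Module.End ℂ U) (W : Submodule ℂ U) : Prop :=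
  ∀ x, ∀ y ∈ W, ρ x y ∈ W

/-- The subspace generated by a vector under a representation. -/
def cyclic (ρ : SL n →ₗ⁅ℂ⁆ Module.End ℂ U) (u : U) : Submodule ℂ U :=
  sInf {W | u ∈ W ∧ IsStable ρ W}

theorem mem_cyclic (ρ : SL n →ₗ⁅ℂ⁆ Module.End ℂ U) (u : U) : u ∈ cyclic ρ u :=
  Submodule.mem_sInf.2 fun _ h => h.1

theorem isStable_cyclic (ρ : SL n →ₗ⁅ℂ⁆ Module.End ℂ U) (u : U) : IsStable ρ (cyclic ρ u) :=
  fun x _ hy => Submodule.mem_sInf.2 fun W h => h.2 x _ (Submodule.mem_sInf.1 hy W h)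

theorem cyclic_le (ρ : SL n →ₗ⁅ℂ⁆ Module.End ℂ U) {u : U} {W : Submodule ℂ U} (hu : u ∈ W)
    (hW : IsStable ρ W) : cyclic ρ u ≤ W :=
  sInf_le ⟨hu, hW⟩

theorem map_lie_apply (ρ : SL n →ₗ⁅ℂ⁆ Module.End ℂ U) (A B : SL n) (y : U) :
    ρ A (ρ B y) = ρ B (ρ A y) + ρ ⁅A, B⁆ y := by
  have h := congrArg (fun F => F y) (LieHom.map_lie ρ A B)
  have h' : ρ ⁅A, B⁆ y = ρ A (ρ B y) - ρ B (ρ A y) := h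
  rw [h']; abel

/-- The module generated by a `𝔟`-eigenvector is contained in every `𝔫⁻`-stable subspace
containing it. -/
theorem cyclic_le_of_nMinus (ρ : SL n →ₗ⁅ℂ⁆ Module.End ℂ U) {u : U}
    (hu : ∀ B ∈ borel n, ∃ c : ℂ, ρ B u = c • u) {W : Submodule ℂ U} (huW : u ∈ W)
    (hW : ∀ F ∈ nMinus n, ∀ y ∈ W, ρ F y ∈ W) : cyclic ρ u ≤ W := by
  -- the smallest such subspace `P` is stable, as the elements mapped to `P` by all of `sl_{n+1}`
  -- form an `𝔫⁻`-stable subspace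
  set P : Submodule ℂ U := sInf {W | u ∈ W ∧ ∀ F ∈ nMinus n, ∀ y ∈ W, ρ F y ∈ W} with hP
  have huP : u ∈ P := Submodule.mem_sInf.2 fun _ h => h.1
  have hFP : ∀ F ∈ nMinus n, ∀ y ∈ P, ρ F y ∈ P := fun F hF y hy =>
    Submodule.mem_sInf.2 fun W h => h.2 F hF _ (Submodule.mem_sInf.1 hy W h)
  let P' : Submodule ℂ U :=
    { carrier := {y | y ∈ P ∧ ∀ A, ρ A y ∈ P}
      zero_mem' := ⟨P.zero_mem, fun A => by rw [map_zero]; exact P.zero_mem⟩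
      add_mem' := fun ha hb => ⟨P.add_mem ha.1 hb.1, fun A => by
        rw [map_add]; exact P.add_mem (ha.2 A) (hb.2 A)⟩
      smul_mem' := fun c _ ha => ⟨P.smul_mem c ha.1, fun A => by
        rw [map_smul]; exact P.smul_mem c (ha.2 A)⟩ }
  have hPP' : P ≤ P' := by
    refine sInf_le ⟨⟨huP, fun A => ?_⟩, fun F hF y hy => ⟨hFP F hF y hy.1, fun A => ?_⟩⟩
    · obtain ⟨F, hF, B, hB, rfl⟩ := exists_nMinus_add_borel A
      obtain ⟨c, hc⟩ := hu B hB
      rw [map_add, LinearMap.add_apply, hc]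
      exact P.add_mem (hFP F hF u huP) (P.smul_mem c huP)
    · rw [map_lie_apply]
      exact P.add_mem (hFP F hF _ (hy.2 A)) (hy.2 _)
  exact (cyclic_le ρ huP fun A y hy => (hPP' hy).2 A).trans (sInf_le ⟨huW, hW⟩)

/-- The diagonal matrix with entries `n, n - 2, …, -n`; the root vectors of `𝔫⁻` lower its
eigenvalues by positive integers. -/
def rhoCheck (n : ℕ) : SL n :=
  ⟨Matrix.diagonal fun a => ((n : ℂ) - 2 * (a : ℕ)), by
    refine LinearMap.mem_ker.2 ((Matrix.traceLinearMap_apply _ _ _ _).trans ?_)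
    rw [Matrix.trace_diagonal, Finset.sum_sub_distrib, ← Finset.mul_sum,
      Fin.sum_univ_eq_sum_range (fun a => (a : ℂ))]
    have h := Finset.sum_range_id_mul_two (n + 1)
    have h' : (∑ a ∈ Finset.range (n + 1), (a : ℂ)) * 2 = (n + 1) * n := by
      rw [← Nat.cast_sum, ← Nat.cast_two, ← Nat.cast_mul, h]; push_cast; simp
    rw [mul_comm, h']
    simp⟩

theorem rhoCheck_mem_borel : rhoCheck n ∈ borel n := fun _ _ h =>
  Matrix.diagonal_apply_ne _ fun h' => h h'.le

theorem rhoCheck_lie_unit (a b : Fin (n + 1)) (h : a ≠ b) :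
    ⁅rhoCheck n, unit a b h⁆ = (2 * ((b : ℕ) - (a : ℕ)) : ℂ) • unit a b h := by
  refine Subtype.ext ?_
  rw [LieAlgebra.SpecialLinear.sl_bracket]
  change Matrix.diagonal _ * Matrix.single a b (1 : ℂ) - Matrix.single a b (1 : ℂ) *
    Matrix.diagonal _ = _ • Matrix.single a b (1 : ℂ)
  ext x y
  rw [Matrix.sub_apply, Matrix.diagonal_mul, Matrix.mul_diagonal, Matrix.smul_apply,
    Matrix.single_apply]
  split_ifs with h'
  · rw [← h'.1, ← h'.2, smul_eq_mul]
    ring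
  · simp

/-- The sum of the eigenspaces of `rhoCheck` for the eigenvalues `μ - 1, μ - 2, …`. -/
def lowerSpace (ρ : SL n →ₗ⁅ℂ⁆ Module.End ℂ U) (μ : ℂ) : Submodule ℂ U :=
  ⨆ k : ℕ, Module.End.eigenspace (ρ (rhoCheck n)) (μ - (k + 1))

/-- The root vectors of `𝔫⁻` lower the eigenvalue by `2 (a - b)`, written as `k + 1` to match the
definition of `lowerSpace`. -/
theorem unit_mem_eigenspace (ρ : SL n →ₗ⁅ℂ⁆ Module.End ℂ U) {a b : Fin (n + 1)} (h : b < a)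
    {ν : ℂ} {y : U} (hy : y ∈ Module.End.eigenspace (ρ (rhoCheck n)) ν) :
    ρ (unit a b h.ne') y ∈ Module.End.eigenspace (ρ (rhoCheck n))
      (ν - ((2 * (a - b) - 1 : ℕ) + 1 : ℂ)) := by
  rw [Module.End.mem_eigenspace_iff] at hy ⊢
  rw [map_lie_apply, hy, rhoCheck_lie_unit, map_smul, map_smul, LinearMap.smul_apply, ← add_smul]
  congr 1
  have h1 : (b : ℕ) < a := h
  have h2 : ((2 * ((a : ℕ) - b) - 1 : ℕ) : ℂ) + 1 = 2 * ((a : ℕ) - (b : ℕ)) := by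
    have h3 : (2 * ((a : ℕ) - b) - 1) + 1 = 2 * ((a : ℕ) - b) := by omega
    rw [← Nat.cast_add_one, h3]
    push_cast [Nat.cast_sub h1.le]
    ring
  rw [h2]
  ring

/-- A module generated by a `𝔟`-eigenvector `u` is the sum of `ℂ u` and of lower eigenspaces. -/
theorem cyclic_le_sup_lowerSpace (ρ : SL n →ₗ⁅ℂ⁆ Module.End ℂ U) {u : U}
    (hu : ∀ B ∈ borel n, ∃ c : ℂ, ρ B u = c • u) {μ : ℂ} (hμ : ρ (rhoCheck n) u = μ • u) :
    cyclic ρ u ≤ Submodule.span ℂ {u} ⊔ lowerSpace ρ μ := by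
  refine cyclic_le_of_nMinus ρ hu (Submodule.mem_sup_left (Submodule.mem_span_singleton_self u)) ?_
  intro F hF
  have hF' := mem_span_unit (r := fun x y => y < x) (fun x => lt_irrefl x) hF
  clear hF
  have hle : Submodule.span ℂ {u} ⊔ lowerSpace ρ μ ≤
      (lowerSpace ρ μ).comap (ρ F) := by
    induction hF' using Submodule.span_induction with
    | mem B hB =>
      obtain ⟨a, b, h, hba, rfl⟩ := hB
      refine sup_le ?_ (iSup_le fun k => ?_)
      · rw [Submodule.span_singleton_le_iff_mem, Submodule.mem_comap]
        exact Submodule.mem_iSup_of_mem _ (unit_mem_eigenspace ρ hba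
          (Module.End.mem_eigenspace_iff.2 hμ))
      · intro y hy
        have h1 := unit_mem_eigenspace ρ hba hy
        refine Submodule.mem_iSup_of_mem (k + (2 * (a - b) - 1 : ℕ) + 1) ?_
        convert h1 using 2
        push_cast
        ring
    | zero =>
      intro y _
      rw [Submodule.mem_comap, map_zero]
      exact Submodule.zero_mem _
    | add A B hA hB ihA ihB =>
      intro y hy
      rw [Submodule.mem_comap, map_add]
      exact Submodule.add_mem _ (ihA hy) (ihB hy)
    | smul c A hA ihA =>
      intro y hy
      rw [Submodule.mem_comap, map_smul]
      exact Submodule.smul_mem _ c (ihA hy)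
  exact fun y hy => Submodule.mem_sup_right (hle hy)

end Cyclic

/-! ### Embedding simple modules into polynomial modules -/

section Embedding

open MvPolynomial

variable {n : ℕ} {P : Type*}

/-- The representation of `sl_{n+1}` on polynomial functions of `P` vectors. -/
def polyRep (n : ℕ) (P : Type*) : SL n →ₗ⁅ℂ⁆ Module.End ℂ (MvPolynomial (P × Fin (n + 1)) ℂ) where
  toFun A := (glDer A.1).toLinearMap
  map_add' A B := congrArg (fun D => D.toLinearMap) (glDer_add (P := P) A.1 B.1)
  map_smul' c A := congrArg (fun D => D.toLinearMap) (glDer_smul (P := P) c A.1)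
  map_lie' {A B} := (congrArg (fun D => D.toLinearMap) (glDer_lie (P := P) A.1 B.1)).trans
    Derivation.commutator_coe_linear_map

variable {V : Type*} [AddCommGroup V] [Module ℂ V]

/-- The direct sum of two representations. -/
def prodRep {M : Type*} [AddCommGroup M] [Module ℂ M] (ρ : SL n →ₗ⁅ℂ⁆ Module.End ℂ V)
    (ρ' : SL n →ₗ⁅ℂ⁆ Module.End ℂ M) : SL n →ₗ⁅ℂ⁆ Module.End ℂ (V × M) where
  toFun A := (ρ A).prodMap (ρ' A)
  map_add' A B := by
    refine LinearMap.ext fun y => ?_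
    simp
  map_smul' c A := by
    refine LinearMap.ext fun y => ?_
    simp
  map_lie' {A B} := by
    refine LinearMap.ext fun y => ?_
    change (ρ ⁅A, B⁆ y.1, ρ' ⁅A, B⁆ y.2) = (ρ A (ρ B y.1), ρ' A (ρ' B y.2)) -
      (ρ B (ρ A y.1), ρ' B (ρ' A y.2))
    rw [Prod.mk_sub_mk, map_lie_apply ρ A B, map_lie_apply ρ' A B]
    simp

/-- Every stable subspace is trivial. -/
def IsIrreducibleRep (ρ : SL n →ₗ⁅ℂ⁆ Module.End ℂ V) : Prop :=
  ∀ W : Submodule ℂ V, IsStable ρ W → W = ⊥ ∨ W = ⊤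

/-- The conjugate transpose of a matrix of trace zero. -/
def conjTransposeSL (A : SL n) : SL n :=
  ⟨A.1.conjTranspose, by
    have h : A.1.trace = 0 := A.2
    refine LinearMap.mem_ker.2 ((Matrix.traceLinearMap_apply _ _ _ _).trans ?_)
    rw [Matrix.trace_conjTranspose, h, star_zero]⟩

/-- A simple module with highest weight vector `v` embeds into any polynomial module with a
highest weight vector `f` of the same weight.  The submodule `N` generated by `(v, f)` in the
direct sum is the graph of the embedding: if `(0, z) ∈ N`, then `z` is orthogonal to `f` for the
Fischer form, hence to the module generated by `f`, which contains `z`. -/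
theorem exists_embedding [Fintype P] (ρ : SL n →ₗ⁅ℂ⁆ Module.End ℂ V) (hρ : IsIrreducibleRep ρ)
    {v : V} (hv : v ≠ 0) {f : MvPolynomial (P × Fin (n + 1)) ℂ} (hf : f ≠ 0) (χ : SL n → ℂ)
    (hχ : star (χ (rhoCheck n)) = χ (rhoCheck n))
    (hρv : ∀ B ∈ borel n, ρ B v = χ B • v) (hρf : ∀ B ∈ borel n, glDer B.1 f = χ B • f) :
    ∃ φ : V →ₗ[ℂ] MvPolynomial (P × Fin (n + 1)) ℂ, Function.Injective φ ∧ φ v = f ∧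
      ∀ A y, φ (ρ A y) = glDer A.1 (φ y) := by
  set ρ₂ := prodRep ρ (polyRep n P) with hρ₂
  have hρ₂a : ∀ A y z, ρ₂ A (y, z) = (ρ A y, glDer A.1 z) := fun A y z => rfl
  set N := cyclic ρ₂ (v, f) with hN
  have hst : IsStable ρ₂ N := isStable_cyclic _ _
  have hmem : (v, f) ∈ N := mem_cyclic _ _
  have hNle : N ≤ Submodule.span ℂ {(v, f)} ⊔ lowerSpace ρ₂ (χ (rhoCheck n)) := by
    refine cyclic_le_sup_lowerSpace ρ₂ (fun B hB => ⟨χ B, ?_⟩) ?_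
    · rw [hρ₂a, hρv B hB, hρf B hB, Prod.smul_mk]
    · rw [hρ₂a, hρv _ rhoCheck_mem_borel, hρf _ rhoCheck_mem_borel, Prod.smul_mk]
  -- orthogonality to `f` of the elements of `N` with vanishing first component
  have horth : ∀ z, ((0 : V), z) ∈ N → fischer f z = 0 := by
    intro z hz
    obtain ⟨a, ha, b, hb, hab⟩ := Submodule.mem_sup.1 (hNle hz)
    obtain ⟨c, rfl⟩ := Submodule.mem_span_singleton.1 ha
    have hb1 : b.1 ∈ lowerSpace ρ (χ (rhoCheck n)) := by
      have : lowerSpace ρ₂ (χ (rhoCheck n)) ≤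
          (lowerSpace ρ (χ (rhoCheck n))).comap (LinearMap.fst ℂ V _) := by
        refine iSup_le fun k y hy => ?_
        refine Submodule.mem_iSup_of_mem k ?_
        rw [Module.End.mem_eigenspace_iff] at hy ⊢
        exact congrArg Prod.fst hy
      exact this hb
    have hb2 : fischer f b.2 = 0 := by
      have : lowerSpace ρ₂ (χ (rhoCheck n)) ≤
          (LinearMap.ker (fischer f)).comap (LinearMap.snd ℂ V _) := by
        refine iSup_le fun k y hy => ?_
        rw [Module.End.mem_eigenspace_iff] at hy
        have hy2 : glDer (rhoCheck n).1 y.2 = (χ (rhoCheck n) - (k + 1)) • y.2 :=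
          congrArg Prod.snd hy
        have h1 := fischer_glDer (rhoCheck n).1 f y.2
        have h2 : (rhoCheck n).1.conjTranspose = (rhoCheck n).1 := by
          change (Matrix.diagonal _).conjTranspose = Matrix.diagonal _
          rw [Matrix.diagonal_conjTranspose]
          congr 1
          funext a
          simp
        rw [hy2, h2, hρf _ rhoCheck_mem_borel, fischer_smul, hχ, map_smul, smul_eq_mul] at h1
        have h3 : ((k : ℂ) + 1) * fischer f y.2 = 0 := by linear_combination -h1
        exact (mul_eq_zero.1 h3).resolve_left (Nat.cast_add_one_ne_zero k)
      exact this hb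
    have hc : c = 0 := by
      have h1 : c • v + b.1 = 0 := congrArg Prod.fst hab
      have hdis := (Module.End.eigenspaces_iSupIndep (ρ (rhoCheck n))) (χ (rhoCheck n))
      have h2 : c • v = 0 := by
        refine Submodule.disjoint_def.1 hdis _ ?_ ?_
        · refine Submodule.smul_mem _ _ ?_
          rw [Module.End.mem_eigenspace_iff]
          exact hρv _ rhoCheck_mem_borel
        · have h3 : lowerSpace ρ (χ (rhoCheck n)) ≤ ⨆ j, ⨆ (_ : j ≠ χ (rhoCheck n)),
              Module.End.eigenspace (ρ (rhoCheck n)) j := by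
            refine iSup_le fun k => ?_
            refine le_iSup₂_of_le (χ (rhoCheck n) - (k + 1)) ?_ le_rfl
            intro h
            exact Nat.cast_add_one_ne_zero (R := ℂ) k (by linear_combination -h)
          refine h3 ?_
          rw [eq_neg_of_add_eq_zero_left h1]
          exact Submodule.neg_mem _ hb1
      exact (smul_eq_zero.1 h2).resolve_right hv
    have h4 : z = b.2 := by
      have := congrArg Prod.snd hab
      rw [hc, zero_smul, zero_add] at this
      exact this.symm
    rw [h4, hb2]
  -- the second component is determined by the first
  have hz0 : ∀ z, ((0 : V), z) ∈ N → z = 0 := by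
    let K : Submodule ℂ (MvPolynomial (P × Fin (n + 1)) ℂ) :=
      { carrier := {g | ∀ z, ((0 : V), z) ∈ N → fischer g z = 0}
        zero_mem' := fun z _ => fischer_zero z
        add_mem' := fun ha hb z hz => by rw [fischer_add, ha z hz, hb z hz, add_zero]
        smul_mem' := fun c g hg z hz => by rw [fischer_smul, hg z hz, mul_zero] }
    have hNK : N ≤ K.comap (LinearMap.snd ℂ V _) := by
      refine cyclic_le ρ₂ (fun z hz => horth z hz) ?_
      rintro A ⟨y, g⟩ hg z hz
      change fischer (glDer A.1 g) z = 0
      have h1 := fischer_glDer (conjTransposeSL A).1 g z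
      have h2 : (conjTransposeSL A).1.conjTranspose = A.1 := Matrix.conjTranspose_conjTranspose _
      rw [h2] at h1
      rw [← h1]
      refine hg _ ?_
      have h3 := hst (conjTransposeSL A) _ hz
      rwa [hρ₂a, map_zero] at h3
    exact fun z hz => eq_zero_of_fischer_self (hNK hz z hz)
  -- the first component is determined by the second
  have hy0 : ∀ y, (y, (0 : MvPolynomial (P × Fin (n + 1)) ℂ)) ∈ N → y = 0 := by
    let Y : Submodule ℂ V := N.comap (LinearMap.inl ℂ V _)
    have hY : IsStable ρ Y := by
      intro A y hy
      have h3 := hst A (y, 0) hy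
      rw [hρ₂a, map_zero] at h3
      exact h3
    rcases hρ Y hY with h | h
    · intro y hy
      have : y ∈ Y := hy
      rwa [h, Submodule.mem_bot] at this
    · exfalso
      have h1 : (v, (0 : MvPolynomial (P × Fin (n + 1)) ℂ)) ∈ N := by
        have : v ∈ Y := h ▸ Submodule.mem_top
        exact this
      have h2 := N.sub_mem hmem h1
      rw [Prod.mk_sub_mk, sub_self, sub_zero] at h2
      exact hf (hz0 f h2)
  have hsurj : ∀ y : V, ∃ z, (y, z) ∈ N := by
    have hW : IsStable ρ (N.map (LinearMap.fst ℂ V _)) := by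
      rintro A _ ⟨⟨y, z⟩, hyz, rfl⟩
      exact ⟨_, hst A _ hyz, rfl⟩
    rcases hρ _ hW with h | h
    · exfalso
      have : v ∈ N.map (LinearMap.fst ℂ V (MvPolynomial (P × Fin (n + 1)) ℂ)) := ⟨_, hmem, rfl⟩
      rw [h, Submodule.mem_bot] at this
      exact hv this
    · intro y
      have : y ∈ N.map (LinearMap.fst ℂ V (MvPolynomial (P × Fin (n + 1)) ℂ)) :=
        h ▸ Submodule.mem_top
      obtain ⟨⟨y', z⟩, hyz, rfl⟩ := this
      exact ⟨z, hyz⟩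
  have huniq : ∀ {y z z'}, (y, z) ∈ N → (y, z') ∈ N → z = z' := by
    intro y z z' h h'
    have h2 := N.sub_mem h h'
    rw [Prod.mk_sub_mk, sub_self] at h2
    exact sub_eq_zero.1 (hz0 _ h2)
  choose φ hφ using hsurj
  refine ⟨{ toFun := φ
            map_add' := fun y y' => huniq (hφ _) (N.add_mem (hφ y) (hφ y'))
            map_smul' := fun c y => huniq (hφ _) (N.smul_mem c (hφ y)) }, ?_,
    huniq (hφ v) hmem, fun A y => huniq (hφ _) (hst A _ (hφ y))⟩
  refine (injective_iff_map_eq_zero _).2 fun y hy => hy0 y ?_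
  have h := hφ y
  rwa [show φ y = 0 from hy] at h

end Embedding

/-! ### Powers of minors as highest weight vectors -/

section RefVector

open MvPolynomial

variable (m : ℕ) {i n : ℕ} (h : i ≤ n + 1)

/-- For the `j`-th family of `i` vectors, the matrix of their first `i` coordinates. -/
def topBlock (j : Fin m) :
    Matrix (Fin i) (Fin i) (MvPolynomial ((Fin m × Fin i) × Fin (n + 1)) ℂ) :=
  Matrix.of fun a r => X ((j, r), Fin.castLE h a)

/-- The product of the top minors of `m` families of `i` vectors, a highest weight vector of weight
`m ω_i`.  Taking `m` independent families instead of the `m`-th power of one minor amounts to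
working in the `m`-th tensor power of the exterior power `Λ^i`. -/
def refVector : MvPolynomial ((Fin m × Fin i) × Fin (n + 1)) ℂ :=
  ∏ j, (topBlock m h j).det

theorem sum_castLE {R : Type*} [AddCommMonoid R] (g : Fin (n + 1) → R)
    (hg : ∀ a : Fin (n + 1), i ≤ (a : ℕ) → g a = 0) :
    ∑ a, g a = ∑ a : Fin i, g (Fin.castLE h a) := by
  refine (Fintype.sum_of_injective (Fin.castLE h) (Fin.castLE_injective h) _ _ ?_
    fun _ => rfl).symm
  intro a ha
  refine hg a ?_
  by_contra hlt
  exact ha ⟨⟨a, not_le.1 hlt⟩, rfl⟩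

/-- Upper triangular matrices act on `refVector` by a scalar. -/
theorem glDer_refVector (A : Matrix (Fin (n + 1)) (Fin (n + 1)) ℂ)
    (hA : ∀ x y, y < x → A x y = 0) :
    glDer A (refVector m h) =
      ((m : ℂ) * ∑ a : Fin i, A (Fin.castLE h a) (Fin.castLE h a)) • refVector m h := by
  have key : ∀ j : Fin m, glDer A (topBlock m h j).det =
      C (∑ a : Fin i, A (Fin.castLE h a) (Fin.castLE h a)) * (topBlock m h j).det := by
    intro j
    rw [derivation_det_of_mul_left (glDer A) (topBlock m h j)
      (Matrix.of fun a c => C (A (Fin.castLE h c) (Fin.castLE h a)))]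
    · rw [Matrix.trace, map_sum]
      rfl
    · intro a r
      change glDer A (X ((j, r), Fin.castLE h a)) = _
      rw [glDer_X, Matrix.mul_apply, sum_castLE h]
      · refine Finset.sum_congr rfl fun c _ => ?_
        rw [smul_eq_C_mul]
        rfl
      · intro c hc
        rw [hA _ _ (Fin.lt_def.2 (lt_of_lt_of_le a.2 hc)), zero_smul]
  rw [refVector, derivation_prod_of_eq_mul (glDer A) _ _ key, Finset.sum_const, Finset.card_univ,
    Fintype.card_fin, smul_eq_C_mul, C_mul, nsmul_eq_mul]
  simp

theorem refVector_ne_zero : refVector m h ≠ 0 := by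
  intro h0
  have h1 := congrArg (eval fun q : (Fin m × Fin i) × Fin (n + 1) =>
    if q.2 = Fin.castLE h q.1.2 then (1 : ℂ) else 0) h0
  rw [map_zero, refVector, map_prod] at h1
  have h2 : ∀ j : Fin m, eval (fun q : (Fin m × Fin i) × Fin (n + 1) =>
      if q.2 = Fin.castLE h q.1.2 then (1 : ℂ) else 0) (topBlock m h j).det = 1 := by
    intro j
    rw [RingHom.map_det, ← Matrix.det_one (n := Fin i)]
    congr 1
    ext a r
    simp [topBlock, Matrix.one_apply]
  simp [h2] at h1

/-- The exchange of the vectors `r` and `r'` of the `j`-th family. -/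
def swapIn (j : Fin m) (r r' : Fin i) : Fin m × Fin i → Fin m × Fin i :=
  fun p => if p.1 = j then (p.1, Equiv.swap r r' p.2) else p

/-- Polynomials which are linear in each vector and alternating in the vectors of each family. -/
def altSpace (m i n : ℕ) : Submodule ℂ (MvPolynomial ((Fin m × Fin i) × Fin (n + 1)) ℂ) where
  carrier := {F | (∀ p, eulerDer (fun q => if q.1 = p then 1 else 0) F = F) ∧
    ∀ j r r', r ≠ r' → rename (Prod.map (swapIn m j r r') id) F = -F}
  zero_mem' := by simp
  add_mem' ha hb := ⟨fun p => by rw [map_add, ha.1, hb.1], fun j r r' hr => by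
    rw [map_add, ha.2 j r r' hr, hb.2 j r r' hr, neg_add]⟩
  smul_mem' c _ ha := ⟨fun p => by rw [Derivation.map_smul, ha.1], fun j r r' hr => by
    rw [map_smul, ha.2 j r r' hr, smul_neg]⟩

theorem glDer_mem_altSpace (A : Matrix (Fin (n + 1)) (Fin (n + 1)) ℂ)
    {F : MvPolynomial ((Fin m × Fin i) × Fin (n + 1)) ℂ} (hF : F ∈ altSpace m i n) :
    glDer A F ∈ altSpace m i n := by
  refine ⟨fun p => ?_, fun j r r' hr => ?_⟩
  · rw [eulerDer_glDer_comm (fun p' => if p' = p then 1 else 0), hF.1]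
  · rw [rename_glDer, hF.2 j r r' hr, map_neg]

theorem refVector_mem_altSpace : refVector m h ∈ altSpace m i n := by
  classical
  refine ⟨fun p => ?_, fun j r r' hr => ?_⟩
  · obtain ⟨j, r⟩ := p
    have key : ∀ j' : Fin m, eulerDer (fun q => if q.1 = (j, r) then 1 else 0)
        (topBlock m h j').det = (if j' = j then 1 else 0) * (topBlock m h j').det := by
      intro j'
      rw [derivation_det_of_mul_right _ (topBlock m h j')
        (Matrix.diagonal fun r' => if (j', r') = (j, r) then 1 else 0)]
      · rw [Matrix.trace_diagonal]
        congr 1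
        by_cases hj : j' = j
        · simp [hj]
        · simp [hj]
      · intro a r'
        change eulerDer _ (X ((j', r'), Fin.castLE h a)) = _
        rw [eulerDer_X, Matrix.mul_diagonal]
        change _ = X ((j', r'), Fin.castLE h a) * _
        split_ifs <;> simp
    rw [refVector, derivation_prod_of_eq_mul _ _ _ key]
    simp
  · have key : ∀ j' : Fin m, rename (Prod.map (swapIn m j r r') id) (topBlock m h j').det =
        (if j' = j then -1 else 1) * (topBlock m h j').det := by
      intro j'
      rw [AlgHom.map_det]
      by_cases hj : j' = j
      · rw [if_pos hj]
        have h1 := Matrix.det_permute' (Equiv.swap r r') (topBlock m h j')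
        rw [Equiv.Perm.sign_swap hr] at h1
        have h2 : (rename (Prod.map (swapIn m j r r') id)).mapMatrix (topBlock m h j') =
            (topBlock m h j').submatrix id (Equiv.swap r r') := by
          refine Matrix.ext fun a c => ?_
          simp [topBlock, swapIn, hj]
        rw [h2, h1]
        simp
      · rw [if_neg hj, one_mul]
        congr 1
        refine Matrix.ext fun a c => ?_
        simp [topBlock, swapIn, hj]
    rw [refVector, map_prod, Finset.prod_congr rfl fun j' _ => key j', Finset.prod_mul_distrib,
      Finset.prod_ite_eq' Finset.univ j (fun _ => (-1 : MvPolynomial _ ℂ))]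
    simp

theorem sum_eq_one_of_mem_altSpace {F : MvPolynomial ((Fin m × Fin i) × Fin (n + 1)) ℂ}
    (hF : F ∈ altSpace m i n) {e : ((Fin m × Fin i) × Fin (n + 1)) →₀ ℕ} (he : coeff e F ≠ 0)
    (p : Fin m × Fin i) : ∑ a, e (p, a) = 1 := by
  have h1 := congrArg (coeff e) (hF.1 p)
  rw [coeff_eulerDer] at h1
  have h2 := mul_right_cancel₀ he (h1.trans (one_mul _).symm)
  rw [Fintype.sum_prod_type, Finset.sum_eq_single p] at h2
  · simp only [if_true, mul_one] at h2
    exact_mod_cast h2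
  · intro p' _ hp'
    simp [hp']
  · simp

/-- No coordinate occurs twice in a monomial of an alternating polynomial. -/
theorem sum_le_one_of_mem_altSpace {F : MvPolynomial ((Fin m × Fin i) × Fin (n + 1)) ℂ}
    (hF : F ∈ altSpace m i n) {e : ((Fin m × Fin i) × Fin (n + 1)) →₀ ℕ} (he : coeff e F ≠ 0)
    (j : Fin m) (a : Fin (n + 1)) : ∑ r, e ((j, r), a) ≤ 1 := by
  have h1 := sum_eq_one_of_mem_altSpace m hF he
  have hle : ∀ p a, e (p, a) ≤ 1 := fun p a => by
    refine le_of_le_of_eq ?_ (h1 p)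
    exact Finset.single_le_sum (f := fun a => e (p, a)) (fun _ _ => Nat.zero_le _)
      (Finset.mem_univ a)
  have hind : ∀ p a, e (p, a) = 1 → ∀ a', e (p, a') = if a' = a then 1 else 0 := by
    intro p a ha a'
    split_ifs with h'
    · rw [h', ha]
    · have h2 := h1 p
      rw [← Finset.add_sum_erase _ _ (Finset.mem_univ a), ha, Nat.add_eq_left,
        Finset.sum_eq_zero_iff] at h2
      exact h2 a' (Finset.mem_erase.2 ⟨h', Finset.mem_univ _⟩)
  by_contra! hgt
  obtain ⟨r, r', hr, hr1, hr2⟩ : ∃ r r', r ≠ r' ∧ e ((j, r), a) = 1 ∧ e ((j, r'), a) = 1 := by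
    obtain ⟨r, _, hr⟩ := Finset.exists_ne_zero_of_sum_ne_zero (ne_of_gt (zero_lt_one.trans hgt))
    rw [← Finset.add_sum_erase _ _ (Finset.mem_univ r)] at hgt
    have h2 := hle (j, r) a
    have h3 : ∑ x ∈ Finset.univ.erase r, e ((j, x), a) ≠ 0 := by omega
    obtain ⟨r', hr', hr''⟩ := Finset.exists_ne_zero_of_sum_ne_zero h3
    have h4 := hle (j, r') a
    exact ⟨r, r', (Finset.ne_of_mem_erase hr').symm, by omega, by omega⟩
  set τ := Prod.map (swapIn m j r r') (id : Fin (n + 1) → Fin (n + 1)) with hτ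
  have hinv : Function.Involutive τ := by
    rintro ⟨⟨j', s⟩, b⟩
    by_cases hj : j' = j
    · simp [hτ, swapIn, hj]
    · simp [hτ, swapIn, hj]
  have heτ : ∀ q, e (τ q) = e q := by
    rintro ⟨⟨j', s⟩, b⟩
    by_cases hj : j' = j
    · subst hj
      have h5 : τ ((j', s), b) = ((j', Equiv.swap r r' s), b) := by simp [hτ, swapIn]
      rw [h5]
      rcases eq_or_ne s r with rfl | h6
      · rw [Equiv.swap_apply_left, hind _ _ hr1, hind _ _ hr2]
      · rcases eq_or_ne s r' with rfl | h7
        · rw [Equiv.swap_apply_right, hind _ _ hr1, hind _ _ hr2]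
        · rw [Equiv.swap_apply_of_ne_of_ne h6 h7]
    · simp [hτ, swapIn, hj]
  have hmap : e.mapDomain τ = e := by
    ext q
    conv_lhs => rw [← hinv q, Finsupp.mapDomain_apply hinv.injective]
    exact heτ q
  have h8 := coeff_rename_mapDomain τ hinv.injective F e
  rw [hmap, hF.2 j r r' hr, coeff_neg] at h8
  exact he (self_eq_neg.1 h8.symm)

end RefVector

section Weights

open MvPolynomial

variable {n i m : ℕ} {V : Type*} [AddCommGroup V] [Module ℂ V]

/-- The value of the weight `μ` on the diagonal of a matrix. -/
def weightValue (μ : Weight n) (A : SL n) : ℂ := ∑ a, (μ a : ℂ) * A.1 a a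

theorem sum_smul_fundWeight (h : i ≤ n + 1) (g : Fin (n + 1) → ℂ) :
    ∑ a, ((((m : ℤ) • fundWeight n i) a : ℤ) : ℂ) * g a =
      (m : ℂ) * ∑ a : Fin i, g (Fin.castLE h a) := by
  rw [sum_castLE h, Finset.mul_sum]
  · refine Finset.sum_congr rfl fun a _ => ?_
    have : fundWeight n i (Fin.castLE h a) = 1 := if_pos a.2
    simp [this]
  · intro a ha
    have : fundWeight n i a = 0 := if_neg (not_lt.2 ha)
    simp [this]

theorem glDer_refVector_borel (h : i ≤ n + 1) {B : SL n} (hB : B ∈ borel n) :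
    glDer B.1 (refVector m h) = weightValue ((m : ℤ) • fundWeight n i) B • refVector m h := by
  rw [glDer_refVector m h B.1 fun x y hxy => hB x y (not_le.2 hxy), weightValue,
    sum_smul_fundWeight h]

/-- A representation with a vector on which `𝔟` acts through the weight `m ω_i`. -/
structure IsHighestWeightRep (i m : ℕ) (ρ : SL n →ₗ⁅ℂ⁆ Module.End ℂ V) (v : V) : Prop where
  irreducible : IsIrreducibleRep ρ
  ne_zero : v ≠ 0
  borel_apply : ∀ B ∈ borel n, ρ B v = weightValue ((m : ℤ) • fundWeight n i) B • v

variable {ρ : SL n →ₗ⁅ℂ⁆ Module.End ℂ V} {v : V}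

theorem IsHighestWeightRep.exists_embedding (hv : IsHighestWeightRep i m ρ v) (h : i ≤ n + 1) :
    ∃ φ : V →ₗ[ℂ] MvPolynomial ((Fin m × Fin i) × Fin (n + 1)) ℂ, Function.Injective φ ∧
      φ v = refVector m h ∧ ∀ A y, φ (ρ A y) = glDer A.1 (φ y) := by
  refine PBW.exists_embedding ρ hv.irreducible hv.ne_zero (refVector_ne_zero m h)
    (weightValue ((m : ℤ) • fundWeight n i)) ?_ hv.borel_apply
    fun B hB => glDer_refVector_borel h hB
  have h1 : ∀ a, (rhoCheck n).1 a a = (n : ℂ) - 2 * (a : ℕ) := fun a =>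
    Matrix.diagonal_apply_eq _ _
  simp only [weightValue, h1]
  simp

/-- The weights of a simple module of highest weight `m ω_i` have coordinates between `0` and `m`;
hence a root vector kills the extremal weight vector of weight `w(m ω_i)` if it would increase a
coordinate `m` or decrease a coordinate `0`. -/
theorem IsHighestWeightRep.unit_apply_eq_zero (hv : IsHighestWeightRep i m ρ v) (h : i ≤ n + 1)
    (w : Weyl n) {u : V}
    (hu : ∀ A : SL n, A.1.IsDiag →
      ρ A u = weightValue (actWeight w ((m : ℤ) • fundWeight n i)) A • u)
    (c d : Fin (n + 1)) (hcd : c ≠ d) (hw : ((w⁻¹ c : Fin (n + 1)) : ℕ) < i ∨ i ≤ (w⁻¹ d : ℕ)) :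
    ρ (unit c d hcd) u = 0 := by
  classical
  obtain ⟨φ, hφ, hφv, hφρ⟩ := hv.exists_embedding h
  have halt : ∀ y, φ y ∈ altSpace m i n := by
    have hst : IsStable ρ ((altSpace m i n).comap φ) := fun A y hy => by
      rw [Submodule.mem_comap, hφρ]
      exact glDer_mem_altSpace m A.1 hy
    rcases hv.irreducible _ hst with h1 | h1
    · exfalso
      have : v ∈ (altSpace m i n).comap φ := by
        rw [Submodule.mem_comap, hφv]
        exact refVector_mem_altSpace m h
      rw [h1, Submodule.mem_bot] at this
      exact hv.ne_zero this
    · intro y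
      have : y ∈ (altSpace m i n).comap φ := h1 ▸ Submodule.mem_top
      exact this
  set μ := actWeight w ((m : ℤ) • fundWeight n i) with hμ
  by_contra hne
  set F := φ (ρ (unit c d hcd) u) with hF
  have hF0 : F ≠ 0 := fun h0 => hne (hφ (h0.trans (map_zero φ).symm))
  obtain ⟨e, he⟩ := MvPolynomial.ne_zero_iff.1 hF0
  -- `N a` is the coordinate `a` of the weight of a monomial of `F`
  set N : Fin (n + 1) → ℕ := fun a => ∑ p, e (p, a) with hN
  have hNm : ∀ a, N a ≤ m := by
    intro a
    rw [hN]
    dsimp only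
    rw [Fintype.sum_prod_type]
    refine (Finset.sum_le_sum fun j _ => sum_le_one_of_mem_altSpace m (halt _) he j a).trans ?_
    simp
  have hNsum : ∑ a, N a = m * i := by
    rw [hN, Finset.sum_comm, Finset.sum_congr rfl fun p _ =>
      sum_eq_one_of_mem_altSpace m (halt _) he p]
    simp
  have hdiag : ∀ A : SL n, A.1.IsDiag →
      ∑ a, (N a : ℂ) * A.1 a a = weightValue μ A + A.1 c c - A.1 d d := by
    intro A hA
    have hbr : ⁅A, unit c d hcd⁆ = (A.1 c c - A.1 d d) • unit c d hcd := by
      refine Subtype.ext ?_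
      rw [LieAlgebra.SpecialLinear.sl_bracket]
      change A.1 * Matrix.single c d (1 : ℂ) - Matrix.single c d (1 : ℂ) * A.1 =
        _ • Matrix.single c d (1 : ℂ)
      rw [← hA.diagonal_diag]
      ext x y
      rw [Matrix.sub_apply, Matrix.diagonal_mul, Matrix.mul_diagonal, Matrix.smul_apply,
        Matrix.single_apply]
      split_ifs with h'
      · rw [← h'.1, ← h'.2]
        simp
      · simp
    have h1 : glDer A.1 F = (weightValue μ A + A.1 c c - A.1 d d) • F := by
      rw [hF, ← hφρ, map_lie_apply, hu A hA, hbr, map_smul, map_smul, LinearMap.smul_apply,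
        map_add, map_smul, map_smul, ← add_smul]
      congr 1
      ring
    rw [glDer_diagonal A.1 hA] at h1
    have h2 := congrArg (coeff e) h1
    rw [coeff_eulerDer, coeff_smul, smul_eq_mul] at h2
    rw [← mul_right_cancel₀ he h2, Fintype.sum_prod_type, Finset.sum_comm]
    refine Finset.sum_congr rfl fun a _ => ?_
    change ((∑ p, e (p, a) : ℕ) : ℂ) * A.1 a a = ∑ p, (e (p, a) : ℂ) * A.1 a a
    rw [Nat.cast_sum, Finset.sum_mul]
  -- the weight of `F`
  set ν : Fin (n + 1) → ℤ := fun a => μ a + (if a = c then 1 else 0) - (if a = d then 1 else 0)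
    with hν
  have hconst : ∀ a b, (N a : ℤ) - N b = ν a - ν b := by
    intro a b
    rcases eq_or_ne a b with rfl | hab
    · simp
    set A : SL n := LieAlgebra.SpecialLinear.singleSubSingle a b (1 : ℂ) with hA
    have hA1 : A.1 = Matrix.diagonal fun x =>
        (if x = a then 1 else 0) - (if x = b then 1 else 0) := by
      rw [hA, LieAlgebra.SpecialLinear.val_singleSubSingle]
      ext x y
      rw [Matrix.sub_apply, Matrix.single_apply, Matrix.single_apply, Matrix.diagonal_apply]
      by_cases hxy : x = y
      · subst hxy
        simp [eq_comm]
      · have h1 : ¬ (a = x ∧ a = y) := fun h' => hxy (h'.1.symm.trans h'.2)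
        have h2 : ¬ (b = x ∧ b = y) := fun h' => hxy (h'.1.symm.trans h'.2)
        simp [hxy, h1, h2]
    have h1 := hdiag A (by rw [hA1]; exact Matrix.isDiag_diagonal _)
    have h2 : ∀ x, A.1 x x = (if x = a then 1 else 0) - (if x = b then 1 else 0) := fun x => by
      rw [hA1, Matrix.diagonal_apply_eq]
    simp only [weightValue, h2, mul_sub, mul_ite, mul_one, mul_zero, Finset.sum_sub_distrib,
      Finset.sum_ite_eq', Finset.mem_univ, if_true] at h1
    have h3 : ((N a : ℤ) - N b : ℂ) = ((ν a - ν b : ℤ) : ℂ) := by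
      rw [hν]
      push_cast
      rw [h1]
      simp only [eq_comm (a := c), eq_comm (a := d)]
      ring
    exact_mod_cast h3
  have hνsum : ∑ a, ν a = m * i := by
    have h1 : ∑ a, μ a = ∑ a, ((m : ℤ) • fundWeight n i) a :=
      Equiv.sum_comp w⁻¹ ((m : ℤ) • fundWeight n i)
    have h2 : ∑ a, ((m : ℤ) • fundWeight n i) a = m * i := by
      have h3 := sum_smul_fundWeight (m := m) h fun _ => 1
      simp only [mul_one] at h3
      rw [← Int.cast_sum, Finset.sum_const, Finset.card_univ, Fintype.card_fin] at h3
      have h4 : ((∑ a, ((m : ℤ) • fundWeight n i) a : ℤ) : ℂ) = ((m * i : ℤ) : ℂ) := by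
        rw [h3]; push_cast; simp
      exact_mod_cast h4
    rw [hν, Finset.sum_sub_distrib, Finset.sum_add_distrib, h1, h2]
    simp
  -- matrices of trace zero determine a weight up to a constant, which is fixed by the degree
  have hNν : ∀ a, (N a : ℤ) = ν a := by
    intro a
    have h1 : ∑ b, ((N b : ℤ) - ν b) = ∑ _b : Fin (n + 1), ((N a : ℤ) - ν a) :=
      Finset.sum_congr rfl fun b _ => by linarith [hconst a b]
    rw [Finset.sum_sub_distrib, hνsum, ← Nat.cast_sum, hNsum, Finset.sum_const, Finset.card_univ,
      Fintype.card_fin, nsmul_eq_mul] at h1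
    have h2 : ((n + 1 : ℕ) : ℤ) ≠ 0 := by exact_mod_cast Nat.succ_ne_zero n
    have h3 := (mul_eq_zero.1 (h1.symm.trans (by push_cast; ring))).resolve_left h2
    linarith
  rcases hw with hc | hd
  · have h1 := hNν c
    have h2 : μ c = m := by
      change (m : ℤ) • fundWeight n i (w⁻¹ c) = m
      rw [fundWeight, if_pos hc, smul_eq_mul, mul_one]
    have h3 := hNm c
    rw [hν] at h1
    simp only [h2, if_true, if_neg hcd] at h1
    omega
  · have h1 := hNν d
    have h2 : μ d = 0 := by
      change (m : ℤ) • fundWeight n i (w⁻¹ d) = 0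
      rw [fundWeight, if_neg (not_lt.2 hd), smul_zero]
    rw [hν] at h1
    simp only [h2, if_true, if_neg hcd.symm] at h1
    omega

/-- The root vector `f_α`, `α = (a, b)` with `a ≤ i < b`, satisfies `f_α^{m+1} v = 0`, as `v` is a
primitive vector of weight `m` for the `sl_2`-triple of `α`. -/
theorem IsHighestWeightRep.unit_pow_apply_eq_zero [FiniteDimensional ℂ V]
    (hv : IsHighestWeightRep i m ρ v) {a b : Fin (n + 1)} (ha : (a : ℕ) < i) (hb : i ≤ (b : ℕ))
    (hba : b ≠ a) : (ρ (unit b a hba) ^ (m + 1)) v = 0 := by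
  classical
  have hab : a < b := Fin.lt_def.2 (lt_of_lt_of_le ha hb)
  let _ : LieRingModule (SL n) V := LieRingModule.compLieHom V ρ
  have _ : LieModule ℂ (SL n) V := LieModule.compLieHom V ρ
  set t : SL n := LieAlgebra.SpecialLinear.singleSubSingle a b (1 : ℂ) with ht
  have htv : t.1 = Matrix.single a a 1 - Matrix.single b b 1 :=
    LieAlgebra.SpecialLinear.val_singleSubSingle a b 1
  have htr : IsSl2Triple t (unit a b hab.ne) (unit b a hab.ne') := by
    refine ⟨?_, ?_, ?_, ?_⟩
    · intro h0
      have h1 : t.1 a a = 0 := by rw [h0]; rfl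
      rw [htv] at h1
      simp [hab.ne'] at h1
    · refine Subtype.ext ?_
      rw [LieAlgebra.SpecialLinear.sl_bracket, htv]
      change Matrix.single a b (1 : ℂ) * Matrix.single b a 1 - Matrix.single b a (1 : ℂ) *
        Matrix.single a b 1 = _
      simp
    · refine Subtype.ext ?_
      rw [LieAlgebra.SpecialLinear.sl_bracket, htv]
      change (_ - _) * Matrix.single a b (1 : ℂ) - Matrix.single a b (1 : ℂ) * (_ - _) =
        2 • Matrix.single a b (1 : ℂ)
      rw [sub_mul, mul_sub]
      simp [hab.ne', two_smul]
    · refine Subtype.ext ?_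
      rw [LieAlgebra.SpecialLinear.sl_bracket, htv]
      change (_ - _) * Matrix.single b a (1 : ℂ) - Matrix.single b a (1 : ℂ) * (_ - _) =
        -(2 • Matrix.single b a (1 : ℂ))
      rw [sub_mul, mul_sub]
      simp [hab.ne, two_smul]
      abel
  have hprim : htr.HasPrimitiveVectorWith v (m : ℂ) := by
    refine ⟨hv.ne_zero, ?_, ?_⟩
    · have htb : t ∈ borel n := by
        intro x y hxy
        rw [htv, Matrix.sub_apply, Matrix.single_apply, Matrix.single_apply]
        have h1 : ¬ (a = x ∧ a = y) := fun h' => hxy (h'.1.symm.trans h'.2).le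
        have h2 : ¬ (b = x ∧ b = y) := fun h' => hxy (h'.1.symm.trans h'.2).le
        simp [h1, h2]
      change ρ t v = _
      rw [hv.borel_apply t htb]
      congr 1
      rw [weightValue, htv]
      simp [Matrix.single_apply, mul_sub, Finset.sum_sub_distrib, fundWeight, ha, not_lt.2 hb]
    · change ρ (unit a b hab.ne) v = 0
      rw [hv.borel_apply _ (unit_mem _ _ hab.le)]
      have : weightValue ((m : ℤ) • fundWeight n i) (unit a b hab.ne) = 0 := by
        refine Finset.sum_eq_zero fun x _ => ?_
        change _ * Matrix.single a b (1 : ℂ) x x = 0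
        rw [Matrix.single_apply, if_neg fun h' => hab.ne (h'.1.trans h'.2.symm), mul_zero]
      rw [this, zero_smul]
  exact hprim.pow_toEnd_f_eq_zero_of_eq_nat rfl

end Weights

/-! ### Leading monomials of minors -/

section Leading

open MvPolynomial

variable {σ : Type*}

/-- `s` is the unique monomial of `p` of largest weight, for the weights `ω` of the variables. -/
def IsLeadingExponent (ω : σ → ℕ) (p : MvPolynomial σ ℂ) (s : σ →₀ ℕ) : Prop :=
  coeff s p ≠ 0 ∧ ∀ e, coeff e p ≠ 0 → e = s ∨ Finsupp.weight ω e < Finsupp.weight ω s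

theorem IsLeadingExponent.one (ω : σ → ℕ) : IsLeadingExponent ω (1 : MvPolynomial σ ℂ) 0 := by
  classical
  refine ⟨by simp, fun e he => Or.inl ?_⟩
  rw [coeff_one] at he
  exact (of_not_not fun h => he (if_neg h)).symm

theorem IsLeadingExponent.mul {ω : σ → ℕ} {p q : MvPolynomial σ ℂ} {s t : σ →₀ ℕ}
    (hp : IsLeadingExponent ω p s) (hq : IsLeadingExponent ω q t) :
    IsLeadingExponent ω (p * q) (s + t) := by
  classical
  constructor
  · rw [coeff_mul, Finset.sum_eq_single (s, t)]
    · exact mul_ne_zero hp.1 hq.1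
    · rintro ⟨u, u'⟩ hu hne
      by_contra h0
      have hsum : u + u' = s + t := Finset.HasAntidiagonal.mem_antidiagonal.1 hu
      have h1 := hp.2 u (left_ne_zero_of_mul h0)
      have h2 := hq.2 u' (right_ne_zero_of_mul h0)
      have h3 := congrArg (Finsupp.weight ω) hsum
      rw [map_add, map_add] at h3
      rcases h1 with rfl | h1
      · exact hne (by rw [add_left_cancel hsum])
      · rcases h2 with rfl | h2
        · omega
        · omega
    · intro h
      exact (h (by rw [Finset.HasAntidiagonal.mem_antidiagonal])).elim
  · intro e he
    rw [coeff_mul] at he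
    obtain ⟨⟨u, u'⟩, hu, h0⟩ := Finset.exists_ne_zero_of_sum_ne_zero he
    obtain rfl : u + u' = e := Finset.HasAntidiagonal.mem_antidiagonal.1 hu
    rw [map_add, map_add]
    rcases hp.2 u (left_ne_zero_of_mul h0) with rfl | h1
    · rcases hq.2 u' (right_ne_zero_of_mul h0) with rfl | h2
      · exact Or.inl rfl
      · exact Or.inr (by omega)
    · rcases hq.2 u' (right_ne_zero_of_mul h0) with rfl | h2
      · exact Or.inr (by omega)
      · exact Or.inr (by omega)

theorem IsLeadingExponent.prod {ω : σ → ℕ} {κ : Type*} (T : Finset κ)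
    {p : κ → MvPolynomial σ ℂ} {s : κ → σ →₀ ℕ} (h : ∀ j, IsLeadingExponent ω (p j) (s j)) :
    IsLeadingExponent ω (∏ j ∈ T, p j) (∑ j ∈ T, s j) := by
  classical
  induction T using Finset.induction_on with
  | empty => simpa using IsLeadingExponent.one ω
  | insert a T ha ih =>
    rw [Finset.prod_insert ha, Finset.sum_insert ha]
    exact (h a).mul ih

/-- A permutation moving only points of `T` and not reversing a function that is strictly
increasing on `T` is the identity. -/
theorem perm_eq_one_of_monovaryOn {i : ℕ} {T : Set (Fin i)} (S : Fin i → ℕ)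
    (hS : ∀ r ∈ T, ∀ r' ∈ T, r < r' → S r < S r') (τ : Equiv.Perm (Fin i))
    (hτ : ∀ r, τ r ≠ r → r ∈ T) (hmono : MonovaryOn (fun r => (τ r : ℕ)) S T) : τ = 1 := by
  by_contra hne
  obtain ⟨r₁, hr₁⟩ : ∃ r, τ r ≠ r := by
    by_contra! h
    exact hne (Equiv.ext h)
  obtain ⟨r, hr, hmin⟩ := (wellFounded_lt (α := Fin i)).has_min {r | τ r ≠ r} ⟨r₁, hr₁⟩
  have hr' : τ r ≠ r := hr
  have hfix : ∀ t, t < r → τ t = t := fun t ht => not_not.1 fun h => hmin t h ht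
  have hlt : r < τ r := by
    refine lt_of_le_of_ne (not_lt.1 fun h => hr' (τ.injective (hfix _ h))) (Ne.symm hr')
  obtain ⟨t, ht⟩ := τ.surjective r
  have htr : t ≠ r := by
    rintro rfl
    exact hr' ht
  have htT : t ∈ T := hτ t (by rw [ht]; exact htr.symm)
  have hrt : r < t := by
    refine lt_of_le_of_ne (not_lt.1 fun h => htr ((hfix t h).symm.trans ht)) (Ne.symm htr)
  have h1 : ((τ r : Fin i) : ℕ) ≤ (τ t : Fin i) :=
    hmono (hτ r hr') htT (hS r (hτ r hr') t htT hrt)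
  rw [ht] at h1
  exact absurd hlt (not_lt.2 (Fin.le_def.2 h1))

variable {n i m : ℕ} {w : Weyl n}

/-- The families of pairs `(a, b)` which are strictly increasing in both entries; they index the
diagonals of the minors of the matrix with entries indexed by `R⁻_w`. -/
def IsDiagonalSet (A : Finset (RootsNeg w)) : Prop :=
  ∀ α ∈ A, ∀ β ∈ A, α ≠ β →
    (α.1.1 < β.1.1 ∧ α.1.2 < β.1.2) ∨ (β.1.1 < α.1.1 ∧ β.1.2 < α.1.2)

/-- The roots `(a, b)` of `R⁻_w` satisfy `a ≤ i < b` in the numbering from `1`. -/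
def IsBlock (i : ℕ) (w : Weyl n) : Prop :=
  ∀ α : RootsNeg w, (α.1.1 : ℕ) < i ∧ i ≤ (α.1.2 : ℕ)

/-- The exponent of the product of the variables in `A`. -/
def indicatorExponent (A : Finset (RootsNeg w)) : RootsNeg w →₀ ℕ :=
  ∑ α ∈ A, Finsupp.single α 1

/-- The weight of the variable indexed by the pair `(a, b)` is `a b`; by the rearrangement
inequality, the diagonal is the leading monomial of a minor. -/
def pairWeight (α : RootsNeg w) : ℕ := (α.1.1 : ℕ) * α.1.2

theorem weight_indicatorExponent (A : Finset (RootsNeg w)) :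
    Finsupp.weight pairWeight (indicatorExponent A) = ∑ α ∈ A, pairWeight α := by
  rw [indicatorExponent, map_sum]
  exact Finset.sum_congr rfl fun α _ => by rw [Finsupp.weight_single, one_smul]

/-- Evaluation at the vectors `exp(∑ c_α e_α) E_{S p}`, with the parameters `c_α` as variables; here
`e_α` is the transpose of `f_α`, because `glDer A` is the derivative along `Aᵀ`. -/
def expEval {P : Type*} (w : Weyl n) (S : P → Fin (n + 1)) :
    MvPolynomial (P × Fin (n + 1)) ℂ →ₐ[ℂ] MvPolynomial (RootsNeg w) ℂ :=
  aeval fun q => (if q.2 = S q.1 then 1 else 0) +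
    ∑ α : RootsNeg w, if α.1.1 = q.2 ∧ α.1.2 = S q.1 then X α else 0

/-- Since the `e_α` have products zero, the action of `f_α` becomes the derivative by `c_α`. -/
theorem expEval_glDer {P : Type*} (hw : IsBlock i w) (S : P → Fin (n + 1)) (α : RootsNeg w)
    (f : MvPolynomial (P × Fin (n + 1)) ℂ) :
    expEval w S (glDer (unit α.1.2 α.1.1 α.2.1.ne').1 f) = pderiv α (expEval w S f) := by
  classical
  have key : ∀ q, expEval w S (glDer (unit α.1.2 α.1.1 α.2.1.ne').1 (X q)) =
      pderiv α (expEval w S (X q)) := by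
    rintro ⟨p', c⟩
    have h1 : glDer (unit α.1.2 α.1.1 α.2.1.ne').1 (X (p', c)) =
        (if α.1.1 = c then X (p', α.1.2) else 0 : MvPolynomial (P × Fin (n + 1)) ℂ) := by
      rw [glDer_X]
      change ∑ a, Matrix.single α.1.2 α.1.1 (1 : ℂ) a c • _ = _
      split_ifs with h
      · rw [Finset.sum_eq_single α.1.2]
        · rw [← h, Matrix.single_apply_same, one_smul]
        · intro a _ ha
          rw [Matrix.single_apply, if_neg fun h' => ha h'.1.symm, zero_smul]
        · simp
      · refine Finset.sum_eq_zero fun a _ => ?_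
        rw [Matrix.single_apply, if_neg fun h' => h h'.2, zero_smul]
    have h2 : ∀ β : RootsNeg w, β.1.1 ≠ α.1.2 := fun β hβ => by
      have h3 := (hw β).1
      have h4 := (hw α).2
      rw [hβ] at h3
      omega
    rw [h1, expEval, aeval_X, map_add, map_sum]
    have h5 : ∀ β : RootsNeg w,
        pderiv α (if β.1.1 = c ∧ β.1.2 = S p' then X β else 0 : MvPolynomial (RootsNeg w) ℂ) =
        if β = α then (if α.1.1 = c ∧ α.1.2 = S p' then 1 else 0) else 0 := by
      intro β
      by_cases hβ : β = α
      · subst hβ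
        rw [if_pos rfl]
        split_ifs <;> simp
      · rw [if_neg hβ]
        split_ifs
        · exact pderiv_X_of_ne hβ
        · exact map_zero _
    have h6 : pderiv α (if c = S p' then 1 else 0 : MvPolynomial (RootsNeg w) ℂ) = 0 := by
      split_ifs <;> simp
    rw [Finset.sum_congr rfl fun β _ => h5 β, h6, Finset.sum_ite_eq' Finset.univ α, zero_add,
      if_pos (Finset.mem_univ α)]
    by_cases hc : α.1.1 = c
    · rw [if_pos hc, aeval_X]
      simp [h2, hc]
    · simp [hc]
  induction f using MvPolynomial.induction_on with
  | C a => simp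
  | add p q hp hq => rw [map_add, map_add, hp, hq, map_add, map_add]
  | mul_X p q hp =>
    rw [Derivation.leibniz, map_add, smul_eq_mul, smul_eq_mul, map_mul, map_mul, hp, map_mul,
      Derivation.leibniz, smul_eq_mul, smul_eq_mul, key]

/-- Iterated derivatives pick out coefficients. -/
theorem factorial_mul_coeff_pderiv_orbit {y : (RootsNeg w →₀ ℕ) → MvPolynomial (RootsNeg w) ℂ}
    (hy : ∀ α s, y (s + Finsupp.single α 1) = pderiv α (y s)) (s e : RootsNeg w →₀ ℕ) :
    (∏ q, ((e q).factorial : ℂ)) * coeff e (y s) =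
      (∏ q, (((e + s : RootsNeg w →₀ ℕ) q).factorial : ℂ)) * coeff (e + s) (y 0) := by
  induction hd : s.degree generalizing s e with
  | zero =>
    obtain rfl : s = 0 := (Finsupp.degree_eq_zero_iff s).1 hd
    rw [add_zero]
  | succ d ih =>
    obtain ⟨t, α, rfl, ht⟩ := exists_eq_add_single_of_degree_eq_succ hd
    rw [hy, coeff_pderiv]
    have h1 := ih t (e + Finsupp.single α 1) ht
    rw [prod_factorial_add_single] at h1
    rw [show e + (t + Finsupp.single α 1) = e + Finsupp.single α 1 + t by abel, ← h1]
    ring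

/-- The basis vector selected for the column `r` of a minor: the second entry `b` of a pair
`(r, b) ∈ A`, or `r` if there is none. -/
def selection (h : i ≤ n + 1) (A : Finset (RootsNeg w)) (r : Fin i) : Fin (n + 1) :=
  open Classical in
  if hr : ∃ α ∈ A, (α.1.1 : ℕ) = r then hr.choose.1.2 else Fin.castLE h r

theorem selection_eq (h : i ≤ n + 1) {A : Finset (RootsNeg w)} (hA : IsDiagonalSet A)
    {α : RootsNeg w} (hα : α ∈ A) {r : Fin i} (hr : (α.1.1 : ℕ) = r) :
    selection h A r = α.1.2 := by
  have hex : ∃ α ∈ A, (α.1.1 : ℕ) = r := ⟨α, hα, hr⟩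
  rw [selection, dif_pos hex]
  by_contra hne
  have h1 := hA _ hex.choose_spec.1 _ hα fun h' => hne (by rw [h'])
  have h2 : hex.choose.1.1 = α.1.1 := Fin.ext (hex.choose_spec.2.trans hr.symm)
  rw [h2] at h1
  rcases h1 with h1 | h1
  · exact lt_irrefl _ h1.1
  · exact lt_irrefl _ h1.1

/-- Under `expEval`, the minor selected by `A` has the diagonal `∏_{α ∈ A} X_α` as leading
monomial. -/
theorem isLeadingExponent_det (hw : IsBlock i w) (h : i ≤ n + 1) {A : Finset (RootsNeg w)}
    (hA : IsDiagonalSet A) {M : Matrix (Fin i) (Fin i) (MvPolynomial (RootsNeg w) ℂ)}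
    (hM : ∀ a r, M a r = (if Fin.castLE h a = selection h A r then 1 else 0) +
      ∑ α : RootsNeg w, if α.1.1 = Fin.castLE h a ∧ α.1.2 = selection h A r then X α else 0) :
    IsLeadingExponent pairWeight M.det (indicatorExponent A) := by
  classical
  set T : Set (Fin i) := {r | ∃ α ∈ A, (α.1.1 : ℕ) = r} with hT
  set S : Fin i → ℕ := fun r => (selection h A r : ℕ) with hS
  -- entries in columns outside `T`
  have hout : ∀ a r, r ∉ T → M a r = if a = r then 1 else 0 := by
    intro a r hr
    have h1 : selection h A r = Fin.castLE h r := dif_neg hr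
    rw [hM, h1, Finset.sum_eq_zero, add_zero]
    · simp [(Fin.castLE_injective h).eq_iff]
    · intro α _
      rw [if_neg]
      rintro ⟨_, h2⟩
      have h3 := (hw α).2
      rw [h2] at h3
      exact absurd r.2 (not_lt.2 h3)
  -- entries in columns in `T`
  have hin : ∀ a r, r ∈ T → M a r =
      ∑ α : RootsNeg w, if α.1.1 = Fin.castLE h a ∧ α.1.2 = selection h A r then X α else 0 := by
    rintro a r ⟨α, hα, hr⟩
    rw [hM, if_neg, zero_add]
    rw [selection_eq h hA hα hr]
    intro h2
    have h3 := (hw α).2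
    rw [← h2] at h3
    exact absurd a.2 (not_lt.2 h3)
  have hentry : ∀ a r, M a r = 0 ∨ ∃ g : RootsNeg w →₀ ℕ, M a r = monomial g 1 ∧
      Finsupp.weight pairWeight g = (if r ∈ T then (a : ℕ) * S r else 0) ∧ (r ∉ T → a = r) := by
    intro a r
    by_cases hr : r ∈ T
    · rw [hin a r hr]
      by_cases hex : ∃ β : RootsNeg w, β.1.1 = Fin.castLE h a ∧ β.1.2 = selection h A r
      · obtain ⟨β, hβ⟩ := hex
        refine Or.inr ⟨Finsupp.single β 1, ?_, ?_, fun h' => absurd hr h'⟩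
        · rw [Finset.sum_eq_single β]
          · rw [if_pos hβ]; rfl
          · intro γ _ hγ
            rw [if_neg]
            rintro ⟨h1, h2⟩
            exact hγ (Subtype.ext (Prod.ext (h1.trans hβ.1.symm) (h2.trans hβ.2.symm)))
          · simp
        · rw [Finsupp.weight_single, one_smul, if_pos hr, pairWeight, hβ.1, hβ.2]
          rfl
      · refine Or.inl (Finset.sum_eq_zero fun β _ => if_neg fun hβ => hex ⟨β, hβ⟩)
    · rw [hout a r hr]
      by_cases har : a = r
      · exact Or.inr ⟨0, by rw [if_pos har]; rfl, by simp [hr], fun _ => har⟩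
      · exact Or.inl (if_neg har)
  have hSmono : ∀ r ∈ T, ∀ r' ∈ T, r < r' → S r < S r' := by
    rintro r ⟨α, hα, hαr⟩ r' ⟨β, hβ, hβr⟩ hrr
    have hrr' : (r : ℕ) < r' := hrr
    rw [hS]
    dsimp only
    rw [selection_eq h hA hα hαr, selection_eq h hA hβ hβr]
    have h1 := hA α hα β hβ (by
      rintro rfl
      omega)
    rcases h1 with h1 | h1
    · exact h1.2
    · have h2 : (β.1.1 : ℕ) < α.1.1 := h1.1
      omega
  -- the diagonal term
  have hdiag : ∏ r, M r r = monomial (indicatorExponent A) 1 := by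
    set g : RootsNeg w → Fin i := fun α => ⟨α.1.1, (hw α).1⟩ with hg
    have h1 : ∀ r, M r r = ∏ α ∈ A with g α = r, X α := by
      intro r
      by_cases hr : r ∈ T
      · rw [hin r r hr]
        obtain ⟨α, hα, hαr⟩ := hr
        have hαr' : α.1.1 = Fin.castLE h r := Fin.ext hαr
        have hfil : A.filter (fun β => g β = r) = {α} := by
          ext β
          simp only [Finset.mem_filter, Finset.mem_singleton]
          constructor
          · rintro ⟨hβ, hβr⟩
            by_contra hne
            have h2 : (β.1.1 : ℕ) = r := congrArg Fin.val hβr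
            have h3 : β.1.1 = α.1.1 := Fin.ext (h2.trans hαr.symm)
            rcases hA β hβ α hα hne with h4 | h4
            · exact absurd h4.1 (by rw [h3]; exact lt_irrefl _)
            · exact absurd h4.1 (by rw [h3]; exact lt_irrefl _)
          · rintro rfl
            exact ⟨hα, Fin.ext hαr⟩
        rw [hfil, Finset.prod_singleton, Finset.sum_eq_single α]
        · rw [if_pos ⟨hαr', (selection_eq h hA hα hαr).symm⟩]
        · intro γ _ hγ
          rw [if_neg]
          rintro ⟨h1, h2⟩
          exact hγ (Subtype.ext (Prod.ext (h1.trans hαr'.symm)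
            (h2.trans (selection_eq h hA hα hαr))))
        · simp
      · rw [hout r r hr, if_pos rfl, Finset.filter_false_of_mem, Finset.prod_empty]
        intro β hβ hβr
        exact hr ⟨β, hβ, congrArg Fin.val hβr⟩
    rw [Finset.prod_congr rfl fun r _ => h1 r, Finset.prod_fiberwise, indicatorExponent,
      monomial_sum_one]
    rfl
  have hwt : Finsupp.weight pairWeight (indicatorExponent A) =
      ∑ r with r ∈ T, (r : ℕ) * S r := by
    rw [weight_indicatorExponent]
    refine Finset.sum_bij (fun α _ => (⟨α.1.1, (hw α).1⟩ : Fin i)) ?_ ?_ ?_ ?_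
    · intro α hα
      exact Finset.mem_filter.2 ⟨Finset.mem_univ _, α, hα, rfl⟩
    · intro α hα β hβ hαβ
      by_contra hne
      have h3 : α.1.1 = β.1.1 := Fin.ext (congrArg (fun x : Fin i => (x : ℕ)) hαβ)
      rcases hA α hα β hβ hne with h4 | h4
      · exact absurd h4.1 (by rw [h3]; exact lt_irrefl _)
      · exact absurd h4.1 (by rw [h3]; exact lt_irrefl _)
    · intro r hr
      obtain ⟨α, hα, hαr⟩ := (Finset.mem_filter.1 hr).2
      exact ⟨α, hα, Fin.ext hαr⟩
    · intro α hα
      rw [pairWeight, hS]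
      dsimp only
      rw [selection_eq h hA hα rfl]
  -- the other terms have smaller weight
  have hother : ∀ τ : Equiv.Perm (Fin i), τ ≠ 1 → ∀ e, coeff e (∏ r, M (τ r) r) ≠ 0 →
      Finsupp.weight pairWeight e < Finsupp.weight pairWeight (indicatorExponent A) := by
    intro τ hτ1 e he
    have h0 : ∀ r, M (τ r) r ≠ 0 := by
      intro r hr
      have h1 : ∏ r, M (τ r) r = 0 := Finset.prod_eq_zero (Finset.mem_univ r) hr
      rw [h1, coeff_zero] at he
      exact he rfl
    choose g hg1 hg2 hg3 using fun r => (hentry (τ r) r).resolve_left (h0 r)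
    rw [Finset.prod_congr rfl fun r _ => hg1 r, ← monomial_sum_one, coeff_monomial] at he
    obtain rfl : ∑ r, g r = e := of_not_not fun h' => he (if_neg h')
    rw [map_sum, Finset.sum_congr rfl fun r _ => hg2 r, ← Finset.sum_filter, hwt]
    have hsub : ∀ r, τ r ≠ r → r ∈ T := fun r hr => of_not_not fun h' => hr (hg3 r h')
    have hmv : MonovaryOn (fun r : Fin i => (r : ℕ)) S
        ((Finset.univ.filter fun r => r ∈ T : Finset (Fin i)) : Set (Fin i)) := by
      intro r hr r' hr' hlt
      by_contra hgt
      have h5 : r' < r := Fin.lt_def.2 (not_le.1 hgt)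
      exact absurd (hSmono r' (Finset.mem_filter.1 hr').2 r (Finset.mem_filter.1 hr).2 h5)
        (not_lt.2 hlt.le)
    refine (hmv.sum_comp_perm_mul_lt_sum_mul_iff (σ := τ) fun r hr =>
      Finset.mem_coe.2 (Finset.mem_filter.2 ⟨Finset.mem_univ _, hsub r hr⟩)).2 fun hmono => ?_
    refine hτ1 (perm_eq_one_of_monovaryOn S hSmono τ hsub ?_)
    intro r hr r' hr' hlt
    exact hmono (Finset.mem_coe.2 (Finset.mem_filter.2 ⟨Finset.mem_univ _, hr⟩))
      (Finset.mem_coe.2 (Finset.mem_filter.2 ⟨Finset.mem_univ _, hr'⟩)) hlt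
  have hcoeff : ∀ e, coeff e M.det = ∑ τ : Equiv.Perm (Fin i),
      ((Equiv.Perm.sign τ : ℤ) : ℂ) * coeff e (∏ r, M (τ r) r) := by
    intro e
    rw [Matrix.det_apply, coeff_sum]
    refine Finset.sum_congr rfl fun τ _ => ?_
    rw [Units.smul_def, ← Int.cast_smul_eq_zsmul ℂ, coeff_smul, smul_eq_mul]
  constructor
  · rw [hcoeff, Finset.sum_eq_single 1]
    · simp [hdiag]
    · intro τ _ hτ
      by_cases h0 : coeff (indicatorExponent A) (∏ r, M (τ r) r) = 0
      · rw [h0, mul_zero]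
      · exact absurd (hother τ hτ _ h0) (lt_irrefl _)
    · simp
  · intro e he
    rw [hcoeff] at he
    obtain ⟨τ, _, hτ⟩ := Finset.exists_ne_zero_of_sum_ne_zero he
    have h0 := right_ne_zero_of_mul hτ
    by_cases hτ1 : τ = 1
    · left
      subst hτ1
      simp only [Equiv.Perm.one_apply] at h0
      rw [hdiag, coeff_monomial] at h0
      exact (of_not_not fun h' => h0 (if_neg h')).symm
    · exact Or.inr (hother τ hτ1 e h0)

variable {V : Type*} [AddCommGroup V] [Module ℂ V] {ρ : SL n →ₗ⁅ℂ⁆ Module.End ℂ V} {v : V}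

/-- The vectors `f^s v`, where `s` is a sum of indicator functions of `m` diagonal sets, are
linearly independent: there is a functional which is nonzero on `f^s v` and which vanishes on
`f^t v`, `t ≠ s`, unless the weight of `t` is smaller than the one of `s`. -/
theorem IsHighestWeightRep.linearIndependent (hv : IsHighestWeightRep i m ρ v) (h : i ≤ n + 1)
    (hw : IsBlock i w) {y : (RootsNeg w →₀ ℕ) → V} (hy0 : y 0 = v)
    (hy : ∀ α s, y (s + Finsupp.single α 1) = ρ (unit α.1.2 α.1.1 α.2.1.ne') (y s))
    (Λ : Set (RootsNeg w →₀ ℕ))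
    (hΛ : ∀ s ∈ Λ, ∃ A : Fin m → Finset (RootsNeg w), (∀ j, IsDiagonalSet (A j)) ∧
      s = ∑ j, indicatorExponent (A j)) :
    LinearIndependent ℂ fun s : Λ => y s := by
  classical
  obtain ⟨φ, -, hφv, hφρ⟩ := hv.exists_embedding h
  rw [linearIndependent_iff']
  intro T c hc s₀ hs₀
  by_contra hne
  obtain ⟨s, hs, hmin⟩ := Finset.exists_min_image (T.filter fun s : Λ => c s ≠ 0)
    (fun s => Finsupp.weight pairWeight (s : RootsNeg w →₀ ℕ))
    ⟨s₀, Finset.mem_filter.2 ⟨hs₀, hne⟩⟩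
  obtain ⟨hsT, hcs⟩ := Finset.mem_filter.1 hs
  obtain ⟨A, hA, hsA⟩ := hΛ s s.2
  set S : Fin m × Fin i → Fin (n + 1) := fun p => selection h (A p.1) p.2 with hS
  set θ := expEval w S with hθ
  have hlead : IsLeadingExponent pairWeight (θ (refVector m h)) s := by
    rw [refVector, map_prod, hsA]
    refine IsLeadingExponent.prod Finset.univ fun j => ?_
    rw [AlgHom.map_det]
    refine isLeadingExponent_det hw h (hA j) fun a r => ?_
    change θ (X ((j, r), Fin.castLE h a)) = _
    rw [hθ, expEval, aeval_X]
  have horb : ∀ α t, θ (φ (y (t + Finsupp.single α 1))) = pderiv α (θ (φ (y t))) := by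
    intro α t
    rw [hy, hφρ, hθ, expEval_glDer hw]
  have hcoeff : ∀ t, coeff 0 (θ (φ (y t))) =
      (∏ q, ((t q).factorial : ℂ)) * coeff t (θ (refVector m h)) := by
    intro t
    have h1 := factorial_mul_coeff_pderiv_orbit (y := fun t => θ (φ (y t))) horb t 0
    rw [hy0, hφv, zero_add] at h1
    simpa using h1
  have hzero := congrArg (fun x => coeff 0 (θ (φ x))) hc
  simp only [map_sum, map_smul, map_zero, coeff_sum, coeff_smul, coeff_zero, hcoeff] at hzero
  rw [Finset.sum_eq_single_of_mem s hsT] at hzero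
  · refine mul_ne_zero hcs (mul_ne_zero ?_ hlead.1) hzero
    exact Finset.prod_ne_zero_iff.2 fun q _ => Nat.cast_ne_zero.2 (Nat.factorial_ne_zero _)
  · intro t ht hts
    by_contra h0
    have hct : c t ≠ 0 := left_ne_zero_of_mul h0
    rcases hlead.2 t (right_ne_zero_of_mul (right_ne_zero_of_mul h0)) with h1 | h1
    · exact hts (Subtype.ext h1)
    · exact absurd h1 (not_lt.2 (hmin t (Finset.mem_filter.2 ⟨ht, hct⟩)))

end Leading

/-! ### Minimal coset representatives -/

section Minimal

variable {n i : ℕ} {w : Weyl n}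

/-- The exchange condition: a word whose product reverses `j` and `j + 1` can be shortened by one
letter after multiplication with the corresponding simple reflection. -/
theorem exists_shorter_word (j : Fin n) (l : List (Fin n))
    (h : (l.map simpleRefl).prod j.succ < (l.map simpleRefl).prod j.castSucc) :
    ∃ l' : List (Fin n), l'.length + 1 = l.length ∧
      (l'.map simpleRefl).prod = (l.map simpleRefl).prod * simpleRefl j := by
  induction l with
  | nil =>
    exfalso
    simp only [List.map_nil, List.prod_nil, Equiv.Perm.one_apply] at h
    exact absurd h (not_lt.2 (Fin.castSucc_lt_succ).le)
  | cons k l ih =>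
    set u := (l.map simpleRefl).prod with hu
    rw [List.map_cons, List.prod_cons, ← hu] at h
    rcases lt_trichotomy (u j.succ) (u j.castSucc) with h1 | h1 | h1
    · obtain ⟨l', h2, h3⟩ := ih h1
      exact ⟨k :: l', by simp [h2], by
        rw [List.map_cons, List.prod_cons, h3, List.map_cons, List.prod_cons, mul_assoc]⟩
    · exact absurd (u.injective h1) (Fin.castSucc_lt_succ).ne'
    · -- the simple reflection `k` reverses the order, so it exchanges the two values
      have h2 : u j.castSucc = k.castSucc ∧ u j.succ = k.succ := by
        simp only [Equiv.Perm.mul_apply, simpleRefl, Equiv.swap_apply_def] at h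
        simp only [Fin.ext_iff, Fin.lt_def, Fin.val_castSucc, Fin.val_succ] at *
        split_ifs at h <;> simp_all <;> omega
      refine ⟨l, rfl, ?_⟩
      rw [List.map_cons, List.prod_cons, ← hu]
      have h3 : simpleRefl k * u = u * simpleRefl j := by
        rw [simpleRefl, simpleRefl, ← h2.1, ← h2.2, Equiv.mul_swap_eq_swap_mul]
      rw [h3, mul_assoc, simpleRefl, Equiv.swap_mul_self, mul_one]

theorem exists_word (w : Weyl n) : ∃ l : List (Fin n), (l.map simpleRefl).prod = w := by
  have h : w ∈ Submonoid.closure (Set.range fun j : Fin n => Equiv.swap j.castSucc j.succ) := by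
    rw [Equiv.Perm.mclosure_swap_castSucc_succ]
    trivial
  obtain ⟨l, hl, hw⟩ := Submonoid.exists_list_of_mem_closure h
  have hl' : ∀ x ∈ l, ∃ j : Fin n, simpleRefl j = x := hl
  clear hl h
  induction l generalizing w with
  | nil => exact ⟨[], hw⟩
  | cons x l ih =>
    obtain ⟨l', h1⟩ := ih l.prod rfl fun y hy => hl' y (List.mem_cons_of_mem _ hy)
    obtain ⟨j, hj⟩ := hl' x List.mem_cons_self
    exact ⟨j :: l', by rw [List.map_cons, List.prod_cons, h1, hj, ← List.prod_cons, hw]⟩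

theorem length_mul_simpleRefl_lt (j : Fin n) (h : w j.succ < w j.castSucc) :
    length (w * simpleRefl j) < length w := by
  have hne : {r | ∃ l : List (Fin n), l.length = r ∧ (l.map simpleRefl).prod = w}.Nonempty := by
    obtain ⟨l, hl⟩ := exists_word w
    exact ⟨_, l, rfl, hl⟩
  obtain ⟨l, hl, hlw⟩ := Nat.sInf_mem hne
  rw [← hlw] at h
  obtain ⟨l', h1, h2⟩ := exists_shorter_word j l h
  have h3 : length (w * simpleRefl j) ≤ l'.length := Nat.sInf_le ⟨l', rfl, by rw [h2, hlw]⟩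
  have h4 : l.length = length w := hl
  omega

theorem IsMinimalRep.lt_succ (hw : IsMinimalRep i w) (j : Fin n) (hj : (j : ℕ) + 1 ≠ i) :
    w j.castSucc < w j.succ := by
  rcases lt_trichotomy (w j.castSucc) (w j.succ) with h | h | h
  · exact h
  · exact absurd (w.injective h) (Fin.castSucc_lt_succ).ne
  · exfalso
    refine absurd (length_mul_simpleRefl_lt j h) (not_lt.2 (hw _ ?_))
    funext a
    simp only [actWeight, fundWeight, simpleRefl, Equiv.swap_inv, Equiv.swap_apply_def]
    congr 1
    split_ifs with h1 h2
    · subst h1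
      simp only [Fin.val_succ, Fin.val_castSucc, eq_iff_iff]
      omega
    · subst h2
      simp only [Fin.val_succ, Fin.val_castSucc, eq_iff_iff]
      omega
    · rfl

/-- A minimal representative is increasing on the first `i` and on the last indices. -/
theorem IsMinimalRep.lt_of_lt (hw : IsMinimalRep i w) {a b : Fin (n + 1)} (hab : a < b)
    (h : (b : ℕ) < i ∨ i ≤ (a : ℕ)) : w a < w b := by
  have key : ∀ (k : ℕ) (a b : Fin (n + 1)), (b : ℕ) = a + k + 1 →
      ((b : ℕ) < i ∨ i ≤ (a : ℕ)) → w a < w b := by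
    intro k
    induction k with
    | zero =>
      intro a b hab h
      have h1 := hw.lt_succ ⟨a, by omega⟩ (by dsimp only; omega)
      have h2 : (⟨a, by omega⟩ : Fin n).succ = b := Fin.ext (by simp [hab])
      rw [h2] at h1
      exact h1
    | succ k ih =>
      intro a b hab h
      have h0 := b.2
      refine (ih a ⟨a + k + 1, by omega⟩ rfl (by dsimp only; omega)).trans ?_
      have h1 := hw.lt_succ ⟨a + k + 1, by omega⟩ (by dsimp only; omega)
      have h2 : (⟨a + k + 1, by omega⟩ : Fin n).succ = b := Fin.ext (by simp [hab]; omega)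
      rw [h2] at h1
      exact h1
  have h' : (a : ℕ) < b := hab
  exact key (b - a - 1) a b (by omega) h

theorem IsMinimalRep.isBlock (hw : IsMinimalRep i w) : IsBlock i w := by
  intro α
  have h1 : (α.1.1 : ℕ) < α.1.2 := α.2.1
  have h2 : ¬ ((α.1.2 : ℕ) < i ∨ i ≤ (α.1.1 : ℕ)) := fun h =>
    absurd (hw.lt_of_lt α.2.1 h) (not_lt.2 α.2.2.le)
  omega

/-- `R⁻_w` is an order ideal in the rectangle of all pairs `(a, b)` with `a ≤ i < b`. -/
theorem IsMinimalRep.mem_of_le (hw : IsMinimalRep i w) (α : RootsNeg w) {a b : Fin (n + 1)}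
    (ha : α.1.1 ≤ a) (hai : (a : ℕ) < i) (hib : i ≤ (b : ℕ)) (hb : b ≤ α.1.2) :
    a < b ∧ w b < w a := by
  have h1 := hw.isBlock α
  refine ⟨Fin.lt_def.2 (lt_of_lt_of_le hai hib), ?_⟩
  have h2 : w b ≤ w α.1.2 := by
    rcases hb.lt_or_eq with h | h
    · exact (hw.lt_of_lt h (Or.inr hib)).le
    · rw [h]
  have h3 : w α.1.1 ≤ w a := by
    rcases ha.lt_or_eq with h | h
    · exact (hw.lt_of_lt h (Or.inl hai)).le
    · rw [h]
  exact (h2.trans_lt α.2.2).trans_le h3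

end Minimal

/-! ### Lattice points of chain polytopes -/

section Chains

variable {n i m : ℕ} {w : Weyl n}

/-- The order of the poset `P_ℓ`, transported to `R⁻_w`. -/
def RootLE (α β : RootsNeg w) : Prop := β.1.1 ≤ α.1.1 ∧ α.1.2 ≤ β.1.2

/-- A finite set of pairwise comparable roots. -/
def IsRootChain (c : Finset (RootsNeg w)) : Prop :=
  ∀ α ∈ c, ∀ β ∈ c, RootLE α β ∨ RootLE β α

/-- The exponents whose sum over each chain is at most `m`. -/
def admissible (w : Weyl n) (m : ℕ) : Set (RootsNeg w →₀ ℕ) :=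
  {s | ∀ c, IsRootChain c → ∑ α ∈ c, s α ≤ m}

theorem RootLE.refl (α : RootsNeg w) : RootLE α α := ⟨le_rfl, le_rfl⟩

theorem RootLE.trans {α β γ : RootsNeg w} (h : RootLE α β) (h' : RootLE β γ) : RootLE α γ :=
  ⟨h'.1.trans h.1, h.2.trans h'.2⟩

/-- The height `b - a` of the root `(a, b)`. -/
def rootHeight (α : RootsNeg w) : ℤ := (α.1.2 : ℕ) - (α.1.1 : ℕ)

theorem RootLE.eq_of_height_le {α β : RootsNeg w} (h : RootLE α β)
    (h' : rootHeight β ≤ rootHeight α) : α = β := by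
  have h1 : (β.1.1 : ℕ) ≤ α.1.1 := h.1
  have h2 : (α.1.2 : ℕ) ≤ β.1.2 := h.2
  unfold rootHeight at h'
  exact Subtype.ext (Prod.ext (Fin.ext (by omega)) (Fin.ext (by omega)))

theorem IsRootChain.exists_max {c : Finset (RootsNeg w)} (hc : IsRootChain c) (hne : c.Nonempty) :
    ∃ x ∈ c, ∀ y ∈ c, RootLE y x := by
  obtain ⟨x, hx, hmax⟩ := Finset.exists_max_image c rootHeight hne
  refine ⟨x, hx, fun y hy => ?_⟩
  rcases hc y hy x hx with h | h
  · exact h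
  · rw [h.eq_of_height_le (hmax y hy)]
    exact RootLE.refl y

theorem indicatorExponent_apply (A : Finset (RootsNeg w)) (α : RootsNeg w) :
    indicatorExponent A α = if α ∈ A then 1 else 0 := by
  classical
  rw [indicatorExponent, Finsupp.finsetSum_apply]
  simp [Finsupp.single_apply]

/-- A lattice point of the `m`-fold dilated chain polytope is a sum of `m` indicator functions of
antichains: remove the maximal elements of the support repeatedly. -/
theorem exists_sum_indicatorExponent (s : RootsNeg w →₀ ℕ) (hs : s ∈ admissible w m) :
    ∃ A : Fin m → Finset (RootsNeg w), (∀ j, IsDiagonalSet (A j)) ∧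
      s = ∑ j, indicatorExponent (A j) := by
  classical
  induction m generalizing s with
  | zero =>
    refine ⟨fun _ => ∅, fun j => j.elim0, ?_⟩
    ext α
    have h := hs {α} fun β hβ γ hγ => by
      rw [Finset.mem_singleton] at hβ hγ
      rw [hβ, hγ]
      exact Or.inl (RootLE.refl α)
    simpa using h
  | succ m ih =>
    set A : Finset (RootsNeg w) :=
      s.support.filter fun α => ∀ β ∈ s.support, RootLE α β → β = α with hA
    have hAdiag : IsDiagonalSet A := by
      intro α hα β hβ hne
      obtain ⟨hα1, hα2⟩ := Finset.mem_filter.1 hα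
      obtain ⟨hβ1, hβ2⟩ := Finset.mem_filter.1 hβ
      have h1 : ¬ RootLE α β := fun h => hne (hα2 β hβ1 h).symm
      have h2 : ¬ RootLE β α := fun h => hne (hβ2 α hα1 h)
      unfold RootLE at h1 h2
      simp only [Fin.le_def, Fin.lt_def] at *
      omega
    have hAs : indicatorExponent A ≤ s := by
      intro α
      rw [indicatorExponent_apply]
      split_ifs with h
      · exact Nat.one_le_iff_ne_zero.2 (Finsupp.mem_support_iff.1 (Finset.mem_filter.1 h).1)
      · exact Nat.zero_le _
    set s' := s - indicatorExponent A with hs'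
    have hsum : s = indicatorExponent A + s' := (add_tsub_cancel_of_le hAs).symm
    have hadm : s' ∈ admissible w m := by
      intro c hc
      rw [← Finset.sum_filter_ne_zero]
      set c' := c.filter fun α => s' α ≠ 0 with hc'
      rcases c'.eq_empty_or_nonempty with h0 | hne
      · rw [h0, Finset.sum_empty]; exact Nat.zero_le _
      have hcc : IsRootChain c' := fun α hα β hβ =>
        hc α (Finset.mem_filter.1 hα).1 β (Finset.mem_filter.1 hβ).1
      obtain ⟨x, hx, hmax⟩ := hcc.exists_max hne
      have hxs : x ∈ s.support := by
        rw [Finsupp.mem_support_iff, hsum, Finsupp.add_apply]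
        have := (Finset.mem_filter.1 hx).2
        omega
      -- a maximal element of the support above the chain
      obtain ⟨y, hyA, hxy⟩ : ∃ y ∈ A, RootLE x y := by
        obtain ⟨y, hy, hymax⟩ := Finset.exists_max_image (s.support.filter fun y => RootLE x y)
          rootHeight ⟨x, Finset.mem_filter.2 ⟨hxs, RootLE.refl x⟩⟩
        obtain ⟨hy1, hy2⟩ := Finset.mem_filter.1 hy
        refine ⟨y, Finset.mem_filter.2 ⟨hy1, fun z hz hyz => ?_⟩, hy2⟩
        exact (hyz.eq_of_height_le (hymax z (Finset.mem_filter.2 ⟨hz, hy2.trans hyz⟩))).symm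
      have hchain : IsRootChain (insert y c') := by
        intro α hα β hβ
        rcases Finset.mem_insert.1 hα with rfl | hα' <;>
          rcases Finset.mem_insert.1 hβ with rfl | hβ'
        · exact Or.inl (RootLE.refl _)
        · exact Or.inr ((hmax β hβ').trans hxy)
        · exact Or.inl ((hmax α hα').trans hxy)
        · exact hcc α hα' β hβ'
      have h1 := hs _ hchain
      have h2 : ∑ α ∈ insert y c', s α =
          ∑ α ∈ insert y c', indicatorExponent A α + ∑ α ∈ insert y c', s' α := by
        rw [← Finset.sum_add_distrib]
        exact Finset.sum_congr rfl fun α _ => by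
          conv_lhs => rw [hsum]
          rw [Finsupp.add_apply]
      have h3 : 1 ≤ ∑ α ∈ insert y c', indicatorExponent A α := by
        refine le_trans ?_ (Finset.single_le_sum (f := fun α => indicatorExponent A α)
          (fun _ _ => Nat.zero_le _) (Finset.mem_insert_self y c'))
        rw [indicatorExponent_apply, if_pos hyA]
      have h4 : ∑ α ∈ c', s' α ≤ ∑ α ∈ insert y c', s' α :=
        Finset.sum_le_sum_of_subset (Finset.subset_insert y c')
      omega
    obtain ⟨B, hB, hsB⟩ := ih s' hadm
    refine ⟨Fin.cons A B, Fin.cases hAdiag hB, ?_⟩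
    rw [Fin.sum_univ_succ]
    simp only [Fin.cons_zero, Fin.cons_succ]
    rw [← hsB]
    exact hsum

theorem mem_smul_chainPolytope_iff {P : Type*} [PartialOrder P] (s : P → ℕ) :
    (fun x => (s x : ℝ)) ∈ (m : ℝ) • chainPolytope P ↔
      ∀ c : Finset P, IsChain (· ≤ ·) (c : Set P) → ∑ x ∈ c, s x ≤ m := by
  classical
  constructor
  · rintro ⟨x, hx, hxs⟩ c hc
    have h1 : ∀ p, (s p : ℝ) = m * x p := fun p => (congrFun hxs p).symm
    have h2 : ((∑ p ∈ c, s p : ℕ) : ℝ) ≤ m := by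
      push_cast
      rw [Finset.sum_congr rfl fun p _ => h1 p, ← Finset.mul_sum]
      exact mul_le_of_le_one_right (Nat.cast_nonneg m) (hx.2 c hc)
    exact_mod_cast h2
  · intro h
    rcases Nat.eq_zero_or_pos m with rfl | hm
    · refine ⟨fun _ => 0, ⟨fun _ => le_rfl, fun c _ => by simp⟩, ?_⟩
      funext p
      have h1 := h {p} (by simp)
      have h2 : s p = 0 := by simpa using h1
      simp [h2]
    · have hm' : (0 : ℝ) < m := Nat.cast_pos.2 hm
      refine ⟨fun p => s p / m, ⟨fun p => by positivity, fun c hc => ?_⟩, ?_⟩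
      · rw [← Finset.sum_div, div_le_one hm']
        exact_mod_cast h c hc
      · funext p
        change (m : ℝ) * (s p / m) = s p
        field_simp

/-- The identification of `R⁻_w` with the poset `P_ℓ`. -/
def rootEquiv (hw : IsMinimalRep i w) : RootsNeg w ≃ PosetL i (ellSeq i w) :=
  Equiv.ofBijective (fun α => ⟨(OrderDual.toDual ((α.1.1 : ℕ) + 1), (α.1.2 : ℕ)), by
    classical
    have h := hw.isBlock α
    refine ⟨Nat.succ_pos _, h.1, h.2, ?_⟩
    refine le_trans ?_ (le_max_right _ _)
    exact Finset.le_sup (f := fun α : RootsNeg w => (α.1.2 : ℕ))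
      (Finset.mem_filter.2 ⟨Finset.mem_univ α, rfl, h.2⟩)⟩) (by
    classical
    constructor
    · intro α β h
      have h1 := congrArg Prod.fst (congrArg Subtype.val h)
      have h2 := congrArg Prod.snd (congrArg Subtype.val h)
      have h3 : (α.1.1 : ℕ) + 1 = β.1.1 + 1 := h1
      have h4 : (α.1.2 : ℕ) = β.1.2 := h2
      exact Subtype.ext (Prod.ext (Fin.ext (by omega)) (Fin.ext h4))
    · rintro ⟨⟨k, j⟩, hk1, hki, hij, hj⟩
      set k' : ℕ := OrderDual.ofDual k with hk'
      change j ≤ ellSeq i w k' at hj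
      change 1 ≤ k' at hk1
      change k' ≤ i at hki
      change i ≤ j at hij
      -- the maximum defining `ℓ_k` is attained at a root of `R⁻_w`
      set F := Finset.univ.filter fun α : RootsNeg w => (α.1.1 : ℕ) + 1 = k' ∧ i ≤ (α.1.2 : ℕ)
        with hF
      have h1 : j ≤ F.sup fun α => (α.1.2 : ℕ) := by
        have h2 : j ≤ max (i - 1) (F.sup fun α => (α.1.2 : ℕ)) := by
          rw [hF]
          unfold ellSeq at hj
          convert hj
        rcases le_max_iff.1 h2 with h3 | h3
        · omega
        · exact h3
      have hne : F.Nonempty := by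
        by_contra h0
        rw [Finset.not_nonempty_iff_eq_empty.1 h0, Finset.sup_empty, bot_eq_zero] at h1
        omega
      obtain ⟨α, hα, hsup⟩ := Finset.exists_mem_eq_sup F hne fun α => (α.1.2 : ℕ)
      rw [hsup] at h1
      obtain ⟨-, hαk, hαi⟩ := Finset.mem_filter.1 hα
      have hjn : j < n + 1 := lt_of_le_of_lt h1 α.1.2.2
      have h3 := hw.mem_of_le α (a := α.1.1) (b := ⟨j, hjn⟩) le_rfl (hw.isBlock α).1 hij h1
      refine ⟨⟨(α.1.1, ⟨j, hjn⟩), h3⟩, Subtype.ext (Prod.ext ?_ rfl)⟩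
      exact congrArg OrderDual.toDual hαk)

theorem coordinate_eq (hw : IsMinimalRep i w) (s : PosetL i (ellSeq i w) → ℕ) (α : RootsNeg w) :
    coordinate i w s α = s (rootEquiv hw α) :=
  dif_pos (rootEquiv hw α).2

theorem rootEquiv_le_iff (hw : IsMinimalRep i w) (α β : RootsNeg w) :
    rootEquiv hw α ≤ rootEquiv hw β ↔ RootLE α β := by
  change ((β.1.1 : ℕ) + 1 ≤ (α.1.1 : ℕ) + 1 ∧ (α.1.2 : ℕ) ≤ (β.1.2 : ℕ)) ↔
    ((β.1.1 : ℕ) ≤ α.1.1 ∧ (α.1.2 : ℕ) ≤ β.1.2)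
  rw [Nat.add_le_add_iff_right]

/-- The lattice points of the dilated chain polytope are the admissible exponents. -/
def latticePointsEquiv (hw : IsMinimalRep i w) (m : ℕ) :
    LatticePoints i m w ≃ admissible w m :=
  (((rootEquiv hw).arrowCongr (Equiv.refl ℕ)).symm.trans
    Finsupp.equivFunOnFinite.symm).subtypeEquiv fun s => by
      classical
      rw [mem_smul_chainPolytope_iff]
      constructor
      · intro h c hc
        have h1 := h (c.map (rootEquiv hw).toEmbedding) (by
          intro x hx y hy _
          obtain ⟨α, hα, rfl⟩ := Finset.mem_map.1 (Finset.mem_coe.1 hx)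
          obtain ⟨β, hβ, rfl⟩ := Finset.mem_map.1 (Finset.mem_coe.1 hy)
          rcases hc α hα β hβ with h2 | h2
          · exact Or.inl ((rootEquiv_le_iff hw α β).2 h2)
          · exact Or.inr ((rootEquiv_le_iff hw β α).2 h2))
        rwa [Finset.sum_map] at h1
      · intro h c hc
        have h1 := h (c.map (rootEquiv hw).symm.toEmbedding) (by
          intro α hα β hβ
          obtain ⟨x, hx, rfl⟩ := Finset.mem_map.1 hα
          obtain ⟨y, hy, rfl⟩ := Finset.mem_map.1 hβ
          rw [← rootEquiv_le_iff hw, ← rootEquiv_le_iff hw]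
          simp only [Equiv.coe_toEmbedding, Equiv.apply_symm_apply]
          rcases eq_or_ne x y with rfl | hxy
          · exact Or.inl le_rfl
          · exact hc hx hy hxy)
        rw [Finset.sum_map] at h1
        refine le_trans (le_of_eq (Finset.sum_congr rfl fun x _ => ?_)) h1
        change s x = s (rootEquiv hw ((rootEquiv hw).symm x))
        rw [Equiv.apply_symm_apply]

theorem latticePointsEquiv_apply (hw : IsMinimalRep i w) (s : LatticePoints i m w)
    (α : RootsNeg w) : (latticePointsEquiv hw m s).1 α = coordinate i w s.1 α :=
  (coordinate_eq hw s.1 α).symm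

end Chains

/-! ### Permanents and polarization -/

section Permanents

variable {A κ κ' : Type*} [CommRing A] {d : ℕ}

/-- The permanent of the matrix with entries `g (a k) (b l)`. -/
def permSum (g : κ → κ' → A) (a : Fin d → κ) (b : Fin d → κ') : A :=
  ∑ τ : Equiv.Perm (Fin d), ∏ k, g (a k) (b (τ k))

theorem permSum_comp_left (g : κ → κ' → A) (a : Fin d → κ) (b : Fin d → κ')
    (π : Equiv.Perm (Fin d)) : permSum g (a ∘ π) b = permSum g a b := by
  unfold permSum
  rw [← Equiv.sum_comp (Equiv.mulRight π)]
  refine Finset.sum_congr rfl fun τ _ => ?_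
  rw [← Equiv.prod_comp π fun k => g (a k) (b (τ k))]
  rfl

theorem permSum_swap (g : κ → κ' → A) (a : Fin d → κ) (b : Fin d → κ') :
    permSum (fun y x => g x y) b a = permSum g a b := by
  unfold permSum
  rw [← Equiv.sum_comp (Equiv.inv (Equiv.Perm (Fin d)))]
  refine Finset.sum_congr rfl fun τ _ => ?_
  rw [← Equiv.prod_comp τ]
  simp

theorem permSum_const (g : κ → κ' → A) (x : κ) (y : κ') :
    permSum g (fun _ : Fin d => x) (fun _ => y) = (d.factorial : A) * g x y ^ d := by
  simp [permSum, Finset.card_univ, Fintype.card_perm]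

variable [Algebra ℂ A]

/-- A derivation replacing `x₀` by `x` in the first argument of `g` acts on permanents by replacing
one occurrence of `x₀` at a time. -/
theorem derivation_permSum [DecidableEq κ] (g : κ → κ' → A) (D : Derivation ℂ A A) (c : ℂ)
    (x₀ x : κ) (a : Fin d → κ) (b : Fin d → κ')
    (hD : ∀ k l, D (g (a k) (b l)) = if a k = x₀ then c • g x (b l) else 0) :
    D (permSum g a b) = c • ∑ k, if a k = x₀ then permSum g (Function.update a k x) b else 0 := by
  unfold permSum
  rw [map_sum, Finset.sum_congr rfl fun τ _ => derivation_prod D _, Finset.sum_comm,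
    Finset.smul_sum]
  refine Finset.sum_congr rfl fun k _ => ?_
  by_cases hk : a k = x₀
  · rw [if_pos hk, Finset.smul_sum]
    refine Finset.sum_congr rfl fun τ _ => ?_
    rw [hD, if_pos hk, Finset.prod_update_of_mem (Finset.mem_univ k), smul_mul_assoc]
    congr 1
    rw [← Finset.mul_prod_erase Finset.univ _ (Finset.mem_univ k), Function.update_self,
      Finset.sdiff_singleton_eq_erase]
    congr 1
    refine Finset.prod_congr rfl fun l hl => ?_
    rw [Function.update_of_ne (Finset.ne_of_mem_erase hl)]
  · rw [if_neg hk, smul_zero]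
    refine Finset.sum_eq_zero fun τ _ => ?_
    rw [hD, if_neg hk, Finset.prod_update_of_mem (Finset.mem_univ k), zero_mul]

/-- Polarization: a subspace containing the permanent with constant row `x₀`, and stable under
derivations replacing `x₀` by the elements `x` with `good x`, contains all permanents with such
rows. -/
theorem permSum_mem_of_polarization [DecidableEq κ] (g : κ → κ' → A) (T : Submodule ℂ A) (x₀ : κ)
    (good : κ → Prop) (b : Fin d → κ') (c : ℂ) (hc : c ≠ 0)
    (hD : ∀ x, good x → x ≠ x₀ → ∃ D : Derivation ℂ A A, (∀ p ∈ T, D p ∈ T) ∧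
      ∀ y, good y → ∀ l, D (g y (b l)) = if y = x₀ then c • g x (b l) else 0)
    (hx₀ : good x₀) (h0 : permSum g (fun _ => x₀) b ∈ T) (a : Fin d → κ)
    (ha : ∀ k, good (a k)) : permSum g a b ∈ T := by
  induction hN : (Finset.univ.filter fun k => a k ≠ x₀).card generalizing a with
  | zero =>
    have h1 : a = fun _ => x₀ := by
      funext k
      by_contra hk
      have h2 := Finset.card_eq_zero.1 hN
      exact absurd (Finset.mem_filter.2 ⟨Finset.mem_univ k, hk⟩) (h2 ▸ Finset.notMem_empty k)
    rw [h1]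
    exact h0
  | succ N ih =>
    obtain ⟨k₀, hk₀⟩ : (Finset.univ.filter fun k => a k ≠ x₀).Nonempty := by
      rw [← Finset.card_pos]; omega
    have hk₀' := (Finset.mem_filter.1 hk₀).2
    set a' := Function.update a k₀ x₀ with ha'
    have hgood : ∀ k, good (a' k) := by
      intro k
      rcases eq_or_ne k k₀ with rfl | hk
      · rw [ha', Function.update_self]; exact hx₀
      · rw [ha', Function.update_of_ne hk]; exact ha k
    have hmem : permSum g a' b ∈ T := by
      refine ih a' hgood ?_
      have h1 : (Finset.univ.filter fun k => a' k ≠ x₀) =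
          (Finset.univ.filter fun k => a k ≠ x₀).erase k₀ := by
        ext k
        rcases eq_or_ne k k₀ with rfl | hk
        · simp [ha']
        · simp [ha', hk]
      rw [h1, Finset.card_erase_of_mem hk₀, hN]
      rfl
    obtain ⟨D, hDT, hDg⟩ := hD (a k₀) (ha k₀) hk₀'
    have h1 := derivation_permSum g D c x₀ (a k₀) a' b fun k l => hDg _ (hgood k) l
    have h2 : ∀ k, a' k = x₀ → permSum g (Function.update a' k (a k₀)) b = permSum g a b := by
      intro k hk
      rw [← permSum_comp_left g a b (Equiv.swap k₀ k)]
      congr 1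
      funext l
      simp only [Function.comp_apply, Function.update_apply, ha', Equiv.swap_apply_def] at hk ⊢
      by_cases h3 : l = k <;> by_cases h4 : l = k₀ <;> by_cases h5 : k = k₀ <;> simp_all
    have h3 : D (permSum g a' b) =
        (c * ((Finset.univ.filter fun k => a' k = x₀).card : ℂ)) • permSum g a b := by
      rw [h1, ← Finset.sum_filter, Finset.sum_congr rfl fun k hk => h2 k (Finset.mem_filter.1 hk).2,
        Finset.sum_const, mul_smul, Nat.cast_smul_eq_nsmul]
    have h4 : c * ((Finset.univ.filter fun k => a' k = x₀).card : ℂ) ≠ 0 := by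
      refine mul_ne_zero hc (Nat.cast_ne_zero.2 (Finset.card_ne_zero.2 ⟨k₀, ?_⟩))
      simp [ha']
    have h5 := hDT _ hmem
    rw [h3] at h5
    exact (Submodule.smul_mem_iff T h4).1 h5

end Permanents

/-! ### Orbits under enveloping algebras -/

section EnvOrbit

variable {k L G : Type*} [CommRing k] [LieRing L] [LieAlgebra k L] [AddCommGroup G] [Module k G]
  (φ : L →ₗ⁅k⁆ Module.End k G)

/-- The `U(L)`-submodule generated by `q`. -/
def envOrbit (q : G) : Submodule k G where
  carrier := {p | ∃ u, p = UniversalEnvelopingAlgebra.lift k φ u q}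
  zero_mem' := ⟨0, by rw [map_zero]; rfl⟩
  add_mem' := by
    rintro _ _ ⟨u, rfl⟩ ⟨u', rfl⟩
    exact ⟨u + u', by rw [map_add]; rfl⟩
  smul_mem' := by
    rintro c _ ⟨u, rfl⟩
    exact ⟨c • u, by rw [map_smul]; rfl⟩

theorem mem_envOrbit_self (q : G) : q ∈ envOrbit φ q := ⟨1, by rw [map_one]; rfl⟩

theorem apply_mem_envOrbit (e : L) {p q : G} (hp : p ∈ envOrbit φ q) : φ e p ∈ envOrbit φ q := by
  obtain ⟨u, rfl⟩ := hp
  exact ⟨UniversalEnvelopingAlgebra.ι k e * u, by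
    rw [map_mul, UniversalEnvelopingAlgebra.lift_ι_apply]; rfl⟩

/-- A subspace stable under `L` is stable under `U(L)`. -/
theorem lift_apply_mem_of_stable {J : Submodule k G} (hJ : ∀ e, ∀ p ∈ J, φ e p ∈ J)
    (u : UniversalEnvelopingAlgebra k L) {p : G} (hp : p ∈ J) :
    UniversalEnvelopingAlgebra.lift k φ u p ∈ J := by
  let S : Subalgebra k (Module.End k G) :=
    { carrier := {f | ∀ p ∈ J, f p ∈ J}
      mul_mem' := fun {f g} hf hg p hp => hf _ (hg p hp)
      add_mem' := fun {f g} hf hg p hp => J.add_mem (hf p hp) (hg p hp)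
      algebraMap_mem' := fun c p hp => J.smul_mem c hp }
  let ψ : L →ₗ⁅k⁆ S :=
    { toFun := fun e => ⟨φ e, hJ e⟩
      map_add' := fun a b => Subtype.ext (φ.map_add a b)
      map_smul' := fun c a => Subtype.ext (φ.map_smul c a)
      map_lie' := fun {a b} => Subtype.ext (φ.map_lie a b) }
  have h : S.val.comp (UniversalEnvelopingAlgebra.lift k ψ) =
      UniversalEnvelopingAlgebra.lift k φ := by
    refine UniversalEnvelopingAlgebra.hom_ext k (LieHom.ext fun e => ?_)
    simp [ψ]
  rw [← h]
  exact (UniversalEnvelopingAlgebra.lift k ψ u).2 p hp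

end EnvOrbit

/-! ### Relations -/

section Relations

variable {n i m : ℕ} {w : Weyl n}

/-- The generator `f_{(a, b)}` of `S(𝔫⁻_w)`, or `0` if `(a, b)` is not in `R⁻_w`. -/
def genW (w : Weyl n) (a b : Fin (n + 1)) : SymmetricAlgebra ℂ (nMinusW w) :=
  if h : a < b ∧ w b < w a then SymmetricAlgebra.ι ℂ _ (fRoot w ⟨(a, b), h⟩) else 0

theorem genW_eq (α : RootsNeg w) : genW w α.1.1 α.1.2 = SymmetricAlgebra.ι ℂ _ (fRoot w α) :=
  dif_pos α.2

/-- The root vector `E_{b,a} ∈ 𝔫⁻`, `a < b`. -/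
def fMinus (a b : Fin (n + 1)) (h : a < b) : nMinus n := ⟨unit b a h.ne', unit_mem _ _ h⟩

/-- The root vector `E_{a,b} ∈ 𝔫⁺`, `a < b`. -/
def ePlus (a b : Fin (n + 1)) (h : a < b) : nPlus n := ⟨unit a b h.ne, unit_mem _ _ h⟩

/-- The generator `f_{(a, b)}` of `S(𝔫⁻)`, or `0` if `b ≤ a`. -/
def genMinus (a b : Fin (n + 1)) : SymmetricAlgebra ℂ (nMinus n) :=
  if h : a < b then SymmetricAlgebra.ι ℂ _ (fMinus a b h) else 0

theorem symIncl_ι (x : nMinusW w) : symIncl w (SymmetricAlgebra.ι ℂ _ x) =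
    SymmetricAlgebra.ι ℂ _ (LieSubalgebra.inclusion (nMinusW_le w) x) :=
  SymmetricAlgebra.lift_ι_apply _ _

theorem symIncl_genW {a b : Fin (n + 1)} (h : a < b ∧ w b < w a) :
    symIncl w (genW w a b) = genMinus a b := by
  rw [genW, dif_pos h, genMinus, dif_pos h.1, symIncl_ι]
  rfl

theorem delta_ι (e : nPlus n) (f : nMinus n) :
    symDerivation ℂ (deltaLin e) (SymmetricAlgebra.ι ℂ _ f) =
      SymmetricAlgebra.ι ℂ _ (deltaLin e f) :=
  symDerivation_ι ℂ _ _

/-- Root vectors of the Levi subalgebra acting on the first index. -/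
theorem delta_genMinus_left {x₀ x y b : Fin (n + 1)} (hx : x₀ < x) (hxb : x < b) (hyb : y < b) :
    symDerivation ℂ (deltaLin (ePlus x₀ x hx)) (genMinus y b) =
      if y = x₀ then (-1 : ℂ) • genMinus x b else 0 := by
  have h1 : deltaLin (ePlus x₀ x hx) (fMinus y b hyb) =
      if y = x₀ then (-1 : ℂ) • fMinus x b hxb else 0 := by
    rw [deltaLin_apply]
    refine Subtype.ext (Subtype.ext (Matrix.ext fun p q => ?_))
    change (if q < p then (⁅unit x₀ x hx.ne, unit b y hyb.ne'⁆ : SL n).1 p q else 0) = _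
    rw [LieAlgebra.SpecialLinear.sl_bracket]
    change (if q < p then (Matrix.single x₀ x (1 : ℂ) * Matrix.single b y 1 -
      Matrix.single b y (1 : ℂ) * Matrix.single x₀ x 1 :
        Matrix (Fin (n + 1)) (Fin (n + 1)) ℂ) p q else 0) = _
    rw [Matrix.single_mul_single_of_ne _ _ _ _ hxb.ne, zero_sub]
    split_ifs with h h' h'
    · subst h'
      rw [Matrix.single_mul_single_same, one_mul]
      change _ = (-1 : ℂ) * Matrix.single b x (1 : ℂ) p q
      rw [Matrix.neg_apply, neg_one_mul]
    · rw [Matrix.single_mul_single_of_ne _ _ _ _ h']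
      simp
    · change _ = (-1 : ℂ) * Matrix.single b x (1 : ℂ) p q
      rw [Matrix.single_apply, if_neg, mul_zero]
      rintro ⟨rfl, rfl⟩
      exact h hxb
    · rfl
  rw [genMinus, dif_pos hyb, delta_ι, h1, genMinus, dif_pos hxb]
  split_ifs
  · rw [map_smul]
  · rw [map_zero]

/-- Root vectors of the Levi subalgebra acting on the second index. -/
theorem delta_genMinus_right {y₀ y a b : Fin (n + 1)} (hy : y < y₀) (hay : a < y) (hab : a < b) :
    symDerivation ℂ (deltaLin (ePlus y y₀ hy)) (genMinus a b) =
      if b = y₀ then (1 : ℂ) • genMinus a y else 0 := by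
  have h1 : deltaLin (ePlus y y₀ hy) (fMinus a b hab) =
      if b = y₀ then (1 : ℂ) • fMinus a y hay else 0 := by
    rw [deltaLin_apply]
    refine Subtype.ext (Subtype.ext (Matrix.ext fun p q => ?_))
    change (if q < p then (⁅unit y y₀ hy.ne, unit b a hab.ne'⁆ : SL n).1 p q else 0) = _
    rw [LieAlgebra.SpecialLinear.sl_bracket]
    change (if q < p then (Matrix.single y y₀ (1 : ℂ) * Matrix.single b a 1 -
      Matrix.single b a (1 : ℂ) * Matrix.single y y₀ 1 :
        Matrix (Fin (n + 1)) (Fin (n + 1)) ℂ) p q else 0) = _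
    rw [Matrix.single_mul_single_of_ne _ b _ _ hay.ne, sub_zero]
    split_ifs with h h' h'
    · subst h'
      rw [Matrix.single_mul_single_same, one_mul]
      change _ = (1 : ℂ) * Matrix.single y a (1 : ℂ) p q
      rw [one_mul]
    · rw [Matrix.single_mul_single_of_ne _ _ _ _ (Ne.symm h')]
      rfl
    · change _ = (1 : ℂ) * Matrix.single y a (1 : ℂ) p q
      rw [Matrix.single_apply, if_neg, mul_zero]
      rintro ⟨rfl, rfl⟩
      exact h hay
    · rfl
  rw [genMinus, dif_pos hab, delta_ι, h1, genMinus, dif_pos hay]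
  split_ifs
  · rw [map_smul]
  · rw [map_zero]

/-- The `U(𝔫⁺)`-submodule of `S(𝔫⁻)` generated by `q`. -/
def nPlusSpan (q : SymmetricAlgebra ℂ (nMinus n)) :
    Submodule ℂ (SymmetricAlgebra ℂ (nMinus n)) :=
  envOrbit (delta n) q

theorem mem_nPlusSpan {p q : SymmetricAlgebra ℂ (nMinus n)} :
    p ∈ nPlusSpan q ↔ ∃ u, p = nPlusAct u q := Iff.rfl

theorem symDerivation_mem_nPlusSpan (e : nPlus n) {p q : SymmetricAlgebra ℂ (nMinus n)}
    (hp : p ∈ nPlusSpan q) : symDerivation ℂ (deltaLin e) p ∈ nPlusSpan q :=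
  apply_mem_envOrbit (delta n) e hp

/-- The data of a permanent whose entries all lie below the root `α`. -/
def IsBelow (i : ℕ) (α : RootsNeg w) {d : ℕ} (a b : Fin d → Fin (n + 1)) : Prop :=
  ∀ k, α.1.1 ≤ a k ∧ (a k : ℕ) < i ∧ i ≤ (b k : ℕ) ∧ b k ≤ α.1.2

theorem IsBelow.mem {α : RootsNeg w} {d : ℕ} {a b : Fin d → Fin (n + 1)} (h : IsBelow i α a b)
    (hw : IsMinimalRep i w) (k l : Fin d) : a k < b l ∧ w (b l) < w (a k) :=
  hw.mem_of_le α (h k).1 (h k).2.1 (h l).2.2.1 (h l).2.2.2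

/-- The permanents of size `m + 1` lie in the `U(𝔫⁺)`-submodule generated by `f_α^{m+1}`. -/
theorem symIncl_permSum_mem_relations (hw : IsMinimalRep i w) {α : RootsNeg w}
    {a b : Fin (m + 1) → Fin (n + 1)} (h : IsBelow i α a b) :
    symIncl w (permSum (genW w) a b) ∈ relations w m := by
  have hα := hw.isBlock α
  set q := genMinus α.1.1 α.1.2 ^ (m + 1) with hq
  have hq' : symIncl w (SymmetricAlgebra.ι ℂ _ (fRoot w α) ^ (m + 1)) = q := by
    rw [map_pow, ← genW_eq, symIncl_genW α.2]
  have h1 : symIncl w (permSum (genW w) a b) = permSum genMinus a b := by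
    simp only [permSum, map_sum, map_prod]
    exact Finset.sum_congr rfl fun τ _ => Finset.prod_congr rfl fun k _ =>
      symIncl_genW (h.mem hw k (τ k))
  suffices h2 : permSum genMinus a b ∈ nPlusSpan q by
    obtain ⟨u, hu⟩ := mem_nPlusSpan.1 h2
    exact ⟨α, u, by rw [h1, hu, hq']⟩
  have hrow : permSum genMinus a (fun _ : Fin (m + 1) => α.1.2) ∈ nPlusSpan q := by
    refine permSum_mem_of_polarization genMinus (nPlusSpan q) α.1.1
      (fun x => α.1.1 ≤ x ∧ (x : ℕ) < i) _ (-1) (by norm_num) ?_ ⟨le_rfl, hα.1⟩ ?_ a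
      fun k => ⟨(h k).1, (h k).2.1⟩
    · intro x hx hne
      refine ⟨symDerivation ℂ (deltaLin (ePlus α.1.1 x (lt_of_le_of_ne hx.1 hne.symm))),
        fun p hp => symDerivation_mem_nPlusSpan _ hp, fun y hy l => ?_⟩
      exact delta_genMinus_left _ (Fin.lt_def.2 (lt_of_lt_of_le hx.2 hα.2))
        (Fin.lt_def.2 (lt_of_lt_of_le hy.2 hα.2))
    · rw [permSum_const, ← nsmul_eq_mul]
      exact Submodule.smul_of_tower_mem _ _ (mem_envOrbit_self (delta n) q)
  rw [← permSum_swap] at hrow ⊢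
  refine permSum_mem_of_polarization _ (nPlusSpan q) α.1.2
    (fun y => i ≤ (y : ℕ) ∧ y ≤ α.1.2) _ 1 one_ne_zero ?_ ⟨hα.2, le_rfl⟩ hrow b
    fun k => ⟨(h k).2.2.1, (h k).2.2.2⟩
  intro y hy hne
  refine ⟨symDerivation ℂ (deltaLin (ePlus y α.1.2 (lt_of_le_of_ne hy.2 hne))),
    fun p hp => symDerivation_mem_nPlusSpan _ hp, fun z hz l => ?_⟩
  exact delta_genMinus_right _ (Fin.lt_def.2 (lt_of_lt_of_le (h l).2.1 hy.1))
    (Fin.lt_def.2 (lt_of_lt_of_le (h l).2.1 hz.1))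

/-- The ideal of `S(𝔫⁻_w)` generated by the permanents of size `m + 1`. -/
def permIdeal (i m : ℕ) (w : Weyl n) : Ideal (SymmetricAlgebra ℂ (nMinusW w)) :=
  Ideal.span {p | ∃ (α : RootsNeg w) (a b : Fin (m + 1) → Fin (n + 1)),
    IsBelow i α a b ∧ p = permSum (genW w) a b}

end Relations

/-! ### The straightening law -/

section Straightening

/-- Two families in opposite order can be sorted simultaneously. -/
theorem exists_perm_monotone_antitone {d : ℕ} {κ : Type*} [LinearOrder κ] {a b : Fin d → κ}
    (h : Antivary a b) : ∃ π : Equiv.Perm (Fin d), Monotone (a ∘ π) ∧ Antitone (b ∘ π) := by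
  set f : Fin d → Lex (κ × κᵒᵈ) := fun k => toLex (a k, OrderDual.toDual (b k)) with hf
  have hmono := Tuple.monotone_sort f
  refine ⟨Tuple.sort f, fun k l hkl => ?_, fun k l hkl => ?_⟩
  · rcases (Prod.Lex.le_iff).1 (hmono hkl) with h1 | h1
    · exact le_of_lt h1
    · exact le_of_eq h1.1
  · rcases (Prod.Lex.le_iff).1 (hmono hkl) with h1 | h1
    · by_contra h2
      exact absurd (h (not_le.1 h2)) (not_le.2 h1)
    · exact h1.2

/-- The pairing of two families in opposite order is unique. -/
theorem prod_eq_prod_of_antivary {d : ℕ} {κ A : Type*} [LinearOrder κ] [CommMonoid A]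
    {a b : Fin d → κ} {τ : Equiv.Perm (Fin d)} (h : Antivary a b) (h' : Antivary a (b ∘ τ))
    (g : κ → κ → A) : ∏ k, g (a k) (b (τ k)) = ∏ k, g (a k) (b k) := by
  obtain ⟨π, h1, h2⟩ := exists_perm_monotone_antitone h
  obtain ⟨π', h3, h4⟩ := exists_perm_monotone_antitone h'
  have ha : a ∘ π = a ∘ π' := Tuple.unique_monotone h1 h3
  have hb : (OrderDual.toDual ∘ b) ∘ π = (OrderDual.toDual ∘ b) ∘ (π'.trans τ) :=
    Tuple.unique_monotone (f := OrderDual.toDual ∘ b) (fun k l hkl => h2 hkl)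
      (fun k l hkl => h4 hkl)
  rw [← Equiv.prod_comp π fun k => g (a k) (b k), ← Equiv.prod_comp π' fun k => g (a k) (b (τ k))]
  refine Finset.prod_congr rfl fun k _ => ?_
  have ha' : a (π k) = a (π' k) := congrFun ha k
  have hb' : b (π k) = b (τ (π' k)) := congrFun hb k
  rw [ha', hb']

theorem exists_le_of_le_degree {R : Type*} {d : ℕ} (s : R →₀ ℕ) (h : d ≤ s.degree) :
    ∃ g : Fin d → R, (∀ k, s (g k) ≠ 0) ∧ ∑ k, Finsupp.single (g k) 1 ≤ s := by
  induction d generalizing s with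
  | zero => exact ⟨fun k => k.elim0, fun k => k.elim0, by simp⟩
  | succ d ih =>
    obtain ⟨t, a, rfl, ht⟩ := exists_eq_add_single_of_degree_eq_succ
      (s := s) (d := s.degree - 1) (by omega)
    obtain ⟨g, hg1, hg2⟩ := ih t (by omega)
    refine ⟨Fin.cons a g, ?_, ?_⟩
    · refine Fin.cases ?_ fun k => ?_
      · simp
      · have := hg1 k
        rw [Fin.cons_succ, Finsupp.add_apply]
        omega
    · rw [Fin.sum_univ_succ, add_comm]
      simp only [Fin.cons_zero, Fin.cons_succ]
      exact add_le_add_left hg2 _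

variable {n i m : ℕ} {w : Weyl n}

theorem weight_pairWeight_le (s : RootsNeg w →₀ ℕ) :
    Finsupp.weight pairWeight s ≤ s.degree * (n * n) := by
  rw [Finsupp.weight_apply, Finsupp.sum, Finsupp.degree_apply, Finset.sum_mul]
  refine Finset.sum_le_sum fun α _ => ?_
  rw [smul_eq_mul]
  exact Nat.mul_le_mul_left _ (Nat.mul_le_mul (Nat.le_of_lt_succ α.1.1.2)
    (Nat.le_of_lt_succ α.1.2.2))

/-- The exponent of the term of a permanent, multiplied by a monomial, given by `τ`. -/
def permExponent (hw : IsMinimalRep i w) {α : RootsNeg w} {d : ℕ} {a b : Fin d → Fin (n + 1)}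
    (h : IsBelow i α a b) (u : RootsNeg w →₀ ℕ) (τ : Equiv.Perm (Fin d)) : RootsNeg w →₀ ℕ :=
  u + ∑ k, Finsupp.single ⟨(a k, b (τ k)), h.mem hw k (τ k)⟩ 1

section PermExponent

variable (hw : IsMinimalRep i w) {α : RootsNeg w} {d : ℕ} {a b : Fin d → Fin (n + 1)}
  (h : IsBelow i α a b) (u : RootsNeg w →₀ ℕ) (τ : Equiv.Perm (Fin d))

theorem symMonomial_permExponent : symMonomial ℂ (fRoot w) (permExponent hw h u τ) =
    symMonomial ℂ (fRoot w) u * ∏ k, genW w (a k) (b (τ k)) := by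
  rw [permExponent, symMonomial_add]
  congr 1
  have h1 : ∀ T : Finset (Fin d), symMonomial ℂ (fRoot w)
      (∑ k ∈ T, Finsupp.single ⟨(a k, b (τ k)), h.mem hw k (τ k)⟩ 1) =
        ∏ k ∈ T, genW w (a k) (b (τ k)) := by
    classical
    intro T
    induction T using Finset.induction_on with
    | empty => rw [Finset.sum_empty, Finset.prod_empty, symMonomial_zero]
    | insert k T hk ihT =>
      rw [Finset.sum_insert hk, Finset.prod_insert hk, symMonomial_add, symMonomial_single, ihT,
        ← genW_eq]
  exact h1 Finset.univ

theorem degree_permExponent : (permExponent hw h u τ).degree = u.degree + d := by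
  rw [permExponent, map_add, map_sum]
  simp

theorem weight_permExponent : Finsupp.weight pairWeight (permExponent hw h u τ) =
    Finsupp.weight pairWeight u + ∑ k, (a k : ℕ) * (b (τ k) : ℕ) := by
  rw [permExponent, map_add, map_sum]
  congr 1
  exact Finset.sum_congr rfl fun k _ => by rw [Finsupp.weight_single, one_smul]; rfl

end PermExponent

/-- A monomial which is not admissible contains a product of `m + 1` factors indexed by a chain. -/
theorem exists_eq_permExponent (hw : IsMinimalRep i w) {s : RootsNeg w →₀ ℕ}
    (hs : s ∉ admissible w m) :
    ∃ (α : RootsNeg w) (a b : Fin (m + 1) → Fin (n + 1)) (h : IsBelow i α a b)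
      (u : RootsNeg w →₀ ℕ), Antivary a b ∧ permExponent hw h u 1 = s := by
  classical
  obtain ⟨c, hc, hcs⟩ : ∃ c, IsRootChain c ∧ m < ∑ α ∈ c, s α := by
    by_contra! h
    exact hs h
  have hdeg : m + 1 ≤ (s.filter (· ∈ c)).degree := by
    have h1 : (s.filter (· ∈ c)).degree = ∑ α ∈ c, s α := by
      have h2 : (s.filter (· ∈ c)).support ⊆ c := fun α hα => by
        rw [Finsupp.support_filter] at hα
        exact (Finset.mem_filter.1 hα).2
      rw [Finsupp.degree_apply, Finset.sum_subset h2 fun α _ hα => Finsupp.notMem_support_iff.1 hα]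
      exact Finset.sum_congr rfl fun α hα => Finsupp.filter_apply_pos _ _ hα
    omega
  obtain ⟨g, hg1, hg2⟩ := exists_le_of_le_degree _ hdeg
  have hgc : ∀ k, g k ∈ c := fun k => by
    by_contra hk
    exact hg1 k (Finsupp.filter_apply_neg _ _ hk)
  have hgs : ∑ k, Finsupp.single (g k) 1 ≤ s := hg2.trans fun α => by
    rw [Finsupp.filter_apply]
    split_ifs
    · exact le_rfl
    · exact Nat.zero_le _
  obtain ⟨α, -, hmax⟩ := IsRootChain.exists_max (c := Finset.univ.image g)
    (fun x hx y hy => by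
      obtain ⟨k, -, rfl⟩ := Finset.mem_image.1 hx
      obtain ⟨l, -, rfl⟩ := Finset.mem_image.1 hy
      exact hc _ (hgc k) _ (hgc l)) (Finset.univ_nonempty.image g)
  refine ⟨α, fun k => (g k).1.1, fun k => (g k).1.2, fun k => ?_,
    s - ∑ k, Finsupp.single (g k) 1, fun k l hkl => ?_, tsub_add_cancel_of_le hgs⟩
  · have h1 := hmax (g k) (Finset.mem_image_of_mem g (Finset.mem_univ k))
    exact ⟨h1.1, (hw.isBlock (g k)).1, (hw.isBlock (g k)).2, h1.2⟩
  · rcases hc _ (hgc k) _ (hgc l) with h1 | h1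
    · exact h1.1
    · exact absurd h1.2 (not_le.2 hkl)

/-- If the terms of a sum in `W` which are not in `W` all agree, they are in `W`. -/
theorem mem_of_sum_mem {M κ : Type*} [AddCommGroup M] [Module ℂ M] [Fintype κ] {W : Submodule ℂ M}
    {x : M} (f : κ → M) (p : κ → Prop) (hex : ∃ τ, p τ) (heq : ∀ τ, p τ → f τ = x)
    (hrest : ∀ τ, ¬ p τ → f τ ∈ W) (hsum : ∑ τ, f τ ∈ W) : x ∈ W := by
  classical
  rw [← Finset.sum_filter_add_sum_filter_not Finset.univ p] at hsum
  have hmain := (Submodule.add_mem_iff_left W (Submodule.sum_mem _ fun τ hτ =>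
    hrest τ (Finset.mem_filter.1 hτ).2)).1 hsum
  rw [Finset.sum_congr rfl fun τ hτ => heq τ (Finset.mem_filter.1 hτ).2, Finset.sum_const,
    ← Nat.cast_smul_eq_nsmul ℂ] at hmain
  obtain ⟨τ, hτ⟩ := hex
  exact (Submodule.smul_mem_iff W (Nat.cast_ne_zero.2 (Finset.card_ne_zero.2
    ⟨τ, Finset.mem_filter.2 ⟨Finset.mem_univ _, hτ⟩⟩))).1 hmain

/-- Modulo the permanents, every monomial is a combination of admissible monomials of the same
degree: by the rearrangement inequality, the terms of the permanent which belongs to a chain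
either agree with the product over the chain or have larger weight `∑ a b`. -/
theorem symMonomial_mem_span_sup (hw : IsMinimalRep i w) (s : RootsNeg w →₀ ℕ) :
    symMonomial ℂ (fRoot w) s ∈
      Submodule.span ℂ (symMonomial ℂ (fRoot w) '' {t | t ∈ admissible w m ∧ t.degree = s.degree}) ⊔
        (permIdeal i m w).restrictScalars ℂ := by
  classical
  induction hN : s.degree * (n * n) - Finsupp.weight pairWeight s using Nat.strong_induction_on
    generalizing s with
  | _ N ih =>
  by_cases hs : s ∈ admissible w m
  · exact Submodule.mem_sup_left (Submodule.subset_span ⟨s, ⟨hs, rfl⟩, rfl⟩)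
  obtain ⟨α, a, b, hbelow, u, hanti, hu⟩ := exists_eq_permExponent hw hs
  have htdeg : ∀ τ, (permExponent hw hbelow u τ).degree = s.degree := by
    intro τ
    rw [← hu, degree_permExponent, degree_permExponent]
  have hanti' : Antivary (fun k => (a k : ℕ)) (fun k => (b k : ℕ)) := fun k l hkl => hanti hkl
  have hwt : Finsupp.weight pairWeight s =
      Finsupp.weight pairWeight u + ∑ k, (a k : ℕ) * (b k : ℕ) := by
    rw [← hu, weight_permExponent]
    rfl
  have hle : ∀ τ, Finsupp.weight pairWeight s ≤
      Finsupp.weight pairWeight (permExponent hw hbelow u τ) := by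
    intro τ
    rw [hwt, weight_permExponent]
    exact Nat.add_le_add_left (hanti'.sum_mul_le_sum_mul_comp_perm (σ := τ)) _
  have heq : ∀ τ, Finsupp.weight pairWeight (permExponent hw hbelow u τ) =
        Finsupp.weight pairWeight s →
      symMonomial ℂ (fRoot w) (permExponent hw hbelow u τ) = symMonomial ℂ (fRoot w) s := by
    intro τ hτ
    rw [hwt, weight_permExponent] at hτ
    have h1 := (hanti'.sum_mul_eq_sum_mul_comp_perm_iff (σ := τ)).1 (Nat.add_left_cancel hτ)
    have h2 : Antivary a (b ∘ τ) := fun k l hkl => h1 hkl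
    rw [← hu, symMonomial_permExponent, symMonomial_permExponent, prod_eq_prod_of_antivary hanti h2]
    rfl
  obtain ⟨W, hW⟩ : ∃ W, W = Submodule.span ℂ
    (symMonomial ℂ (fRoot w) '' {t | t ∈ admissible w m ∧ t.degree = s.degree}) ⊔
        (permIdeal i m w).restrictScalars ℂ := ⟨_, rfl⟩
  rw [← hW]
  have hsum : ∑ τ, symMonomial ℂ (fRoot w) (permExponent hw hbelow u τ) ∈ W := by
    rw [hW]
    refine Submodule.mem_sup_right ?_
    rw [Finset.sum_congr rfl fun τ _ => symMonomial_permExponent hw hbelow u τ, ← Finset.mul_sum]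
    exact Ideal.mul_mem_left _ _ (Ideal.subset_span ⟨α, a, b, hbelow, rfl⟩)
  refine mem_of_sum_mem _ (fun τ => Finsupp.weight pairWeight (permExponent hw hbelow u τ) =
    Finsupp.weight pairWeight s) ⟨1, by rw [hu]⟩ heq (fun τ h1 => ?_) hsum
  have h2 := hle τ
  have h3 := weight_pairWeight_le (permExponent hw hbelow u τ)
  rw [htdeg] at h3
  have h4 : s.degree * (n * n) - Finsupp.weight pairWeight (permExponent hw hbelow u τ) < N := by
    omega
  have h5 := ih _ h4 (permExponent hw hbelow u τ) (by rw [htdeg])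
  rw [htdeg] at h5
  rw [hW]
  exact h5

end Straightening

/-! ### The action of the abelian nilradical -/

/-- The elements on which an action of a commutative algebra is compatible with a derivation are
closed under products. -/
theorem equivariant_mul {k A V : Type*} [CommRing k] [CommRing A] [Algebra k A] [AddCommGroup V]
    [Module k V] (D : Derivation k A A) (Θ : A →ₐ[k] Module.End k V) (T : Module.End k V) {a b : A}
    (ha : ∀ y, T (Θ a y) = Θ a (T y) + Θ (D a) y) (hb : ∀ y, T (Θ b y) = Θ b (T y) + Θ (D b) y)
    (y : V) : T (Θ (a * b) y) = Θ (a * b) (T y) + Θ (D (a * b)) y := by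
  have hm : ∀ a b y, Θ (a * b) y = Θ a (Θ b y) := fun a b y => by rw [map_mul]; rfl
  rw [Derivation.leibniz, smul_eq_mul, smul_eq_mul, mul_comm b, map_add, LinearMap.add_apply, hm,
    hm, hm, hm, ha, hb, map_add]
  abel

section Block

variable {n i m : ℕ} {w : Weyl n}

/-- The part of a matrix supported at the positions `(x, y)` with `p x y`, where `p` is
irreflexive. -/
def maskPart (p : Fin (n + 1) → Fin (n + 1) → Prop) [∀ x y, Decidable (p x y)]
    (hp : ∀ x, ¬ p x x) : SL n →ₗ[ℂ] SL n where
  toFun A := ⟨Matrix.of fun x y => if p x y then A.1 x y else 0, by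
    refine LinearMap.mem_ker.2 ((Matrix.traceLinearMap_apply _ _ _ _).trans ?_)
    exact Finset.sum_eq_zero fun x _ => if_neg (hp x)⟩
  map_add' A B := by
    ext x y
    change (if p x y then A.1 x y + B.1 x y else 0) =
      (if p x y then A.1 x y else 0) + (if p x y then B.1 x y else 0)
    split_ifs <;> simp
  map_smul' c A := by
    ext x y
    change (if p x y then c * A.1 x y else 0) = c * (if p x y then A.1 x y else 0)
    split_ifs <;> simp

/-- The lower left block of a matrix, whose rows are the ones after the `i`-th and whose columns
are the first `i` ones. -/
def blockPart (i : ℕ) : SL n →ₗ[ℂ] SL n :=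
  maskPart (fun x y => (y : ℕ) < i ∧ i ≤ (x : ℕ)) fun _ h => absurd h.1 (not_lt.2 h.2)

/-- The strictly upper triangular part of the two diagonal blocks of a matrix. -/
def leviPart (i : ℕ) : SL n →ₗ[ℂ] SL n :=
  maskPart (fun x y => x < y ∧ ((x : ℕ) < i ↔ (y : ℕ) < i)) fun x h => lt_irrefl x h.1

theorem blockPart_apply (i : ℕ) (A : SL n) (x y : Fin (n + 1)) :
    (blockPart i A).1 x y = if (y : ℕ) < i ∧ i ≤ (x : ℕ) then A.1 x y else 0 := rfl

theorem leviPart_apply (i : ℕ) (A : SL n) (x y : Fin (n + 1)) :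
    (leviPart i A).1 x y = if x < y ∧ ((x : ℕ) < i ↔ (y : ℕ) < i) then A.1 x y else 0 := rfl

theorem blockPart_lie_blockPart (A B : SL n) : ⁅blockPart i A, blockPart i B⁆ = 0 := by
  have h : ∀ A B : SL n, (blockPart i A).1 * (blockPart i B).1 = 0 := by
    intro A B
    ext x y
    rw [Matrix.mul_apply]
    refine Finset.sum_eq_zero fun z _ => ?_
    rw [blockPart_apply, blockPart_apply]
    split_ifs with h1 h2 h2
    · omega
    · rw [mul_zero]
    · rw [zero_mul]
    · rw [zero_mul]
  refine Subtype.ext ?_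
  rw [LieAlgebra.SpecialLinear.sl_bracket, h, h, sub_zero]
  rfl

/-- The lower left block of `[e, A] mod 𝔟`, for `e ∈ 𝔫⁺`, is the bracket of the Levi part of `e`
with the lower left block of `A`. -/
theorem leviPart_lie_blockPart (e : nPlus n) (A : SL n) :
    ⁅leviPart i (e : SL n), blockPart i A⁆ =
      blockPart i (lowerPart ⁅(e : SL n), A⁆ : nMinus n) := by
  have he : ∀ x y, ¬ x < y → e.1.1 x y = 0 := e.2
  refine Subtype.ext (Matrix.ext fun x y => ?_)
  rw [blockPart_apply]
  change _ = if (y : ℕ) < i ∧ i ≤ (x : ℕ) then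
    (if y < x then ⁅(e : SL n), A⁆.1 x y else 0) else 0
  rw [LieAlgebra.SpecialLinear.sl_bracket, LieAlgebra.SpecialLinear.sl_bracket, Matrix.sub_apply,
    Matrix.sub_apply, Matrix.mul_apply, Matrix.mul_apply, Matrix.mul_apply, Matrix.mul_apply]
  split_ifs with h h'
  · congr 1
    · refine Finset.sum_congr rfl fun z _ => ?_
      rw [leviPart_apply, blockPart_apply]
      by_cases hxz : x < z
      · have : (x : ℕ) < z := hxz
        rw [if_pos ⟨hxz, by omega⟩, if_pos (by omega)]
      · rw [he x z hxz, if_neg (fun h => hxz h.1), zero_mul, zero_mul]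
    · refine Finset.sum_congr rfl fun z _ => ?_
      rw [leviPart_apply, blockPart_apply]
      by_cases hzy : z < y
      · have : (z : ℕ) < y := hzy
        rw [if_pos (by omega), if_pos ⟨hzy, by omega⟩]
      · rw [he z y hzy, ite_self, mul_zero, mul_zero]
  · exact absurd (Fin.lt_def.2 (lt_of_lt_of_le h.1 h.2)) h'
  · rw [Finset.sum_eq_zero, Finset.sum_eq_zero, sub_zero]
    · intro z _
      rw [leviPart_apply, blockPart_apply]
      split_ifs
      · omega
      · rw [mul_zero]
      · rw [zero_mul]
      · rw [zero_mul]
    · intro z _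
      rw [leviPart_apply, blockPart_apply]
      split_ifs
      · omega
      · rw [mul_zero]
      · rw [zero_mul]
      · rw [zero_mul]

variable {V : Type*} [AddCommGroup V] [Module ℂ V]

/-- The action of `S(𝔫⁻)` on a representation through the abelian lower left block; the entries
outside of the block act by zero. -/
def blockAction (i : ℕ) (ρ : SL n →ₗ⁅ℂ⁆ Module.End ℂ V) :
    SymmetricAlgebra ℂ (nMinus n) →ₐ[ℂ] Module.End ℂ V :=
  symLift ℂ ((ρ : SL n →ₗ[ℂ] Module.End ℂ V) ∘ₗ blockPart i ∘ₗ (nMinus n).toSubmodule.subtype)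
    fun x y => LinearMap.ext fun z => by
      have h := map_lie_apply ρ (blockPart i x) (blockPart i y) z
      rw [blockPart_lie_blockPart, map_zero, LinearMap.zero_apply, add_zero] at h
      exact h

variable {ρ : SL n →ₗ⁅ℂ⁆ Module.End ℂ V} {v : V}

theorem blockAction_ι (x : nMinus n) :
    blockAction i ρ (SymmetricAlgebra.ι ℂ _ x) = ρ (blockPart i x) :=
  symLift_ι _ _ _ _

/-- The action of the abelian block is equivariant with respect to the Levi part of `𝔫⁺`. -/
theorem leviPart_blockAction (e : nPlus n) (p : SymmetricAlgebra ℂ (nMinus n)) :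
    ∀ y, ρ (leviPart i e) (blockAction i ρ p y) = blockAction i ρ p (ρ (leviPart i e) y) +
      blockAction i ρ (symDerivation ℂ (deltaLin e) p) y := by
  induction p using SymmetricAlgebra.induction with
  | algebraMap r =>
    intro y
    rw [Derivation.map_algebraMap, map_zero, AlgHom.commutes]
    simp [Module.algebraMap_end_apply]
  | ι x =>
    intro y
    rw [symDerivation_ι, blockAction_ι, blockAction_ι, map_lie_apply, leviPart_lie_blockPart]
    rfl
  | mul a b ha hb => exact equivariant_mul _ _ _ ha hb
  | add a b ha hb =>
    intro y
    simp only [map_add, LinearMap.add_apply, ha, hb]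
    abel

theorem IsHighestWeightRep.leviPart_apply_eq_zero (hv : IsHighestWeightRep i m ρ v) (e : SL n) :
    ρ (leviPart i e) v = 0 := by
  rw [hv.borel_apply, weightValue, Finset.sum_eq_zero, zero_smul]
  · intro a _
    rw [leviPart_apply, if_neg fun h => lt_irrefl a h.1, mul_zero]
  · intro x y hxy
    rw [leviPart_apply, if_neg fun h => hxy h.1.le]

/-- The action of `S(𝔫⁻_w)` through commuting operators. -/
def opHom (i : ℕ) (w : Weyl n) (ρ : SL n →ₗ⁅ℂ⁆ Module.End ℂ V) :
    SymmetricAlgebra ℂ (nMinusW w) →ₐ[ℂ] Module.End ℂ V :=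
  (blockAction i ρ).comp (symIncl w)

theorem opHom_apply (p : SymmetricAlgebra ℂ (nMinusW w)) :
    opHom i w ρ p = blockAction i ρ (symIncl w p) := rfl

theorem opHom_ι (hw : IsBlock i w) (x : nMinusW w) :
    opHom i w ρ (SymmetricAlgebra.ι ℂ _ x) = ρ x := by
  rw [opHom_apply, symIncl_ι, blockAction_ι]
  congr 1
  refine Subtype.ext (Matrix.ext fun a b => ?_)
  rw [blockPart_apply]
  change (if _ then x.1.1 a b else 0) = x.1.1 a b
  split_ifs with h
  · rfl
  · exact (x.2 a b fun h' => h ⟨(hw ⟨(b, a), h'⟩).1, (hw ⟨(b, a), h'⟩).2⟩).symm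

/-- The relations annihilate the highest weight vector. -/
theorem IsHighestWeightRep.blockAction_relations [FiniteDimensional ℂ V]
    (hv : IsHighestWeightRep i m ρ v) (hw : IsBlock i w) {q : SymmetricAlgebra ℂ (nMinus n)}
    (hq : q ∈ Submodule.span ℂ (relations w m)) : blockAction i ρ q v = 0 := by
  let J : Submodule ℂ (SymmetricAlgebra ℂ (nMinus n)) :=
    LinearMap.ker ((LinearMap.applyₗ v).comp (blockAction i ρ).toLinearMap)
  have hJ : ∀ p, p ∈ J ↔ blockAction i ρ p v = 0 := fun p => Iff.rfl
  rw [← hJ]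
  refine Submodule.span_le.2 ?_ hq
  rintro _ ⟨α, u, rfl⟩
  refine lift_apply_mem_of_stable (delta n) (J := J) (fun e p hp => ?_) u ?_
  · rw [hJ] at hp ⊢
    have h := leviPart_blockAction (i := i) (ρ := ρ) e p v
    rw [hp, map_zero, hv.leviPart_apply_eq_zero, map_zero, zero_add] at h
    exact h.symm
  · rw [hJ, ← opHom_apply, map_pow, opHom_ι hw]
    exact hv.unit_pow_apply_eq_zero (hw α).1 (hw α).2 _

end Block

/-! ### The monomial basis of the submodule generated by the highest weight vector -/

section MonomialBasis

variable {n i m : ℕ} {w : Weyl n} {V : Type*} [AddCommGroup V] [Module ℂ V]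
  {ρ : SL n →ₗ⁅ℂ⁆ Module.End ℂ V} {v : V}

/-- The vector `f^s v`. -/
def orbitVec (i : ℕ) (w : Weyl n) (ρ : SL n →ₗ⁅ℂ⁆ Module.End ℂ V) (v : V)
    (s : RootsNeg w →₀ ℕ) : V :=
  opHom i w ρ (symMonomial ℂ (fRoot w) s) v

theorem orbitVec_zero : orbitVec i w ρ v 0 = v := by
  rw [orbitVec, symMonomial_zero, map_one]; rfl

theorem orbitVec_add_single (hw : IsBlock i w) (s : RootsNeg w →₀ ℕ) (α : RootsNeg w) :
    orbitVec i w ρ v (s + Finsupp.single α 1) = ρ (fRoot w α) (orbitVec i w ρ v s) := by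
  rw [orbitVec, add_comm s, symMonomial_add, symMonomial_single, map_mul, opHom_ι hw]
  rfl

theorem IsHighestWeightRep.linearIndependent_orbitVec (hv : IsHighestWeightRep i m ρ v)
    (h : i ≤ n + 1) (hw : IsBlock i w) :
    LinearIndependent ℂ fun s : admissible w m => orbitVec i w ρ v s :=
  hv.linearIndependent h hw orbitVec_zero (fun α s => orbitVec_add_single hw s α) _
    exists_sum_indicatorExponent

/-- The ideal of the elements of `S(𝔫⁻_w)` which annihilate `v`. -/
def vanishingIdeal (i : ℕ) (w : Weyl n) (ρ : SL n →ₗ⁅ℂ⁆ Module.End ℂ V) (v : V) :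
    Ideal (SymmetricAlgebra ℂ (nMinusW w)) where
  carrier := {p | opHom i w ρ p v = 0}
  zero_mem' := by
    change opHom i w ρ 0 v = 0
    rw [map_zero]; rfl
  add_mem' {p q} hp hq := by
    change opHom i w ρ (p + q) v = 0
    rw [map_add]
    exact (congrArg₂ (· + ·) hp hq).trans (add_zero 0)
  smul_mem' r p hp := by
    change opHom i w ρ (r * p) v = 0
    rw [map_mul]
    exact (congrArg (opHom i w ρ r) hp).trans (map_zero _)

theorem IsHighestWeightRep.mem_vanishingIdeal_of_symIncl [FiniteDimensional ℂ V]
    (hv : IsHighestWeightRep i m ρ v) (hw : IsBlock i w) {p : SymmetricAlgebra ℂ (nMinusW w)}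
    (hp : symIncl w p ∈ Submodule.span ℂ (relations w m)) : p ∈ vanishingIdeal i w ρ v :=
  hv.blockAction_relations hw hp

theorem permIdeal_le (hw : IsMinimalRep i w) :
    permIdeal i m w ≤ Ideal.span {p | symIncl w p ∈ relations w m} :=
  Ideal.span_mono fun p ⟨α, a, b, h, hp⟩ => by
    rw [hp]; exact symIncl_permSum_mem_relations hw h

theorem IsHighestWeightRep.permIdeal_le_vanishingIdeal [FiniteDimensional ℂ V]
    (hv : IsHighestWeightRep i m ρ v) (hw : IsMinimalRep i w) :
    permIdeal i m w ≤ vanishingIdeal i w ρ v :=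
  (permIdeal_le hw).trans <| Ideal.span_le.2 fun _ hp =>
    hv.mem_vanishingIdeal_of_symIncl hw.isBlock (Submodule.subset_span hp)

theorem map_mem_span_image {k M M' κ : Type*} [CommRing k] [AddCommGroup M] [Module k M]
    [AddCommGroup M'] [Module k M'] {e : κ → M} {Λ : Set κ} (F : M →ₗ[k] M') {x p q : M}
    (hp : p ∈ Submodule.span k (e '' Λ)) (hq : F q = 0) (hx : p + q = x) :
    F x ∈ Submodule.span k ((fun s => F (e s)) '' Λ) := by
  have h := Submodule.mem_map_of_mem (f := F) hp
  rw [Submodule.map_span, ← Set.image_comp] at h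
  rw [← hx, map_add, hq, add_zero]
  exact h

/-- The straightening law in the module. -/
theorem IsHighestWeightRep.orbitVec_mem_span [FiniteDimensional ℂ V]
    (hv : IsHighestWeightRep i m ρ v) (hw : IsMinimalRep i w) (s : RootsNeg w →₀ ℕ) :
    orbitVec i w ρ v s ∈ Submodule.span ℂ
      (orbitVec i w ρ v '' {t | t ∈ admissible w m ∧ t.degree = s.degree}) := by
  obtain ⟨p, hp, q, hq, hpq⟩ := Submodule.mem_sup.1 (symMonomial_mem_span_sup (m := m) hw s)
  exact map_mem_span_image ((LinearMap.applyₗ v).comp (opHom i w ρ).toLinearMap) hp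
    (hv.permIdeal_le_vanishingIdeal hw hq) hpq

theorem fRoot_span (x : nMinusW w) : x ∈ Submodule.span ℂ (Set.range (fRoot w)) := by
  have h1 : (x : SL n) ∈ Submodule.span ℂ
      ((nMinusW w).toSubmodule.subtype '' Set.range (fRoot w)) := by
    refine Submodule.span_mono ?_ (mem_span_unit (r := fun x y => y < x ∧ w x < w y)
      (fun x h => lt_irrefl x h.1) x.2)
    rintro _ ⟨a, b, h, hab, rfl⟩
    exact ⟨fRoot w ⟨(b, a), hab⟩, ⟨_, rfl⟩, rfl⟩
  rw [← Submodule.map_span] at h1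
  obtain ⟨y, hy, hyx⟩ := h1
  rwa [← Subtype.ext hyx]

/-- The monomials in a spanning set span the symmetric algebra. -/
theorem span_symMonomial {k R N : Type*} [CommRing k] [Fintype R] [AddCommGroup N] [Module k N]
    {x : R → N} (hx : ∀ z, z ∈ Submodule.span k (Set.range x)) (p : SymmetricAlgebra k N) :
    p ∈ Submodule.span k (Set.range (symMonomial k x)) := by
  have hmul : ∀ a ∈ Submodule.span k (Set.range (symMonomial k x)),
      ∀ b ∈ Submodule.span k (Set.range (symMonomial k x)),
      a * b ∈ Submodule.span k (Set.range (symMonomial k x)) := by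
    intro a ha b hb
    have h := Submodule.mul_mem_mul ha hb
    rw [Submodule.span_mul_span] at h
    refine Submodule.span_mono ?_ h
    rintro _ ⟨_, ⟨s, rfl⟩, _, ⟨t, rfl⟩, rfl⟩
    exact ⟨s + t, symMonomial_add x s t⟩
  induction p using SymmetricAlgebra.induction with
  | algebraMap r =>
    rw [Algebra.algebraMap_eq_smul_one]
    exact Submodule.smul_mem _ _ (Submodule.subset_span ⟨0, symMonomial_zero x⟩)
  | ι z =>
    have h := Submodule.mem_map_of_mem (f := SymmetricAlgebra.ι k N) (hx z)
    rw [Submodule.map_span] at h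
    refine Submodule.span_mono ?_ h
    rintro _ ⟨_, ⟨a, rfl⟩, rfl⟩
    exact ⟨Finsupp.single a 1, symMonomial_single x a⟩
  | mul a b ha hb => exact hmul a ha b hb
  | add a b ha hb => exact Submodule.add_mem _ ha hb

/-- A linear map which is injective on a basis of a subspace is injective on the subspace. -/
theorem eq_zero_of_linearIndependent {k M M' κ : Type*} [CommRing k] [AddCommGroup M] [Module k M]
    [AddCommGroup M'] [Module k M'] {e : κ → M} {Λ : Set κ} (F : M →ₗ[k] M')
    (hF : LinearIndependent k fun s : Λ => F (e s)) {x : M} (hx : x ∈ Submodule.span k (e '' Λ))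
    (h0 : F x = 0) : x = 0 := by
  rw [Set.image_eq_range, Finsupp.mem_span_range_iff_exists_finsupp] at hx
  obtain ⟨c, rfl⟩ := hx
  rw [map_finsuppSum] at h0
  simp only [map_smul] at h0
  have : c = 0 := by
    refine linearIndependent_iff.1 hF c ?_
    rw [Finsupp.linearCombination_apply]
    exact h0
  rw [this, Finsupp.sum_zero_index]

theorem symMonomial_span_sup_permIdeal (hw : IsMinimalRep i w)
    (p : SymmetricAlgebra ℂ (nMinusW w)) :
    p ∈ Submodule.span ℂ (symMonomial ℂ (fRoot w) '' admissible w m) ⊔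
      (permIdeal i m w).restrictScalars ℂ := by
  refine (Submodule.span_le.2 ?_ : Submodule.span ℂ (Set.range (symMonomial ℂ (fRoot w))) ≤ _)
    (span_symMonomial fRoot_span p)
  rintro _ ⟨s, rfl⟩
  obtain ⟨p, hp, q, hq, hpq⟩ := Submodule.mem_sup.1 (symMonomial_mem_span_sup (m := m) hw s)
  refine Submodule.mem_sup.2 ⟨p, Submodule.span_mono ?_ hp, q, hq, hpq⟩
  exact Set.image_mono fun t ht => ht.1

/-- An ideal containing the permanents is generated by them if the admissible monomials are
linearly independent modulo the ideal. -/
theorem le_permIdeal {M' : Type*} [AddCommGroup M'] [Module ℂ M'] (hw : IsMinimalRep i w)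
    {I : Ideal (SymmetricAlgebra ℂ (nMinusW w))} (hI : permIdeal i m w ≤ I)
    (F : SymmetricAlgebra ℂ (nMinusW w) →ₗ[ℂ] M') (hFI : ∀ p ∈ I, F p = 0)
    (hF : LinearIndependent ℂ fun s : admissible w m => F (symMonomial ℂ (fRoot w) s)) :
    I ≤ permIdeal i m w := by
  intro p hp
  obtain ⟨a, ha, b, hb, rfl⟩ := Submodule.mem_sup.1 (symMonomial_span_sup_permIdeal (m := m) hw p)
  have h1 : a ∈ I := (Submodule.add_mem_iff_left I (hI hb)).1 hp
  rw [eq_zero_of_linearIndependent F hF ha (hFI a h1), zero_add]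
  exact hb

theorem IsHighestWeightRep.vanishingIdeal_eq [FiniteDimensional ℂ V]
    (hv : IsHighestWeightRep i m ρ v) (h : i ≤ n + 1) (hw : IsMinimalRep i w) :
    vanishingIdeal i w ρ v = permIdeal i m w :=
  le_antisymm (le_permIdeal hw (hv.permIdeal_le_vanishingIdeal hw)
    ((LinearMap.applyₗ v).comp (opHom i w ρ).toLinearMap) (fun _ hp => hp)
    (hv.linearIndependent_orbitVec h hw.isBlock)) (hv.permIdeal_le_vanishingIdeal hw)

theorem IsHighestWeightRep.span_relations_eq [FiniteDimensional ℂ V]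
    (hv : IsHighestWeightRep i m ρ v) (h : i ≤ n + 1) (hw : IsMinimalRep i w) :
    Ideal.span {p | symIncl w p ∈ relations w m} = permIdeal i m w ∧
      Ideal.span {p | symIncl w p ∈ Submodule.span ℂ (relations w m)} = permIdeal i m w := by
  have h1 := permIdeal_le (m := m) hw
  have h2 : Ideal.span {p | symIncl w p ∈ relations w m} ≤
      Ideal.span {p | symIncl w p ∈ Submodule.span ℂ (relations w m)} :=
    Ideal.span_mono fun _ hp => Submodule.subset_span hp
  have h3 : Ideal.span {p | symIncl w p ∈ Submodule.span ℂ (relations w m)} ≤ permIdeal i m w := by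
    rw [← hv.vanishingIdeal_eq h hw]
    exact Ideal.span_le.2 fun _ hp => hv.mem_vanishingIdeal_of_symIncl hw.isBlock hp
  exact ⟨le_antisymm (h2.trans h3) h1, le_antisymm h3 (h1.trans h2)⟩

end MonomialBasis

/-! ### The PBW-graded module of `𝔫⁻_w` and its defining ideal -/

section NegativePart

variable {n i m : ℕ} {w : Weyl n} {V : Type*} [AddCommGroup V] [Module ℂ V]

/-- If `v` has weight `μ` and is killed by the positive root vectors, then `𝔟` acts on `v`
through `μ`. -/
theorem borel_apply_of_weight {ρ : SL n →ₗ⁅ℂ⁆ Module.End ℂ V} {v : V} {μ : Weight n}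
    (hd : ∀ A : SL n, A.1.IsDiag → ρ A v = weightValue μ A • v)
    (hu : ∀ (a b : Fin (n + 1)) (h : a < b), ρ (unit a b h.ne) v = 0) {B : SL n}
    (hB : B ∈ borel n) : ρ B v = weightValue μ B • v := by
  set U : SL n := maskPart (fun x y => x < y) (fun x => lt_irrefl x) B with hU
  have hUxy : ∀ x y, U.1 x y = if x < y then B.1 x y else 0 := fun _ _ => rfl
  have hU0 : ρ U v = 0 := by
    have h1 : U ∈ nPlus n := fun x y h => by rw [hUxy, if_neg h]
    have h2 := mem_span_unit (r := fun x y => x < y) (fun x => lt_irrefl x) h1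
    clear_value U
    clear hU hUxy h1
    induction h2 using Submodule.span_induction with
    | mem x hx =>
      obtain ⟨a, b, _, hab, rfl⟩ := hx
      exact hu a b hab
    | zero => rw [map_zero]; rfl
    | add x y _ _ hx hy => rw [map_add, LinearMap.add_apply, hx, hy, add_zero]
    | smul c x _ hx => rw [map_smul, LinearMap.smul_apply, hx, smul_zero]
  have hD : (B - U).1.IsDiag := fun x y hxy => by
    change B.1 x y - U.1 x y = 0
    rw [hUxy]
    split_ifs with h
    · exact sub_self _
    · rw [sub_zero]
      exact hB x y fun h' => h (lt_of_le_of_ne h' hxy)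
  have h3 := hd _ hD
  rw [map_sub, LinearMap.sub_apply, hU0, sub_zero] at h3
  rw [h3]
  congr 1
  refine Finset.sum_congr rfl fun a _ => ?_
  change _ * (B.1 a a - U.1 a a) = _
  rw [hUxy, if_neg (lt_irrefl a), sub_zero]

variable [LieRingModule (SL n) V] [LieModule ℂ (SL n) V]

theorem isIrreducibleRep_toEnd [LieModule.IsIrreducible ℂ (SL n) V] :
    IsIrreducibleRep (LieModule.toEnd ℂ (SL n) V) := by
  intro W hW
  let N : LieSubmodule ℂ (SL n) V := { W with lie_mem := fun {x y} hy => hW x y hy }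
  have hN : (N : Submodule ℂ V) = W := rfl
  rcases eq_bot_or_eq_top N with h | h
  · left
    rw [← hN, h, LieSubmodule.bot_toSubmodule]
  · right
    rw [← hN, h, LieSubmodule.top_toSubmodule]

theorem IsHighestWeightVector.isHighestWeightRep [LieModule.IsIrreducible ℂ (SL n) V] {v : V}
    (hv : IsHighestWeightVector ((m : ℤ) • fundWeight n i) v) :
    IsHighestWeightRep i m (LieModule.toEnd ℂ (SL n) V) v where
  irreducible := isIrreducibleRep_toEnd
  ne_zero := hv.ne_zero
  borel_apply _ := borel_apply_of_weight (fun A hA => hv.weight A hA)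
    fun _ _ h => hv.nPlus_lie _ (unit_mem _ _ h)

variable {v : V}

theorem isMonomialOrbit_fRoot (hw : IsBlock i w) :
    IsMonomialOrbit (fRoot w) v (orbitVec i w (LieModule.toEnd ℂ (SL n) V) v) where
  zero := orbitVec_zero
  lie α s := by
    rw [orbitVec_add_single hw]
    rfl

/-- The admissible monomials form a basis of the PBW-graded module of `𝔫⁻_w`. -/
theorem IsHighestWeightRep.basis_gr_nMinusW [FiniteDimensional ℂ V]
    (hv : IsHighestWeightRep i m (LieModule.toEnd ℂ (SL n) V) v) (h : i ≤ n + 1)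
    (hw : IsMinimalRep i w) :
    LinearIndependent ℂ (fun s : admissible w m =>
        symMonomial ℂ (fRoot w) s • grGen ℂ (nMinusW w) v) ∧
      Submodule.span ℂ (Set.range fun s : admissible w m =>
        symMonomial ℂ (fRoot w) s • grGen ℂ (nMinusW w) v) = ⊤ := by
  refine (isMonomialOrbit_fRoot hw.isBlock).basis_gr _ (fun z s => ?_)
    (hv.orbitVec_mem_span hw) (hv.linearIndependent_orbitVec h hw.isBlock)
  induction fRoot_span z using Submodule.span_induction with
  | mem x hx =>
    obtain ⟨α, rfl⟩ := hx
    rw [(isMonomialOrbit_fRoot hw.isBlock).lie]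
    refine Submodule.subset_span ⟨_, ?_, rfl⟩
    change (s + Finsupp.single α 1).degree ≤ s.degree + 1
    rw [map_add, Finsupp.degree_single]
  | zero => rw [zero_lie]; exact Submodule.zero_mem _
  | add x y _ _ hx hy => rw [add_lie]; exact Submodule.add_mem _ hx hy
  | smul c x _ hx => rw [smul_lie]; exact Submodule.smul_mem _ _ hx

/-- A homogeneous element of `S(L)` which annihilates `v` annihilates its class. -/
theorem IsMonomialOrbit.sum_smul_grGen_eq_zero {k R L M : Type*} [CommRing k] [Fintype R]
    [LieRing L] [LieAlgebra k L] [AddCommGroup M] [Module k M] [LieRingModule L M] [LieModule k L M]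
    {x : R → L} {v : M} {y : (R →₀ ℕ) → M} (h : IsMonomialOrbit x v y) {κ : Type*} (T : Finset κ)
    {d : ℕ} (e : κ → R →₀ ℕ) (hd : ∀ τ, (e τ).degree = d) (h0 : ∑ τ ∈ T, y (e τ) = 0) :
    (∑ τ ∈ T, symMonomial k x (e τ)) • grGen k L v = 0 := by
  choose h1 h2 using fun τ => h.smul_grGen (k := k) d (e τ) (hd τ)
  rw [Finset.sum_smul, Finset.sum_congr rfl fun τ _ => h2 τ, ← map_sum]
  have h3 : ∑ τ ∈ T, (⟨y (e τ), h1 τ⟩ : filtration k L v d) = 0 := by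
    refine Subtype.ext ?_
    rw [Submodule.coe_sum]
    exact h0
  rw [h3, map_zero]

theorem IsHighestWeightRep.permIdeal_le_definingIdeal [FiniteDimensional ℂ V]
    (hv : IsHighestWeightRep i m (LieModule.toEnd ℂ (SL n) V) v)
    (hw : IsMinimalRep i w) : permIdeal i m w ≤ definingIdeal w v := by
  refine Ideal.span_le.2 ?_
  rintro p ⟨α, a, b, h, hp⟩
  have h1 : p = ∑ τ, symMonomial ℂ (fRoot w) (permExponent hw h 0 τ) := by
    rw [hp]
    refine Finset.sum_congr rfl fun τ _ => ?_
    rw [symMonomial_permExponent, symMonomial_zero, one_mul]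
  have h2 : opHom i w (LieModule.toEnd ℂ (SL n) V) p v = 0 :=
    hv.permIdeal_le_vanishingIdeal hw (Ideal.subset_span ⟨α, a, b, h, hp⟩)
  rw [SetLike.mem_coe, Ideal.mem_torsionOf_iff, h1]
  refine (isMonomialOrbit_fRoot hw.isBlock).sum_smul_grGen_eq_zero _ _
    (fun τ => degree_permExponent hw h 0 τ) ?_
  rw [h1, map_sum, LinearMap.sum_apply] at h2
  exact h2

theorem IsHighestWeightRep.definingIdeal_eq [FiniteDimensional ℂ V]
    (hv : IsHighestWeightRep i m (LieModule.toEnd ℂ (SL n) V) v) (h : i ≤ n + 1)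
    (hw : IsMinimalRep i w) : definingIdeal w v = permIdeal i m w :=
  le_antisymm (le_permIdeal hw (hv.permIdeal_le_definingIdeal hw)
    ((LinearMap.toSpanSingleton (SymmetricAlgebra ℂ (nMinusW w)) (GrW w v)
      (grGen ℂ (nMinusW w) v)).restrictScalars ℂ) (fun _ hp => hp)
    (hv.basis_gr_nMinusW h hw).1) (hv.permIdeal_le_definingIdeal hw)

end NegativePart

/-! ### The PBW-graded Demazure module -/

section Demazure

variable {n i m : ℕ} {w : Weyl n} {V : Type*} [AddCommGroup V] [Module ℂ V]

/-- Conjugation with the permutation matrix of `w`. -/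
def conjPerm (w : Weyl n) : SL n →ₗ⁅ℂ⁆ SL n where
  toFun A := ⟨A.1.submatrix w.symm w.symm, by
    refine LinearMap.mem_ker.2 ((Matrix.traceLinearMap_apply _ _ _ _).trans ?_)
    have h : A.1.trace = 0 := LinearMap.mem_ker.1 A.2
    rw [← h]
    exact Equiv.sum_comp w.symm fun a => A.1 a a⟩
  map_add' A B := rfl
  map_smul' c A := rfl
  map_lie' {A B} := by
    refine Subtype.ext ?_
    change (A.1 * B.1 - B.1 * A.1).submatrix w.symm w.symm =
      A.1.submatrix w.symm w.symm * B.1.submatrix w.symm w.symm -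
        B.1.submatrix w.symm w.symm * A.1.submatrix w.symm w.symm
    rw [Matrix.submatrix_mul_equiv, Matrix.submatrix_mul_equiv]
    rfl

theorem conjPerm_apply (A : SL n) (x y : Fin (n + 1)) :
    (conjPerm w A).1 x y = A.1 (w.symm x) (w.symm y) := rfl

theorem conjPerm_conjPerm_inv (A : SL n) : conjPerm w (conjPerm w⁻¹ A) = A := by
  refine Subtype.ext (Matrix.ext fun x y => ?_)
  rw [conjPerm_apply, conjPerm_apply]
  change A.1 (w (w.symm x)) (w (w.symm y)) = _
  rw [Equiv.apply_symm_apply, Equiv.apply_symm_apply]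

theorem conjPerm_unit (a b : Fin (n + 1)) (h : a ≠ b) :
    conjPerm w (unit a b h) = unit (w a) (w b) (w.injective.ne h) := by
  refine Subtype.ext (Matrix.ext fun x y => ?_)
  rw [conjPerm_apply]
  change Matrix.single a b (1 : ℂ) _ _ = Matrix.single (w a) (w b) (1 : ℂ) x y
  simp only [Matrix.single_apply, Equiv.eq_symm_apply]

/-- Twisting with `w` turns an extremal weight vector into a highest weight vector. -/
theorem IsHighestWeightRep.conjPerm {ρ : SL n →ₗ⁅ℂ⁆ Module.End ℂ V} {v vw : V}
    (hv : IsHighestWeightRep i m ρ v) (h : i ≤ n + 1) (hvw0 : vw ≠ 0)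
    (hvw : ∀ A : SL n, A.1.IsDiag →
      ρ A vw = weightValue (actWeight w ((m : ℤ) • fundWeight n i)) A • vw) :
    IsHighestWeightRep i m (ρ.comp (conjPerm w)) vw where
  irreducible W hW := hv.irreducible W fun A y hy => by
    have h1 := hW (PBW.conjPerm w⁻¹ A) y hy
    rwa [LieHom.comp_apply, conjPerm_conjPerm_inv] at h1
  ne_zero := hvw0
  borel_apply B := by
    refine borel_apply_of_weight (fun A hA => ?_) fun a b hab => ?_
    · have h1 : (PBW.conjPerm w A).1.IsDiag := fun x y hxy => hA (w.symm.injective.ne hxy)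
      rw [LieHom.comp_apply, hvw _ h1]
      congr 1
      exact Equiv.sum_comp w.symm fun a => ((((m : ℤ) • fundWeight n i) a : ℤ) : ℂ) * A.1 a a
    · rw [LieHom.comp_apply, conjPerm_unit]
      refine hv.unit_apply_eq_zero h w hvw _ _ _ ?_
      have h1 : w⁻¹ (w a) = a := w.symm_apply_apply a
      have h2 : w⁻¹ (w b) = b := w.symm_apply_apply b
      have h3 : (a : ℕ) < b := hab
      rw [h1, h2]
      omega

variable {ρ : SL n →ₗ⁅ℂ⁆ Module.End ℂ V} {v : V}

/-- The span of the vectors `f^s v` with `s` of degree at most `d`. -/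
def degreeSpan (i : ℕ) (w : Weyl n) (ρ : SL n →ₗ⁅ℂ⁆ Module.End ℂ V) (v : V) (d : ℕ) :
    Submodule ℂ V :=
  Submodule.span ℂ (orbitVec i w ρ v '' {t | t.degree ≤ d})

theorem orbitVec_mem_degreeSpan {s : RootsNeg w →₀ ℕ} {d : ℕ} (h : s.degree ≤ d) :
    orbitVec i w ρ v s ∈ degreeSpan i w ρ v d :=
  Submodule.subset_span ⟨s, h, rfl⟩

theorem apply_fRoot_mem_degreeSpan (hw : IsBlock i w) (F : nMinusW w) {d : ℕ} {p : V}
    (hp : p ∈ degreeSpan i w ρ v d) : ρ F p ∈ degreeSpan i w ρ v (d + 1) := by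
  induction hp using Submodule.span_induction with
  | mem p hp =>
    obtain ⟨s, hs, rfl⟩ := hp
    induction fRoot_span F using Submodule.span_induction with
    | mem x hx =>
      obtain ⟨α, rfl⟩ := hx
      rw [← orbitVec_add_single hw]
      refine orbitVec_mem_degreeSpan ?_
      rw [map_add, Finsupp.degree_single]
      exact Nat.add_le_add_right hs 1
    | zero =>
      change ρ 0 _ ∈ _
      rw [map_zero]; exact Submodule.zero_mem _
    | add x y _ _ hx hy =>
      change ρ (x + y : SL n) _ ∈ _
      rw [map_add]; exact Submodule.add_mem _ hx hy
    | smul c x _ hx =>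
      change ρ (c • (x : SL n)) _ ∈ _
      rw [map_smul]; exact Submodule.smul_mem _ _ hx
  | zero => rw [map_zero]; exact Submodule.zero_mem _
  | add x y _ _ hx hy => rw [map_add]; exact Submodule.add_mem _ hx hy
  | smul c x _ hx => rw [map_smul]; exact Submodule.smul_mem _ _ hx

/-- The subalgebra `w⁻¹ 𝔟 w`. -/
def twistedBorel (w : Weyl n) : LieSubalgebra ℂ (SL n) :=
  supported (fun x y => w x ≤ w y) (fun _ _ _ => le_trans)

theorem nMinusW_le_twistedBorel : nMinusW w ≤ twistedBorel w :=
  fun _ hA x y h => hA x y fun h' => h h'.2.le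

theorem exists_eq_add_of_mem_twistedBorel {A : SL n} (hA : A ∈ twistedBorel w) :
    ∃ F : nMinusW w, ∃ B ∈ borel n, B ∈ twistedBorel w ∧ A = F + B := by
  have hF : (lowerPart A : SL n) ∈ nMinusW w := by
    intro x y h
    change (if y < x then A.1 x y else 0) = 0
    split_ifs with h1
    · exact hA x y fun h2 => h ⟨h1, lt_of_le_of_ne h2 (w.injective.ne h1.ne')⟩
    · rfl
  refine ⟨⟨lowerPart A, hF⟩, A - lowerPart A, fun x y hxy => ?_,
    (twistedBorel w).sub_mem hA (nMinusW_le_twistedBorel hF), by simp⟩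
  change A.1 x y - (if y < x then A.1 x y else 0) = 0
  rw [if_pos (not_le.1 hxy), sub_self]

/-- The subalgebra `𝔟 ∩ w⁻¹ 𝔟 w` preserves the degree filtration. -/
theorem IsHighestWeightRep.apply_orbitVec_mem_degreeSpan (hv : IsHighestWeightRep i m ρ v)
    (hw : IsBlock i w) (d : ℕ) : ∀ s : RootsNeg w →₀ ℕ, s.degree = d → ∀ B ∈ borel n,
      B ∈ twistedBorel w → ρ B (orbitVec i w ρ v s) ∈ degreeSpan i w ρ v d := by
  induction d with
  | zero =>
    intro s hs B hB _
    obtain rfl : s = 0 := (Finsupp.degree_eq_zero_iff s).1 hs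
    have h0 := orbitVec_mem_degreeSpan (i := i) (ρ := ρ) (v := v) (s := (0 : RootsNeg w →₀ ℕ))
      (d := 0) (by simp)
    rw [orbitVec_zero] at h0 ⊢
    rw [hv.borel_apply B hB]
    exact Submodule.smul_mem _ _ h0
  | succ d ih =>
    intro s hs B hB hB'
    obtain ⟨t, α, rfl, ht⟩ := exists_eq_add_single_of_degree_eq_succ hs
    have hmono : degreeSpan i w ρ v d ≤ degreeSpan i w ρ v (d + 1) :=
      Submodule.span_mono (Set.image_mono fun u (hu : u.degree ≤ d) => Nat.le_succ_of_le hu)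
    rw [orbitVec_add_single hw, map_lie_apply]
    refine Submodule.add_mem _ (apply_fRoot_mem_degreeSpan hw _ (ih t ht B hB hB')) ?_
    obtain ⟨F, C, hC, hC', h1⟩ := exists_eq_add_of_mem_twistedBorel
      ((twistedBorel w).lie_mem hB' (nMinusW_le_twistedBorel (fRoot w α).2))
    rw [h1, map_add]
    exact Submodule.add_mem _
      (apply_fRoot_mem_degreeSpan hw F (orbitVec_mem_degreeSpan ht.le)) (hmono (ih t ht C hC hC'))

theorem IsHighestWeightRep.apply_orbitVec_mem_degreeSpan_succ (hv : IsHighestWeightRep i m ρ v)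
    (hw : IsBlock i w) (s : RootsNeg w →₀ ℕ) {A : SL n} (hA : A ∈ twistedBorel w) :
    ρ A (orbitVec i w ρ v s) ∈ degreeSpan i w ρ v (s.degree + 1) := by
  obtain ⟨F, B, hB, hB', rfl⟩ := exists_eq_add_of_mem_twistedBorel hA
  have hmono : degreeSpan i w ρ v s.degree ≤ degreeSpan i w ρ v (s.degree + 1) :=
    Submodule.span_mono (Set.image_mono fun u (hu : u.degree ≤ s.degree) => Nat.le_succ_of_le hu)
  rw [map_add]
  exact Submodule.add_mem _ (apply_fRoot_mem_degreeSpan hw F (orbitVec_mem_degreeSpan le_rfl))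
    (hmono (hv.apply_orbitVec_mem_degreeSpan hw _ s rfl B hB hB'))

variable [LieRingModule (SL n) V] [LieModule ℂ (SL n) V]

theorem isMonomialOrbit_eRoot (hw : IsBlock i w) {vw : V} : IsMonomialOrbit (eRoot w) vw
    (orbitVec i w ((LieModule.toEnd ℂ (SL n) V).comp (conjPerm w)) vw) where
  zero := orbitVec_zero
  lie α s := by
    rw [orbitVec_add_single hw, LieHom.comp_apply]
    change _ = LieModule.toEnd ℂ (SL n) V (conjPerm w (unit _ _ _)) _
    rw [conjPerm_unit]
    rfl

/-- The admissible monomials form a basis of the PBW-graded Demazure module. -/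
theorem IsHighestWeightRep.basis_gr_borel [FiniteDimensional ℂ V] {vw : V}
    (hv : IsHighestWeightRep i m ((LieModule.toEnd ℂ (SL n) V).comp (PBW.conjPerm w)) vw)
    (h : i ≤ n + 1) (hw : IsMinimalRep i w) :
    LinearIndependent ℂ (fun s : admissible w m =>
        symMonomial ℂ (eRoot w) s • grGen ℂ (borel n) vw) ∧
      Submodule.span ℂ (Set.range fun s : admissible w m =>
        symMonomial ℂ (eRoot w) s • grGen ℂ (borel n) vw) = ⊤ := by
  refine (isMonomialOrbit_eRoot hw.isBlock).basis_gr _ (fun z s => ?_)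
    (hv.orbitVec_mem_span hw) (hv.linearIndependent_orbitVec h hw.isBlock)
  have h1 : PBW.conjPerm w⁻¹ z ∈ twistedBorel w := fun x y hxy => z.2 (w x) (w y) hxy
  have h2 := hv.apply_orbitVec_mem_degreeSpan_succ hw.isBlock s h1
  rw [LieHom.comp_apply, conjPerm_conjPerm_inv] at h2
  exact h2

end Demazure

/-! ### Reindexing by lattice points -/

section LatticePoints

variable {n i m : ℕ} {w : Weyl n}

theorem fMonomial_eq (hw : IsMinimalRep i w) (s : LatticePoints i m w) :
    fMonomial i w s.1 = symMonomial ℂ (fRoot w) (latticePointsEquiv hw m s).1 := by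
  unfold fMonomial symMonomial
  exact Finset.prod_congr rfl fun α _ => by rw [latticePointsEquiv_apply]

theorem eMonomial_eq (hw : IsMinimalRep i w) (s : LatticePoints i m w) :
    eMonomial i w s.1 = symMonomial ℂ (eRoot w) (latticePointsEquiv hw m s).1 := by
  unfold eMonomial symMonomial
  exact Finset.prod_congr rfl fun α _ => by rw [latticePointsEquiv_apply]

theorem basis_comp_equiv {k M κ κ' : Type*} [CommRing k] [AddCommGroup M] [Module k M]
    {f : κ → M} (e : κ' ≃ κ)
    (h : LinearIndependent k f ∧ Submodule.span k (Set.range f) = ⊤) {g : κ' → M}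
    (hg : ∀ s, g s = f (e s)) :
    LinearIndependent k g ∧ Submodule.span k (Set.range g) = ⊤ := by
  obtain rfl : g = f ∘ e := funext hg
  exact ⟨h.1.comp _ e.injective, by rw [e.surjective.range_comp]; exact h.2⟩

end LatticePoints

end PBW

end

theorem theorem3p1 (n i m : ℕ) (hi : 1 ≤ i) (hin : i ≤ n)
    (w : PBW.Weyl n) (hw : PBW.IsMinimalRep i w)
    {V : Type*} [AddCommGroup V] [Module ℂ V] [FiniteDimensional ℂ V]
    [LieRingModule (PBW.SL n) V] [LieModule ℂ (PBW.SL n) V]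
    [LieModule.IsIrreducible ℂ (PBW.SL n) V]
    (v : V) (hv : PBW.IsHighestWeightVector ((m : ℤ) • PBW.fundWeight n i) v)
    (vw : V) (hvw0 : vw ≠ 0)
    (hvw : PBW.HasWeight (PBW.actWeight w ((m : ℤ) • PBW.fundWeight n i)) vw) :
    -- the monomials applied to the highest weight vector form a basis
    (LinearIndependent ℂ (fun s : PBW.LatticePoints i m w =>
        (PBW.fMonomial i w s.1 • PBW.grGen ℂ (PBW.nMinusW w) v : PBW.GrW w v)) ∧
      Submodule.span ℂ (Set.range (fun s : PBW.LatticePoints i m w =>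
        (PBW.fMonomial i w s.1 • PBW.grGen ℂ (PBW.nMinusW w) v : PBW.GrW w v))) = ⊤) ∧
    -- the corresponding monomials form a basis of the graded Demazure module
    (LinearIndependent ℂ (fun s : PBW.LatticePoints i m w =>
        (PBW.eMonomial i w s.1 • PBW.grGen ℂ (PBW.borel n) vw : PBW.GrDemazure vw)) ∧
      Submodule.span ℂ (Set.range (fun s : PBW.LatticePoints i m w =>
        (PBW.eMonomial i w s.1 • PBW.grGen ℂ (PBW.borel n) vw : PBW.GrDemazure vw))) = ⊤) ∧
    -- generators of the defining ideal
    (PBW.definingIdeal w v =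
        Ideal.span {p | PBW.symIncl w p ∈ PBW.relations w m} ∧
      PBW.definingIdeal w v =
        Ideal.span {p | PBW.symIncl w p ∈ Submodule.span ℂ (PBW.relations w m)}) := by
  have h : i ≤ n + 1 := hin.trans (Nat.le_succ n)
  have hv' := hv.isHighestWeightRep
  have hvw' := hv'.conjPerm h hvw0 hvw
  obtain ⟨h1, h2⟩ := hv'.span_relations_eq h hw
  refine ⟨PBW.basis_comp_equiv (PBW.latticePointsEquiv hw m) (hv'.basis_gr_nMinusW h hw)
      fun s => by rw [PBW.fMonomial_eq hw],
    PBW.basis_comp_equiv (PBW.latticePointsEquiv hw m) (hvw'.basis_gr_borel h hw)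
      fun s => by rw [PBW.eMonomial_eq hw], ?_, ?_⟩
  · rw [h1, hv'.definingIdeal_eq h hw]
  · rw [h2, hv'.definingIdeal_eq h hw]
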